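/- **Theorem (Isoperimetric inequality for the one-mode quantum-limited attenuator).** Let $\mathcal H=\ell^2(\mathbb N,\mathbb C)$ be the Hilbert space of one harmonic oscillator, with Fock basis $\{|n\rangle\}_{n\in\mathbb N}$ and ladder operator $\hat a\,|n\rangle=\sqrt n\,|n-1\rangle$. For $0<\lambda\le 1$ let $$\Phi_\lambda(\hat X)=\mathrm{Tr}_E\left[\hat U_\lambda\left(\hat X\otimes|0\rangle_E\langle 0|\right)\hat U_\lambda^\dagger\right],\qquad \hat U_\lambda=\exp\left[\arccos\sqrt{\lambda}\;\left(\hat a^\dagger\hat e-\hat e^\dagger\hat a\right)\right],$$ be the quantum-limited attenuator, where $E$ is a second mode with ladder operator $\hat e$ and vacuum $|0\rangle_E$. For a quantum state (positive operator of trace one) $\hat\sigma$ on $\mathcal H$ let $S(\hat\sigma)=-\mathrm{Tr}[\hat\sigma\ln\hat\sigma]\in[0,\infty]$ be its von Neumann entropy. Let $g(E)=(E+1)\ln(E+1)-E\ln E$ for $E\ge 0$ (with $0\ln 0=0$), a bijection of $[0,\infty)$ with inverse $g^{-1}$, and $$f(S)=-g^{-1}(S)\,g'\left(g^{-1}(S)\right)\quad(S>0),\qquad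 f(0)=0.$$ Let $\hat\rho$ be a quantum state with finite support, i.e. such that the orthogonal complement of its kernel is finite-dimensional. Then $S(\hat\rho)<\infty$, the right derivative $$\left.\frac{d}{dt}S\left(\Phi_{e^{-t}}(\hat\rho)\right)\right|_{t=0}=\lim_{t\to0^+}\frac{S\left(\Phi_{e^{-t}}(\hat\rho)\right)-S\left(\Phi_{1}(\hat\rho)\right)}{t}$$ exists as an extended real number, and $$\left.\frac{d}{dt}S\left(\Phi_{e^{-t}}(\hat\rho)\right)\right|_{t=0}\ \ge\ f\left(S(\hat\rho)\right).$$ -/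

import Mathlib

open Filter Topology

noncomputable section

namespace QuantumAttenuator

/-! ### One bosonic mode -/

/-- The Hilbert space of one harmonic oscillator, in its Fock representation `ℓ²(ℕ, ℂ)`. -/
abbrev Mode : Type := lp (fun _ : ℕ => ℂ) 2

/-- The Fock (number) basis vector `|n⟩`. -/
def fock (n : ℕ) : Mode := lp.single 2 n (1 : ℂ)

/-- A quantum state (density operator): a positive operator of trace one.  (For a positive operator
the trace is the sum of its diagonal entries in any orthonormal basis.) -/
structure IsState (ρ : Mode →L[ℂ] Mode) : Prop where
  isPositive : ρ.IsPositive
  trace_eq_one : HasSum (fun n => inner ℂ (fock n) (ρ (fock n))) 1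

/-- An operator has finite support if its support, the orthogonal complement of its kernel, is
finite-dimensional; for a self-adjoint operator this says that its range is finite-dimensional.
(The support is not required to be spanned by Fock vectors.) -/
def HasFiniteSupport (ρ : Mode →L[ℂ] Mode) : Prop :=
  FiniteDimensional ℂ ((LinearMap.ker (ρ : Mode →ₗ[ℂ] Mode))ᗮ : Submodule ℂ Mode)

/-- The von Neumann entropy `S(ρ) = Tr[η(ρ)] = - Tr[ρ ln ρ]` with `η(x) = - x ln x`, `η(0) = 0`, in
`[0, ∞]`.  The operator `η(ρ)` is given by the continuous functional calculus for
normal operators; it is positive for every state `ρ`, whose spectrum lies in `[0, 1]`. -/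
def entropy (ρ : Mode →L[ℂ] Mode) : ENNReal :=
  ∑' n : ℕ, ENNReal.ofReal
    (inner ℂ (fock n) ((cfc (fun z : ℂ => (Real.negMulLog z.re : ℂ)) ρ) (fock n))).re

/-! ### The beam splitter -/

/-- The matrix element `⟨m| a |n⟩` of the ladder operator, `a |n⟩ = √n |n-1⟩`.
Then `⟨m| a† |n⟩ = ladder n m`. -/
def ladder (m n : ℕ) : ℂ := if m + 1 = n then ((√(n : ℝ) : ℝ) : ℂ) else 0

/-- The restriction of the mode mixing generator `a† e - e† a` of the system mode `a` and of the
environment mode `e` to the sector of total photon number `M`, which it leaves invariant and which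
is spanned by the vectors `|i⟩_A ⊗ |j⟩_E` with `i + j = M`. -/
def modeMixing (M : ℕ) :
    Matrix (Finset.HasAntidiagonal.antidiagonal M) (Finset.HasAntidiagonal.antidiagonal M) ℂ :=
  Matrix.of fun p q =>
    ladder q.1.1 p.1.1 * ladder p.1.2 q.1.2 - ladder p.1.1 q.1.1 * ladder q.1.2 p.1.2

/-- The restriction of the beam splitter unitary `U = exp(θ (a† e - e† a))`, `θ = arccos √lam`, to
the sector of total photon number `M`.  For `0 < lam ≤ 1` one has
`θ = arctan √((1 - lam) / lam)`. It satisfies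
`U† a U = √lam a + √(1 - lam) e` and `U† e U = - √(1 - lam) a + √lam e`. -/
def beamSplitter (lam : ℝ) (M : ℕ) :
    Matrix (Finset.HasAntidiagonal.antidiagonal M) (Finset.HasAntidiagonal.antidiagonal M) ℂ :=
  NormedSpace.exp (((Real.arccos (√lam) : ℝ) : ℂ) • modeMixing M)

theorem modeMixing_mem_skewAdjoint (M : ℕ) :
    star (modeMixing M) = - modeMixing M := by
  ext p q
  have h : ∀ m n, star (ladder m n) = ladder m n := by
    intro m n
    unfold ladder
    split_ifs <;> simp
  simp only [Matrix.star_apply, Matrix.neg_apply, modeMixing, Matrix.of_apply, star_sub, star_mul',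
    h]
  ring

theorem beamSplitter_mem_unitaryGroup (lam : ℝ) (M : ℕ) :
    beamSplitter lam M ∈ Matrix.unitaryGroup (Finset.HasAntidiagonal.antidiagonal M) ℂ := by
  set A := ((Real.arccos (√lam) : ℝ) : ℂ) • modeMixing M with hA
  have hstar : star A = -A := by
    rw [hA, star_smul, modeMixing_mem_skewAdjoint, smul_neg]
    simp
  have h1 : star (NormedSpace.exp A) = NormedSpace.exp (-A) := by
    rw [← hstar, Matrix.star_eq_conjTranspose, Matrix.star_eq_conjTranspose,
      Matrix.exp_conjTranspose]
  rw [Matrix.mem_unitaryGroup_iff]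
  change NormedSpace.exp A * star (NormedSpace.exp A) = 1
  rw [h1, ← Matrix.exp_add_of_commute _ _ (Commute.neg_right (Commute.refl A)), add_neg_cancel,
    NormedSpace.exp_zero]

/-- The matrix element `⟨m|_A ⟨l|_E U |m+l⟩_A |0⟩_E` of the beam splitter unitary. -/
def krausCoeff (lam : ℝ) (l m : ℕ) : ℂ :=
  beamSplitter lam (m + l) ⟨(m, l), by simp⟩ ⟨(m + l, 0), by simp⟩

theorem norm_krausCoeff_le_one (lam : ℝ) (l m : ℕ) : ‖krausCoeff lam l m‖ ≤ 1 :=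
  entry_norm_bound_of_unitary (beamSplitter_mem_unitaryGroup lam (m + l)) _ _

/-! ### The quantum-limited attenuator -/

theorem summable_norm_sq (ψ : Mode) : Summable fun m => ‖ψ m‖ ^ 2 := by
  have h := (lp.hasSum_norm (p := 2) (by norm_num) ψ).summable
  simpa using h

theorem weightedShift_memlp (l : ℕ) (c : ℕ → ℂ) (hc : ∀ m, ‖c m‖ ≤ 1) (ψ : Mode) :
    Memℓp (fun m => c m * ψ (m + l)) 2 := by
  refine memℓp_gen ?_
  have hs : Summable fun m => ‖ψ (m + l)‖ ^ 2 := (summable_nat_add_iff l).2 (summable_norm_sq ψ)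
  have h : Summable fun m => ‖c m * ψ (m + l)‖ ^ 2 := by
    refine Summable.of_nonneg_of_le (fun m => by positivity) (fun m => ?_) hs
    rw [norm_mul]
    have := mul_le_of_le_one_left (norm_nonneg (ψ (m + l))) (hc m)
    gcongr
  simpa using h

/-- The bounded operator `∑ m, c m |m⟩⟨m + l|`, for coefficients bounded by one. -/
def weightedShift (l : ℕ) (c : ℕ → ℂ) (hc : ∀ m, ‖c m‖ ≤ 1) : Mode →L[ℂ] Mode :=
  LinearMap.mkContinuous
    { toFun := fun ψ => ⟨fun m => c m * ψ (m + l), weightedShift_memlp l c hc ψ⟩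
      map_add' := fun ψ φ => by
        ext m
        exact mul_add _ _ _
      map_smul' := fun z ψ => by
        ext m
        exact mul_left_comm _ _ _ } 1 (fun ψ => by
    refine lp.norm_le_of_forall_sum_le (by norm_num) (by positivity) (fun s => ?_)
    have h2 : ((2 : ENNReal).toReal) = ((2 : ℕ) : ℝ) := by norm_num
    have hψ := lp.norm_rpow_eq_tsum (p := 2) (by norm_num) ψ
    rw [one_mul, hψ]
    simp only [h2, Real.rpow_natCast]
    have hs : Summable fun m => ‖ψ (m + l)‖ ^ 2 := (summable_nat_add_iff l).2 (summable_norm_sq ψ)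
    calc ∑ m ∈ s, ‖c m * ψ (m + l)‖ ^ 2 ≤ ∑ m ∈ s, ‖ψ (m + l)‖ ^ 2 := by
          refine Finset.sum_le_sum fun m _ => ?_
          rw [norm_mul]
          have := mul_le_of_le_one_left (norm_nonneg (ψ (m + l))) (hc m)
          gcongr
      _ ≤ ∑' m, ‖ψ (m + l)‖ ^ 2 := hs.sum_le_tsum s (fun m _ => by positivity)
      _ ≤ ∑' m, ‖ψ m‖ ^ 2 :=
          hs.tsum_le_tsum_of_inj (fun m => m + l) (add_left_injective l)
            (fun m _ => by positivity) (fun m => le_refl _) (summable_norm_sq ψ))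

/-- The operator `B_l = ⟨l|_E U |0⟩_E` on the system mode.  As `U` preserves the total photon
number, `B_l = ∑ m, ⟨m|⟨l| U |m+l⟩|0⟩ |m⟩⟨m+l|`. -/
def kraus (lam : ℝ) (l : ℕ) : Mode →L[ℂ] Mode :=
  weightedShift l (krausCoeff lam l) (norm_krausCoeff_le_one lam l)

/-- The one-mode quantum-limited attenuator `Φ_lam(X) = Tr_E[U (X ⊗ |0⟩⟨0|_E) U†]`, with the partial
trace over the environment evaluated in its Fock basis:
`Tr_E[U (X ⊗ |0⟩⟨0|_E) U†] = ∑ l, ⟨l|_E U |0⟩_E X ⟨0|_E U† |l⟩_E`.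
For every trace-class `X` the series converges absolutely. -/
def attenuator (lam : ℝ) (X : Mode →L[ℂ] Mode) : Mode →L[ℂ] Mode :=
  ∑' l : ℕ, kraus lam l * X * star (kraus lam l)

/-! ### The functions in the isoperimetric inequality -/

/-- The entropy `g(E)` of the thermal Gaussian state with average photon number `E`. -/
def g (E : ℝ) : ℝ := (E + 1) * Real.log (E + 1) - E * Real.log E

/-- The inverse of the bijection `g : [0, ∞) → [0, ∞)`. -/
def gInv (S : ℝ) : ℝ := Function.invFunOn g (Set.Ici 0) S

/-- `f(S) = - g⁻¹(S) g'(g⁻¹(S))`.  At `S = 0`, where `g⁻¹(S) = 0`, the value is `0`, which is the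
continuous extension. -/
def f (S : ℝ) : ℝ := - gInv S * deriv g (gInv S)

/-- `D ∈ [-∞, ∞]` is the right derivative of the extended real function `φ` at `x`, i.e. the limit
of its difference quotients from the right. -/
def HasRightDeriv (φ : ℝ → EReal) (D : EReal) (x : ℝ) : Prop :=
  Tendsto (fun t : ℝ => (φ t - φ x) / ((t - x : ℝ) : EReal)) (𝓝[>] x) (𝓝 D)

end QuantumAttenuator

end

/-!
The idea is to compute the derivative explicitly when it is finite, and to reduce the inequality to
one about the eigenvalues `p₀ ≥ p₁ ≥ … > 0` of the state `ρ = ∑ i, p_i |ψ_i⟩⟨ψ_i|`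
(`exists_spectral_decomposition`). Solving the linear differential equation of the beam splitter on
each sector of fixed photon number gives the Kraus operators `B_l`, which remove `l` photons
(`krausCoeff_eq`); on the domain of the ladder operator `a` they satisfy
`B_{l+1} = - √((1 - λ) / (l + 1)) B_l a` (`kraus_succ_of_isLowering`). Everything depends on whether
the support `V` of `ρ` is invariant under `a`.

*Invariant support.* Here `a` acts on `V` by a matrix `A`, and `V` is in the domain of every power
of `a`. The output lives on `B_0 V`, which makes an angle of order `t` with `V`, so that up to
`O(t²)` the output entropy is that of its diagonal in the basis `ψ`, and the populations move at the
rates of a jump process with rate `|A i j|²` from `j` to `i`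
(`hasRightDeriv_entropy_of_isInvariant`). The tangent of `η(x) = - x ln x` and its quadratic
correction, applied to operators, replace perturbation theory of eigenvalues. The commutation
relation `a a† = a† a + 1`, compressed to `V`, says that the rate into each level exceeds the rate
out of it by at most one (`row_le_one_add_column`). Writing `ln p_i - ln p_j` as a sum over the
levels between, one finds that under this constraint the entropy drops at most as fast as for the
pure death process `n + 1 → n` at rate `n + 1` (`sum_rate_mul_log_le`). For that process, the
log-sum inequality against a shift by one bounds the entropy loss through the tails of `p`, and
the chain rule together with convexity of `ln (1 + g⁻¹)` bounds the result by that of the geometric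
distribution of the same entropy (`sum_succ_mul_log_le`), which is `- f(S(ρ))`.

*Otherwise* the derivative is `+∞` (`hasRightDeriv_entropy_top_of_not_isInvariant`). Let `δ` be the
probability of losing at least one photon. If a fixed fraction of `δ` leads out of the support
`B_0 V` of the no-loss part, then these events contribute `δ ln (1 / δ)` to the entropy up to a
factor, while everything else costs only `O(δ)` (`le_entropy_output`); as `δ` is at least of order
`t`, the difference quotient diverges (`hasRightDeriv_entropy_top`). If the mean photon number is
finite, a single loss maps some `ψ_j` to a multiple of `B_0 a ψ_j` with `a ψ_j ∉ V`
(`hasRightDeriv_entropy_top_of_notMem`). If it is infinite, then `δ / t → ∞`, whereas losses that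
end with few photons have probability `O(t)` and `B_0 V` is concentrated on few photons
(`hasRightDeriv_entropy_top_of_not_summable`).
-/

noncomputable section

namespace QuantumAttenuator

/-! ### The Kraus coefficients of the beam splitter -/

section MatrixNorm

open scoped Matrix.Norms.Operator

/-- A matrix-valued solution of `C' = A C` is the exponential flow of its initial value. -/
theorem eq_exp_mul_of_hasDerivAt {ι : Type*} [Fintype ι] [DecidableEq ι] (A : Matrix ι ι ℂ)
    (C : ℝ → Matrix ι ι ℂ) (hC : ∀ θ, HasDerivAt C (A * C θ) θ) (θ : ℝ) :
    C θ = NormedSpace.exp ((θ : ℂ) • A) * C 0 := by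
  have hcoe : ∀ (r : ℝ) (B : Matrix ι ι ℂ), (r : ℂ) • B = r • B := fun r B => by
    ext i j; simp
  have h1 : ∀ u : ℝ, HasDerivAt (fun u : ℝ => NormedSpace.exp (u • (-A)) * C u) 0 u := by
    intro u
    have := (hasDerivAt_exp_smul_const (𝕂 := ℝ) (-A) u).mul (hC u)
    exact this.congr_deriv (by noncomm_ring)
  have h2 := is_const_of_deriv_eq_zero (fun u => (h1 u).differentiableAt)
    (fun u => (h1 u).deriv) θ 0
  simp only [zero_smul, NormedSpace.exp_zero, one_mul] at h2
  rw [← h2, hcoe, ← mul_assoc, ← Matrix.exp_add_of_commute]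
  · simp
  · simp [Commute, SemiconjBy]

/-- The amplitudes `⟨i|⟨j| U |i+j⟩|0⟩` of the beam splitter of angle `θ`. -/
def binomialAmplitude (M : ℕ) (θ : ℝ) (p : Finset.HasAntidiagonal.antidiagonal M) : ℝ :=
  (-1) ^ p.1.2 * √(M.choose p.1.2) * Real.cos θ ^ p.1.1 * Real.sin θ ^ p.1.2

theorem sqrt_mul_sqrt_mul_sqrt_choose (i j : ℕ) :
    √((i + 1 : ℕ) : ℝ) * √((j + 1 : ℕ) : ℝ) * √(((i + 1 + j).choose (j + 1) : ℕ) : ℝ)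
      = (i + 1) * √(((i + 1 + j).choose j : ℕ) : ℝ) := by
  have h : ((i + 1 + j).choose (j + 1)) * (j + 1) = ((i + 1 + j).choose j) * (i + 1) := by
    have := Nat.choose_succ_right_eq (i + 1 + j) j
    rwa [Nat.add_sub_cancel] at this
  rw [← Real.sqrt_mul (by positivity), ← Real.sqrt_mul (by positivity)]
  have h' : (((i + 1 + j).choose (j + 1) : ℕ) : ℝ) * ((j + 1 : ℕ) : ℝ)
      = (((i + 1 + j).choose j : ℕ) : ℝ) * ((i + 1 : ℕ) : ℝ) := by exact_mod_cast h
  have h2 : ((i + 1 : ℕ) : ℝ) * ((j + 1 : ℕ) : ℝ) * (((i + 1 + j).choose (j + 1) : ℕ) : ℝ)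
      = ((i : ℝ) + 1) ^ 2 * (((i + 1 + j).choose j : ℕ) : ℝ) := by
    rw [mul_assoc, mul_comm ((j + 1 : ℕ) : ℝ), h']; push_cast; ring
  rw [h2, Real.sqrt_mul (by positivity), Real.sqrt_sq (by positivity)]

theorem hasDerivAt_binomialAmplitude (M : ℕ) (θ : ℝ)
    (p : Finset.HasAntidiagonal.antidiagonal M) :
    HasDerivAt (fun θ => ((binomialAmplitude M θ p : ℝ) : ℂ))
      (∑ q, modeMixing M p q * ((binomialAmplitude M θ q : ℝ) : ℂ)) θ := by
  obtain ⟨⟨i, j⟩, hp⟩ := p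
  obtain rfl : i + j = M := by simpa using hp
  have hd : HasDerivAt (fun θ => binomialAmplitude (i + j) θ ⟨(i, j), hp⟩)
      ((-1) ^ j * √((i + j).choose j) *
        (-(i : ℝ) * Real.cos θ ^ (i - 1) * Real.sin θ ^ (j + 1)
          + j * Real.cos θ ^ (i + 1) * Real.sin θ ^ (j - 1))) θ := by
    have h1 := (Real.hasDerivAt_cos θ).pow i
    have h2 := (Real.hasDerivAt_sin θ).pow j
    have h3 := (h1.mul h2).const_mul ((-1 : ℝ) ^ j * √((i + j).choose j))
    refine (h3.congr_deriv ?_).congr_of_eventuallyEq (Eventually.of_forall fun x => ?_)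
    · simp only [Pi.pow_apply]; ring
    · simp only [binomialAmplitude, Pi.mul_apply, Pi.pow_apply]; ring
  refine hd.ofReal_comp.congr_deriv ?_
  have hsplit : ∀ q : Finset.HasAntidiagonal.antidiagonal (i + j),
      modeMixing (i + j) ⟨(i, j), hp⟩ q * ((binomialAmplitude (i + j) θ q : ℝ) : ℂ)
      = ((fun r : ℕ × ℕ => (ladder r.1 i * ladder j r.2 - ladder i r.1 * ladder r.2 j) *
        (((-1) ^ r.2 * √((i + j).choose r.2) * Real.cos θ ^ r.1 * Real.sin θ ^ r.2 : ℝ) : ℂ))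
          q.1) :=
    fun q => rfl
  rw [Finset.sum_congr rfl fun q _ => hsplit q,
    Finset.sum_coe_sort (Finset.HasAntidiagonal.antidiagonal (i + j))
      (fun r : ℕ × ℕ => (ladder r.1 i * ladder j r.2 - ladder i r.1 * ladder r.2 j) *
        (((-1) ^ r.2 * √((i + j).choose r.2) * Real.cos θ ^ r.1 * Real.sin θ ^ r.2 : ℝ) : ℂ))]
  simp only [sub_mul, Finset.sum_sub_distrib]
  have hA : ∑ r ∈ Finset.HasAntidiagonal.antidiagonal (i + j), ladder r.1 i * ladder j r.2 *
        (((-1) ^ r.2 * √((i + j).choose r.2) * Real.cos θ ^ r.1 * Real.sin θ ^ r.2 : ℝ) : ℂ)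
      = (((-1) ^ j * √((i + j).choose j) *
        (-(i : ℝ) * Real.cos θ ^ (i - 1) * Real.sin θ ^ (j + 1)) : ℝ) : ℂ) := by
    rcases i with _ | i
    · rw [Finset.sum_eq_zero]
      · simp
      · intro r _; simp [ladder]
    · rw [Finset.sum_eq_single (i, j + 1)]
      · have := sqrt_mul_sqrt_mul_sqrt_choose i j
        simp only [ladder, if_true]
        rw [← Complex.ofReal_mul, ← Complex.ofReal_mul]
        congr 1
        rw [Nat.add_sub_cancel]
        calc _ = (√((i + 1 : ℕ) : ℝ) * √((j + 1 : ℕ) : ℝ) * √(((i + 1 + j).choose (j + 1) : ℕ) : ℝ))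
              * ((-1) ^ (j + 1) * Real.cos θ ^ i * Real.sin θ ^ (j + 1)) := by ring
          _ = _ := by rw [this]; push_cast; ring
      · rintro ⟨a, b⟩ hab hne
        simp only [Finset.HasAntidiagonal.mem_antidiagonal] at hab
        have : a + 1 ≠ i + 1 := by
          intro h
          apply hne
          ext <;> simp <;> omega
        simp only [ladder, if_neg this, zero_mul]
      · intro h; exact absurd (Finset.HasAntidiagonal.mem_antidiagonal.2 (by dsimp only; omega)) h
  have hB : ∑ r ∈ Finset.HasAntidiagonal.antidiagonal (i + j), ladder i r.1 * ladder r.2 j *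
        (((-1) ^ r.2 * √((i + j).choose r.2) * Real.cos θ ^ r.1 * Real.sin θ ^ r.2 : ℝ) : ℂ)
      = (((-1) ^ j * √((i + j).choose j) *
        (-(j : ℝ) * Real.cos θ ^ (i + 1) * Real.sin θ ^ (j - 1)) : ℝ) : ℂ) := by
    rcases j with _ | j
    · rw [Finset.sum_eq_zero]
      · simp
      · intro r _; simp [ladder]
    · rw [Finset.sum_eq_single (i + 1, j)]
      · have := sqrt_mul_sqrt_mul_sqrt_choose j i
        have e1 : (j + 1 + i).choose (i + 1) = (i + (j + 1)).choose j := by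
          rw [show i + (j + 1) = j + 1 + i by ring, ← Nat.choose_symm_of_eq_add
            (show j + 1 + i = j + (i + 1) by ring)]
        have e2 : (j + 1 + i).choose i = (i + (j + 1)).choose (j + 1) := by
          rw [show i + (j + 1) = j + 1 + i by ring, Nat.choose_symm_add]
        rw [e1, e2] at this
        simp only [ladder, if_true]
        rw [← Complex.ofReal_mul, ← Complex.ofReal_mul]
        congr 1
        rw [Nat.add_sub_cancel]
        calc _ = (√((j + 1 : ℕ) : ℝ) * √((i + 1 : ℕ) : ℝ) * √(((i + (j + 1)).choose j : ℕ) : ℝ))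
              * ((-1) ^ j * Real.cos θ ^ (i + 1) * Real.sin θ ^ j) := by ring
          _ = _ := by rw [this]; push_cast; ring
      · rintro ⟨a, b⟩ hab hne
        simp only [Finset.HasAntidiagonal.mem_antidiagonal] at hab
        have : i + 1 ≠ a := by
          intro h
          apply hne
          ext <;> simp <;> omega
        simp [ladder, this]
      · intro h; exact absurd (Finset.HasAntidiagonal.mem_antidiagonal.2 (by dsimp only; omega)) h
  rw [hA, hB, ← Complex.ofReal_sub]
  congr 1
  ring

/-- The Kraus coefficients are the amplitudes of a binomial distribution, up to a sign that depends
on the number `l` of lost photons only. -/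
theorem krausCoeff_eq {lam : ℝ} (h0 : 0 ≤ lam) (h1 : lam ≤ 1) (l m : ℕ) :
    krausCoeff lam l m
      = (((-1) ^ l * √((m + l).choose l) * √lam ^ m * √(1 - lam) ^ l : ℝ) : ℂ) := by
  classical
  set M := m + l with hM
  set p₀ : Finset.HasAntidiagonal.antidiagonal M := ⟨(M, 0), by simp⟩ with hp₀
  set C : ℝ → Matrix (Finset.HasAntidiagonal.antidiagonal M)
      (Finset.HasAntidiagonal.antidiagonal M) ℂ := fun θ =>
    ∑ q, ((binomialAmplitude M θ q : ℝ) : ℂ) • Matrix.single q p₀ (1 : ℂ) with hCdef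
  have hentry : ∀ θ p r, C θ p r = if r = p₀ then ((binomialAmplitude M θ p : ℝ) : ℂ) else 0 := by
    intro θ p r
    simp only [hCdef, Matrix.sum_apply, Matrix.smul_apply, Matrix.single_apply, smul_eq_mul]
    split_ifs with h
    · subst h; simp
    · rw [Finset.sum_eq_zero]; intro q _; rw [if_neg]; · simp
      rintro ⟨-, h'⟩; exact h h'.symm
  have hC : ∀ θ, HasDerivAt C (modeMixing M * C θ) θ := by
    intro θ
    have := HasDerivAt.fun_sum (u := Finset.univ) fun q _ =>
      (hasDerivAt_binomialAmplitude M θ q).smul_const (Matrix.single q p₀ (1 : ℂ))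
    refine this.congr_deriv ?_
    ext p r
    simp only [Matrix.mul_apply, hentry, Matrix.sum_apply, Matrix.smul_apply, Matrix.single_apply,
      smul_eq_mul]
    split_ifs with h
    · subst h; simp
    · rw [Finset.sum_eq_zero]; · simp
      intro q _; rw [if_neg]; · simp
      rintro ⟨-, h'⟩; exact h h'.symm
  have hC0 : C 0 = Matrix.single p₀ p₀ 1 := by
    ext p r
    rw [hentry, Matrix.single_apply]
    by_cases hr : r = p₀
    · rw [if_pos hr]
      by_cases hp : p = p₀
      · rw [if_pos ⟨hp.symm, hr.symm⟩, hp]; simp [binomialAmplitude, hp₀]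
      · rw [if_neg (fun h => hp h.1.symm)]
        have : p.1.2 ≠ 0 := by
          intro h
          apply hp
          have hs := Finset.HasAntidiagonal.mem_antidiagonal.1 p.2
          apply Subtype.ext
          ext
          · change p.1.1 = M; omega
          · exact h
        simp [binomialAmplitude, this]
    · rw [if_neg hr, if_neg (fun h => hr h.2.symm)]
  have key := eq_exp_mul_of_hasDerivAt (modeMixing M) C hC (Real.arccos (√lam))
  have key2 := congrFun (congrFun key ⟨(m, l), by simp [hM]⟩) p₀
  rw [hentry, if_pos rfl, hC0] at key2
  rw [Matrix.mul_single_apply_same, mul_one] at key2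
  change beamSplitter lam M ⟨(m, l), _⟩ p₀ = _
  rw [beamSplitter, ← key2, binomialAmplitude, Real.cos_arccos, Real.sin_arccos, Real.sq_sqrt h0]
  · linarith [Real.sqrt_nonneg lam]
  · exact Real.sqrt_le_one.2 h1

end MatrixNorm

/-! ### The entropy of thermal states -/

theorem continuous_g : Continuous g := by
  have h : Continuous fun E : ℝ => E * Real.log E := Real.continuous_mul_log
  have h2 : Continuous fun E : ℝ => (E + 1) * Real.log (E + 1) := h.comp (continuous_add_const 1)
  exact h2.sub h

theorem hasDerivAt_g {E : ℝ} (hE : 0 < E) : HasDerivAt g (Real.log (E + 1) - Real.log E) E := by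
  have h1 := Real.hasDerivAt_mul_log hE.ne'
  have h2 := (Real.hasDerivAt_mul_log (x := E + 1) (by positivity)).comp_add_const E 1
  exact (h2.sub h1).congr_deriv (by ring)

theorem log_add_one_le_g {E : ℝ} (hE : 0 ≤ E) : Real.log (E + 1) ≤ g E := by
  rcases hE.eq_or_lt with rfl | hE
  · simp [g]
  · have : Real.log E ≤ Real.log (E + 1) := Real.log_le_log hE (by linarith)
    unfold g
    nlinarith

theorem gInv_spec {S : ℝ} (hS : 0 ≤ S) : 0 ≤ gInv S ∧ g (gInv S) = S := by
  have hex : ∃ E ∈ Set.Ici (0 : ℝ), g E = S := by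
    have h0 : g 0 = 0 := by simp [g]
    have h1 : S ≤ g (Real.exp S) := by
      refine le_trans ?_ (log_add_one_le_g (Real.exp_pos S).le)
      conv_lhs => rw [← Real.log_exp S]
      exact Real.log_le_log (Real.exp_pos S) (by linarith)
    obtain ⟨E, hE, hgE⟩ := intermediate_value_Icc (Real.exp_pos S).le continuous_g.continuousOn
      (show S ∈ Set.Icc (g 0) (g (Real.exp S)) from ⟨by rw [h0]; exact hS, h1⟩)
    exact ⟨E, hE.1, hgE⟩
  exact ⟨Function.invFunOn_mem hex, Function.invFunOn_eq hex⟩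

theorem antitoneOn_add_one_mul_log :
    AntitoneOn (fun e : ℝ => (e + 1) * (Real.log (e + 1) - Real.log e)) (Set.Ioi 0) := by
  have hd : ∀ e ∈ Set.Ioi (0 : ℝ),
      HasDerivAt (fun e : ℝ => (e + 1) * (Real.log (e + 1) - Real.log e))
        ((Real.log (e + 1) - Real.log e) - 1 / e) e := by
    intro e he
    have he' : (0 : ℝ) < e := he
    have h1 : HasDerivAt (fun e : ℝ => e + 1) 1 e := (hasDerivAt_id e).add_const 1
    have h2 := (h1.log (by positivity)).sub (Real.hasDerivAt_log he'.ne')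
    refine (h1.mul h2).congr_deriv ?_
    simp only [Pi.sub_apply]
    field_simp
    ring
  refine antitoneOn_of_deriv_nonpos (convex_Ioi 0)
    (fun e he => (hd e he).continuousAt.continuousWithinAt)
    (fun e he => (hd e (interior_subset he)).differentiableAt.differentiableWithinAt)
    fun e he => ?_
  have he' : (0 : ℝ) < e := interior_subset he
  rw [(hd e he').deriv, ← Real.log_div (by positivity) he'.ne']
  have := Real.log_le_sub_one_of_pos (show 0 < (e + 1) / e by positivity)
  have h3 : (e + 1) / e - 1 = 1 / e := by field_simp; ring
  linarith

/-- `log (1 + g⁻¹)` is a convex function, expressed through its supporting line at `g E`. -/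
theorem mul_g_sub_log_le {E e : ℝ} (hE : 0 < E) (he : 0 ≤ e) :
    ((E + 1) * (Real.log (E + 1) - Real.log E))⁻¹ * g e - Real.log (e + 1)
      ≤ ((E + 1) * (Real.log (E + 1) - Real.log E))⁻¹ * g E - Real.log (E + 1) := by
  set u : ℝ → ℝ := fun e => (e + 1) * (Real.log (e + 1) - Real.log e) with hu
  have hpos : ∀ x, 0 < x → 0 < u x := fun x hx =>
    mul_pos (by linarith) (sub_pos.2 (Real.log_lt_log hx (by linarith)))
  set k : ℝ → ℝ := fun e => (u E)⁻¹ * g e - Real.log (e + 1) with hk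
  have hd : ∀ x, 0 < x → HasDerivAt k ((u x / u E - 1) / (x + 1)) x := by
    intro x hx
    have h1 : HasDerivAt (fun e : ℝ => e + 1) 1 x := (hasDerivAt_id x).add_const 1
    refine (((hasDerivAt_g hx).const_mul _).sub (h1.log (by positivity))).congr_deriv ?_
    have := (hpos E hE).ne'
    have hx1 : x + 1 ≠ 0 := by positivity
    rw [div_eq_mul_inv (u x)]
    field_simp
    simp only [hu]
  have hcont : ContinuousOn k (Set.Ici 0) := by
    refine (continuous_g.const_mul _).continuousOn.sub (ContinuousOn.log (by fun_prop) ?_)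
    intro x hx
    have : (0 : ℝ) ≤ x := hx
    positivity
  change k e ≤ k E
  rcases le_total e E with h | h
  · refine monotoneOn_of_deriv_nonneg (convex_Icc 0 E) (hcont.mono Set.Icc_subset_Ici_self)
      (fun x hx => ?_) (fun x hx => ?_) ⟨he, h⟩ ⟨hE.le, le_rfl⟩ h
    · rw [interior_Icc] at hx
      exact (hd x hx.1).differentiableAt.differentiableWithinAt
    · rw [interior_Icc] at hx
      rw [(hd x hx.1).deriv]
      have := antitoneOn_add_one_mul_log hx.1 hE hx.2.le
      have h3 : 1 ≤ u x / u E := (one_le_div (hpos E hE)).2 this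
      have := hx.1
      exact div_nonneg (by linarith) (by linarith)
  · refine antitoneOn_of_deriv_nonpos (convex_Ici E)
      (hcont.mono (Set.Ici_subset_Ici.2 hE.le)) (fun x hx => ?_) (fun x hx => ?_)
      (Set.mem_Ici.2 le_rfl) h h
    · rw [interior_Ici] at hx
      exact (hd x (hE.trans hx)).differentiableAt.differentiableWithinAt
    · rw [interior_Ici] at hx
      have hx0 : 0 < x := hE.trans hx
      rw [(hd x hx0).deriv]
      have := antitoneOn_add_one_mul_log hE hx0 (le_of_lt hx)
      have h3 : u x / u E ≤ 1 := (div_le_one (hpos E hE)).2 this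
      exact div_nonpos_of_nonpos_of_nonneg (by linarith) (by linarith)

/-! ### The isoperimetric inequality for a decreasing probability distribution -/

/-- The log-sum inequality for a distribution against its shift by one. -/
theorem sum_mul_log_shift_le {N k : ℕ} (p : ℕ → ℝ) (hp : ∀ n ≤ N, 0 < p n) (hk : k < N) :
    ∑ n ∈ Finset.Ico k N, p (n + 1) * (Real.log (p n) - Real.log (p (n + 1)))
      ≤ (∑ n ∈ Finset.Ico (k + 1) (N + 1), p n)
        * (Real.log (∑ n ∈ Finset.Ico k (N + 1), p n)
          - Real.log (∑ n ∈ Finset.Ico (k + 1) (N + 1), p n)) := by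
  set Q := ∑ n ∈ Finset.Ico k (N + 1), p n with hQ
  set Q' := ∑ n ∈ Finset.Ico (k + 1) (N + 1), p n with hQ'
  have hQ'eq : ∑ n ∈ Finset.Ico k N, p (n + 1) = Q' := Finset.sum_Ico_add' p k N 1
  have hQeq : (∑ n ∈ Finset.Ico k N, p n) + p N = Q := (Finset.sum_Ico_succ_top hk.le p).symm
  have hQ'pos : 0 < Q' := Finset.sum_pos
    (fun n hn => hp n (by have := Finset.mem_Ico.1 hn; omega))
    ⟨N, Finset.mem_Ico.2 (by omega)⟩
  have hQpos : 0 < Q := Finset.sum_pos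
    (fun n hn => hp n (by have := Finset.mem_Ico.1 hn; omega))
    ⟨N, Finset.mem_Ico.2 (by omega)⟩
  have hterm : ∀ n ∈ Finset.Ico k N, p (n + 1) * (Real.log (p n) - Real.log (p (n + 1)))
      ≤ p (n + 1) * (Real.log Q - Real.log Q') + (Q' / Q * p n - p (n + 1)) := by
    intro n hn
    have hn' := Finset.mem_Ico.1 hn
    have h0 := hp n (by omega)
    have h1 := hp (n + 1) (by omega)
    have h2 := Real.log_le_sub_one_of_pos (show 0 < (p n * Q') / (p (n + 1) * Q) by positivity)
    rw [Real.log_div (by positivity) (by positivity), Real.log_mul h0.ne' hQ'pos.ne',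
      Real.log_mul h1.ne' hQpos.ne'] at h2
    have h3 := mul_le_mul_of_nonneg_left h2 h1.le
    have h4 : p (n + 1) * ((p n * Q') / (p (n + 1) * Q) - 1) = Q' / Q * p n - p (n + 1) := by
      field_simp
    rw [h4] at h3
    linarith
  refine (Finset.sum_le_sum hterm).trans ?_
  rw [Finset.sum_add_distrib, Finset.sum_sub_distrib, ← Finset.sum_mul, ← Finset.mul_sum, hQ'eq]
  have h5 : Q' / Q * (∑ n ∈ Finset.Ico k N, p n) ≤ Q' / Q * Q :=
    mul_le_mul_of_nonneg_left (by linarith [hp N le_rfl]) (by positivity)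
  rw [div_mul_cancel₀ _ hQpos.ne'] at h5
  linarith

/-- The chain rule writes the entropy of a distribution on `{0, …, N}` with tails `Q n` as the
`p`-average of `g (Q (n + 1) / p n)`, the entropies of geometric distributions.  Convexity of
`log (1 + g⁻¹)` then bounds the average of `log (1 + Q (n + 1) / p n) = log (Q n / p n)`. -/
theorem log_le_sum_mul_log_tail {N : ℕ} (p : ℕ → ℝ) (hp : ∀ n ≤ N, 0 < p n)
    (hsum : ∑ n ∈ Finset.range (N + 1), p n = 1) {E : ℝ} (hE : 0 ≤ E)
    (hS : ∑ n ∈ Finset.range (N + 1), Real.negMulLog (p n) = g E) :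
    Real.log (E + 1) ≤ ∑ n ∈ Finset.range (N + 1),
      p n * (Real.log (∑ m ∈ Finset.Ico n (N + 1), p m) - Real.log (p n)) := by
  set Q : ℕ → ℝ := fun n => ∑ m ∈ Finset.Ico n (N + 1), p m with hQ
  have hQsucc : ∀ n ≤ N, Q n = p n + Q (n + 1) := fun n hn =>
    Finset.sum_eq_sum_Ico_succ_bot (Nat.lt_succ_of_le hn) p
  have hQnn : ∀ n, 0 ≤ Q n := fun n => Finset.sum_nonneg
    (fun m hm => (hp m (by have := Finset.mem_Ico.1 hm; omega)).le)
  have hQ0 : Q 0 = 1 := by rw [hQ]; simpa using hsum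
  have hQN : Q (N + 1) = 0 := by simp [hQ]
  have hQpos : ∀ n ≤ N, 0 < Q n := fun n hn => by
    rw [hQsucc n hn]; linarith [hp n hn, hQnn (n + 1)]
  have hone : ∀ n ≤ N, Q (n + 1) / p n + 1 = Q n / p n := fun n hn => by
    have := (hp n hn).ne'
    rw [hQsucc n hn]; field_simp; ring
  have hlog : ∀ n ≤ N, Real.log (Q (n + 1) / p n + 1) = Real.log (Q n) - Real.log (p n) :=
    fun n hn => by rw [hone n hn, Real.log_div (hQpos n hn).ne' (hp n hn).ne']
  rcases hE.eq_or_lt with rfl | hE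
  · rw [zero_add, Real.log_one]
    refine Finset.sum_nonneg fun n hn => ?_
    have hn' : n ≤ N := by have := Finset.mem_range.1 hn; omega
    have : Real.log (p n) ≤ Real.log (Q n) := Real.log_le_log (hp n hn')
      (by rw [hQsucc n hn']; linarith [hQnn (n + 1)])
    exact mul_nonneg (hp n hn').le (by linarith)
  · have hg : ∀ n ≤ N, p n * g (Q (n + 1) / p n)
        = (Q n * Real.log (Q n) - Q (n + 1) * Real.log (Q (n + 1))) + Real.negMulLog (p n) := by
      intro n hn
      have hpn := hp n hn
      have h1 : Q (n + 1) / p n * Real.log (Q (n + 1) / p n)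
          = Q (n + 1) / p n * (Real.log (Q (n + 1)) - Real.log (p n)) := by
        rcases (hQnn (n + 1)).eq_or_lt with h0 | h0
        · rw [← h0]; simp
        · rw [Real.log_div h0.ne' hpn.ne']
      rw [g, hlog n hn, hone n hn, h1, Real.negMulLog]
      have h2 := hQsucc n hn
      field_simp
      rw [h2]
      ring
    have hgsum : ∑ n ∈ Finset.range (N + 1), p n * g (Q (n + 1) / p n) = g E := by
      rw [Finset.sum_congr rfl fun n hn => hg n (by have := Finset.mem_range.1 hn; omega),
        Finset.sum_add_distrib, hS, Finset.sum_range_sub' (fun n => Q n * Real.log (Q n)),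
        hQ0, hQN]
      simp
    set κ := ((E + 1) * (Real.log (E + 1) - Real.log E))⁻¹
    have hle : ∑ n ∈ Finset.range (N + 1), p n * (κ * g (Q (n + 1) / p n)
        - Real.log (Q (n + 1) / p n + 1))
        ≤ ∑ n ∈ Finset.range (N + 1), p n * (κ * g E - Real.log (E + 1)) := by
      refine Finset.sum_le_sum fun n hn => ?_
      have hn' : n ≤ N := by have := Finset.mem_range.1 hn; omega
      exact mul_le_mul_of_nonneg_left
        (mul_g_sub_log_le hE (div_nonneg (hQnn _) (hp n hn').le)) (hp n hn').le
    rw [← Finset.sum_mul, hsum, one_mul] at hle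
    have h1 : ∑ n ∈ Finset.range (N + 1), p n * (κ * g (Q (n + 1) / p n)
        - Real.log (Q (n + 1) / p n + 1)) = κ * g E - ∑ n ∈ Finset.range (N + 1),
          p n * (Real.log (Q n) - Real.log (p n)) := by
      rw [← hgsum, Finset.mul_sum, ← Finset.sum_sub_distrib]
      refine Finset.sum_congr rfl fun n hn => ?_
      rw [hlog n (by have := Finset.mem_range.1 hn; omega)]
      ring
    rw [h1] at hle
    linarith

/-- Let `α i j` be the rates from `j` to `i` of a jump process, whose total rate into each level
exceeds the total rate out of it by at most one. Then the entropy of a decreasing distribution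
drops at most as fast as under the pure death process `n + 1 → n` at rate `n + 1`: at each `n`, the
net rate across the cut between `n` and `n + 1` is at most `n + 1`. -/
theorem sum_rate_mul_log_le {N : ℕ} (p : ℕ → ℝ) (hp : ∀ n ≤ N, 0 < p n)
    (hanti : ∀ m n, m ≤ n → n ≤ N → p n ≤ p m) (α : ℕ → ℕ → ℝ) (hα : ∀ i j, 0 ≤ α i j)
    (hrow : ∀ i ≤ N, ∑ j ∈ Finset.range (N + 1), α i j
      ≤ 1 + ∑ k ∈ Finset.range (N + 1), α k i) :
    ∑ i ∈ Finset.range (N + 1), ∑ j ∈ Finset.range (N + 1),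
        α i j * p j * (Real.log (p i) - Real.log (p j))
      ≤ ∑ n ∈ Finset.range N,
        (n + 1) * (p (n + 1) * (Real.log (p n) - Real.log (p (n + 1)))) := by
  set r : ℕ → ℝ := fun n => Real.log (p n) - Real.log (p (n + 1)) with hr
  have hrnn : ∀ n < N, 0 ≤ r n := fun n hn =>
    sub_nonneg.2 (Real.log_le_log (hp _ (by omega)) (hanti _ _ (by omega) (by omega)))
  set χ : ℕ → ℕ → ℝ := fun n j => if n < j then 1 else 0 with hχ
  have htel : ∀ j ≤ N, ∑ n ∈ Finset.range N, r n * χ n j = Real.log (p 0) - Real.log (p j) := by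
    intro j hj
    rw [← Finset.sum_range_sub' (fun n => Real.log (p n)) j]
    have : Finset.range j = (Finset.range N).filter (fun n => n < j) := by
      ext n; simp; omega
    rw [this, Finset.sum_filter]
    refine Finset.sum_congr rfl fun n _ => ?_
    simp only [hχ, hr]
    split_ifs <;> simp
  have hlayer : ∀ i ≤ N, ∀ j ≤ N, Real.log (p i) - Real.log (p j)
      = ∑ n ∈ Finset.range N, r n * (χ n j - χ n i) := by
    intro i hi j hj
    simp only [mul_sub, Finset.sum_sub_distrib, htel i hi, htel j hj]
    ring
  have hle : ∀ i ∈ Finset.range (N + 1), ∀ j ∈ Finset.range (N + 1),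
      α i j * p j * (Real.log (p i) - Real.log (p j))
      ≤ ∑ n ∈ Finset.range N, r n * p (n + 1) * (α i j * (χ n j - χ n i)) := by
    intro i hi j hj
    have hi' : i ≤ N := by have := Finset.mem_range.1 hi; omega
    have hj' : j ≤ N := by have := Finset.mem_range.1 hj; omega
    rw [hlayer i hi' j hj', Finset.mul_sum]
    refine Finset.sum_le_sum fun n hn => ?_
    have hn' := Finset.mem_range.1 hn
    have key : p j * (χ n j - χ n i) ≤ p (n + 1) * (χ n j - χ n i) := by
      simp only [hχ]
      split_ifs with h1 h2 h2
      · simp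
      · simpa using hanti (n + 1) j h1 hj'
      · simpa using hanti j (n + 1) (by omega) (by omega)
      · simp
    have := mul_le_mul_of_nonneg_left key (mul_nonneg (hrnn n hn') (hα i j))
    linarith
  refine (Finset.sum_le_sum fun i hi => Finset.sum_le_sum (hle i hi)).trans ?_
  have hswap : ∑ i ∈ Finset.range (N + 1), ∑ j ∈ Finset.range (N + 1), ∑ n ∈ Finset.range N,
      r n * p (n + 1) * (α i j * (χ n j - χ n i))
      = ∑ n ∈ Finset.range N, r n * p (n + 1) * ∑ i ∈ Finset.range (N + 1),
        ∑ j ∈ Finset.range (N + 1), α i j * (χ n j - χ n i) := by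
    simp only [Finset.mul_sum]
    rw [Finset.sum_comm]
    conv_rhs => rw [Finset.sum_comm]
    rw [Finset.sum_comm]
    exact Finset.sum_congr rfl fun i _ => Finset.sum_comm
  rw [hswap]
  refine Finset.sum_le_sum fun n hn => ?_
  have hn' := Finset.mem_range.1 hn
  have hflow : ∑ i ∈ Finset.range (N + 1), ∑ j ∈ Finset.range (N + 1), α i j * (χ n j - χ n i)
      ≤ n + 1 := by
    have h1 : ∑ i ∈ Finset.range (N + 1), ∑ j ∈ Finset.range (N + 1), α i j * (χ n j - χ n i)
        = ∑ i ∈ Finset.range (N + 1), (1 - χ n i) * ((∑ j ∈ Finset.range (N + 1), α i j)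
          - ∑ k ∈ Finset.range (N + 1), α k i) := by
      have h2 : ∑ i ∈ Finset.range (N + 1), (1 - χ n i) * ∑ k ∈ Finset.range (N + 1), α k i
          = ∑ i ∈ Finset.range (N + 1), ∑ j ∈ Finset.range (N + 1), (1 - χ n j) * α i j := by
        simp only [Finset.mul_sum]
        exact Finset.sum_comm
      simp only [mul_sub (1 - χ n _)]
      rw [Finset.sum_sub_distrib, h2, ← Finset.sum_sub_distrib]
      refine Finset.sum_congr rfl fun i _ => ?_
      rw [Finset.mul_sum, ← Finset.sum_sub_distrib]
      refine Finset.sum_congr rfl fun j _ => ?_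
      ring
    rw [h1]
    have h3 : ∀ i ∈ Finset.range (N + 1), (1 - χ n i) * ((∑ j ∈ Finset.range (N + 1), α i j)
          - ∑ k ∈ Finset.range (N + 1), α k i) ≤ 1 - χ n i := by
      intro i hi
      have := hrow i (by have := Finset.mem_range.1 hi; omega)
      have h4 : 0 ≤ 1 - χ n i := by simp only [hχ]; split_ifs <;> simp
      nlinarith
    refine (Finset.sum_le_sum h3).trans (le_of_eq ?_)
    have h5 : ∀ i, 1 - χ n i = if i < n + 1 then (1 : ℝ) else 0 := by
      intro i
      simp only [hχ]
      split_ifs <;> first | omega | simp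
    simp only [h5]
    rw [← Finset.sum_filter]
    have : (Finset.range (N + 1)).filter (fun i => i < n + 1) = Finset.range (n + 1) := by
      ext i; simp; omega
    rw [this]; simp
  have := mul_le_mul_of_nonneg_left hflow
    (mul_nonneg (hrnn n hn') (hp (n + 1) (by omega)).le)
  linarith

/-- Both `p` and its tails enter the final bound through
`∑ n, Q (n + 1) * log (Q n / Q (n + 1)) = g E - ∑ n, p n * log (Q n / p n)`. -/
theorem sum_succ_mul_log_le {N : ℕ} (p : ℕ → ℝ) (hp : ∀ n ≤ N, 0 < p n)
    (hsum : ∑ n ∈ Finset.range (N + 1), p n = 1) {E : ℝ} (hE : 0 ≤ E)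
    (hS : ∑ n ∈ Finset.range (N + 1), Real.negMulLog (p n) = g E) :
    ∑ n ∈ Finset.range N, (n + 1) * (p (n + 1) * (Real.log (p n) - Real.log (p (n + 1))))
      ≤ g E - Real.log (E + 1) := by
  set Q : ℕ → ℝ := fun n => ∑ m ∈ Finset.Ico n (N + 1), p m with hQ
  have hswap : ∑ n ∈ Finset.range N, ((n : ℝ) + 1) *
        (p (n + 1) * (Real.log (p n) - Real.log (p (n + 1))))
      = ∑ k ∈ Finset.range N, ∑ n ∈ Finset.Ico k N,
        p (n + 1) * (Real.log (p n) - Real.log (p (n + 1))) := by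
    have h1 : ∀ n ∈ Finset.range N, ((n : ℝ) + 1) *
        (p (n + 1) * (Real.log (p n) - Real.log (p (n + 1))))
        = ∑ k ∈ Finset.range (n + 1), p (n + 1) * (Real.log (p n) - Real.log (p (n + 1))) := by
      intro n _
      rw [Finset.sum_const, Finset.card_range, nsmul_eq_mul]
      push_cast; ring
    rw [Finset.sum_congr rfl h1]
    refine Finset.sum_comm' fun n k => ?_
    simp only [Finset.mem_range, Finset.mem_Ico]
    omega
  have hle : ∑ k ∈ Finset.range N, ∑ n ∈ Finset.Ico k N,
        p (n + 1) * (Real.log (p n) - Real.log (p (n + 1)))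
      ≤ ∑ k ∈ Finset.range N, Q (k + 1) * (Real.log (Q k) - Real.log (Q (k + 1))) :=
    Finset.sum_le_sum fun k hk => sum_mul_log_shift_le p hp (Finset.mem_range.1 hk)
  have hQsucc : ∀ n ≤ N, Q n = p n + Q (n + 1) := fun n hn =>
    Finset.sum_eq_sum_Ico_succ_bot (Nat.lt_succ_of_le hn) p
  have hQ0 : Q 0 = 1 := by rw [hQ]; simpa using hsum
  have hQN : Q N = p N := by simp [hQ]
  have habel : ∑ k ∈ Finset.range N, Q (k + 1) * (Real.log (Q k) - Real.log (Q (k + 1)))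
      = - ∑ n ∈ Finset.range (N + 1), p n * Real.log (Q n) := by
    have h1 : ∀ k ∈ Finset.range N, Q (k + 1) * (Real.log (Q k) - Real.log (Q (k + 1)))
        = (Q k * Real.log (Q k) - Q (k + 1) * Real.log (Q (k + 1))) - p k * Real.log (Q k) := by
      intro k hk
      rw [hQsucc k (Finset.mem_range.1 hk).le]; ring
    rw [Finset.sum_congr rfl h1, Finset.sum_sub_distrib,
      Finset.sum_range_sub' (fun n => Q n * Real.log (Q n)), Finset.sum_range_succ, hQ0, hQN]
    simp
    ring
  have hlog := log_le_sum_mul_log_tail p hp hsum hE hS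
  have hS' : ∑ n ∈ Finset.range (N + 1), p n * (Real.log (Q n) - Real.log (p n))
      = (∑ n ∈ Finset.range (N + 1), p n * Real.log (Q n)) + g E := by
    rw [← hS, ← Finset.sum_add_distrib]
    refine Finset.sum_congr rfl fun n _ => ?_
    rw [Real.negMulLog]; ring
  rw [hS'] at hlog
  linarith

theorem g_sub_log_eq {E : ℝ} (hE : 0 ≤ E) : g E - Real.log (E + 1) = E * deriv g E := by
  rcases hE.eq_or_lt with rfl | hE
  · simp [g]
  · rw [(hasDerivAt_g hE).deriv, g]; ring

/-- The isoperimetric inequality at the level of eigenvalues: `p` is the spectrum of the state and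
`α i j = |⟨i| a |j⟩|²` in its eigenbasis. -/
theorem f_le_neg_sum_rate_mul_log {d : ℕ} (p : Fin d → ℝ) (hp : ∀ i, 0 < p i) (hanti : Antitone p)
    (hsum : ∑ i, p i = 1) (α : Fin d → Fin d → ℝ) (hα : ∀ i j, 0 ≤ α i j)
    (hrow : ∀ i, ∑ j, α i j ≤ 1 + ∑ k, α k i) :
    f (∑ i, Real.negMulLog (p i))
      ≤ - ∑ i, ∑ j, α i j * p j * (Real.log (p i) - Real.log (p j)) := by
  rcases d with _ | N
  · simp at hsum
  set P : ℕ → ℝ := fun n => p (Fin.ofNat (N + 1) n) with hP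
  set a : ℕ → ℕ → ℝ := fun i j => α (Fin.ofNat (N + 1) i) (Fin.ofNat (N + 1) j) with ha
  have hof : ∀ i : Fin (N + 1), Fin.ofNat (N + 1) (i : ℕ) = i := fun i => by
    ext; simp [Fin.ofNat]; omega
  have hp1 : ∀ i, p i ≤ 1 := fun i => by
    rw [← hsum]; exact Finset.single_le_sum (fun j _ => (hp j).le) (Finset.mem_univ i)
  have hS0 : 0 ≤ ∑ i, Real.negMulLog (p i) :=
    Finset.sum_nonneg fun i _ => Real.negMulLog_nonneg (hp i).le (hp1 i)
  obtain ⟨hE, hgE⟩ := gInv_spec hS0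
  set E := gInv (∑ i, Real.negMulLog (p i)) with hEdef
  have h1 := sum_rate_mul_log_le (N := N) P (fun n _ => hp _) ?_ a (fun i j => hα _ _) ?_
  · have h2 := sum_succ_mul_log_le (N := N) P (fun n _ => hp _)
      (by rw [Finset.sum_range]; simpa [hP, hof] using hsum) hE
      (by rw [Finset.sum_range, hgE]; simp [hP])
    rw [g_sub_log_eq hE] at h2
    have h3 : ∑ i ∈ Finset.range (N + 1), ∑ j ∈ Finset.range (N + 1),
        a i j * P j * (Real.log (P i) - Real.log (P j))
        = ∑ i, ∑ j, α i j * p j * (Real.log (p i) - Real.log (p j)) := by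
      rw [Finset.sum_range]
      refine Finset.sum_congr rfl fun i _ => ?_
      rw [Finset.sum_range]
      refine Finset.sum_congr rfl fun j _ => ?_
      simp only [ha, hP, hof]
    rw [f, ← hEdef]
    linarith
  · intro m n hmn hn
    refine hanti ?_
    rw [Fin.le_def]
    simp only [Fin.ofNat]
    rw [Nat.mod_eq_of_lt (by omega), Nat.mod_eq_of_lt (by omega)]
    exact hmn
  · intro i _
    rw [Finset.sum_range, Finset.sum_range]
    simpa [ha, hof] using hrow (Fin.ofNat (N + 1) i)

/-! ### Diagonal matrix elements of the entropy operator -/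

/-- The diagonal matrix element `⟨φ| η(X) |φ⟩` of the operator `η(X) = - X ln X`. -/
def entropyDiag (X : Mode →L[ℂ] Mode) (φ : Mode) : ℝ :=
  (inner ℂ φ ((cfc (fun z : ℂ => (Real.negMulLog z.re : ℂ)) X) φ)).re

theorem norm_fock (n : ℕ) : ‖fock n‖ = 1 := by
  simp [fock, lp.norm_single]

instance : Nontrivial Mode :=
  ⟨fock 0, 0, fun h => by simpa [h] using norm_fock 0⟩

open scoped ComplexOrder in
theorem mem_Icc_of_mem_spectrum {X : Mode →L[ℂ] Mode} (hX : X.IsPositive) (hX1 : ‖X‖ ≤ 1) {z : ℂ}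
    (hz : z ∈ spectrum ℂ X) : ((z.re : ℝ) : ℂ) = z ∧ 0 ≤ z.re ∧ z.re ≤ 1 := by
  have h0 : 0 ≤ X := (ContinuousLinearMap.nonneg_iff_isPositive X).2 hX
  have h1 : 0 ≤ z := spectrum_nonneg_of_nonneg h0 hz
  have h2 := Complex.nonneg_iff.1 h1
  refine ⟨Complex.ext (by simp) (by simp [h2.2]), h2.1, ?_⟩
  exact (Complex.re_le_norm z).trans ((spectrum.norm_le_norm_of_mem hz).trans hX1)

/-- A nonnegative function of `X` is the square of a self-adjoint operator. -/
theorem exists_sqrt_cfc {X : Mode →L[ℂ] Mode} (hX : X.IsPositive) (hX1 : ‖X‖ ≤ 1) (u : ℝ → ℝ)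
    (hu : Continuous u) (hu0 : ∀ x, 0 ≤ x → x ≤ 1 → 0 ≤ u x) :
    ∃ R : Mode →L[ℂ] Mode, IsSelfAdjoint R ∧ cfc (fun z : ℂ => (u z.re : ℂ)) X = R * R := by
  have hN : IsStarNormal X := hX.isSelfAdjoint.isStarNormal
  have hc : Continuous fun z : ℂ => ((√(u z.re) : ℝ) : ℂ) := by fun_prop
  refine ⟨cfc (fun z : ℂ => ((√(u z.re) : ℝ) : ℂ)) X, ?_, ?_⟩
  · rw [IsSelfAdjoint, ← cfc_star]
    refine cfc_congr fun z _ => ?_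
    simp
  · rw [← cfc_mul _ _ X hc.continuousOn hc.continuousOn]
    refine cfc_congr fun z hz => ?_
    obtain ⟨-, h0, h1⟩ := mem_Icc_of_mem_spectrum hX hX1 hz
    rw [← Complex.ofReal_mul, Real.mul_self_sqrt (hu0 _ h0 h1)]

theorem inner_mul_self_eq {R : Mode →L[ℂ] Mode} (hR : IsSelfAdjoint R) (φ : Mode) :
    (inner ℂ φ ((R * R) φ)).re = ‖R φ‖ ^ 2 := by
  have h : inner ℂ φ ((R * R) φ) = inner ℂ (R φ) (R φ) := by
    rw [mul_apply_eq_comp, ← ContinuousLinearMap.adjoint_inner_left,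
      ← ContinuousLinearMap.star_eq_adjoint, hR.star_eq]
  rw [h, inner_self_eq_norm_sq_to_K]
  norm_cast

theorem re_inner_cfc_nonneg {X : Mode →L[ℂ] Mode} (hX : X.IsPositive) (hX1 : ‖X‖ ≤ 1) (u : ℝ → ℝ)
    (hu : Continuous u) (hu0 : ∀ x, 0 ≤ x → x ≤ 1 → 0 ≤ u x) (φ : Mode) :
    0 ≤ (inner ℂ φ ((cfc (fun z : ℂ => (u z.re : ℂ)) X) φ)).re := by
  obtain ⟨R, hR, h⟩ := exists_sqrt_cfc hX hX1 u hu hu0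
  rw [h, inner_mul_self_eq hR]
  positivity

theorem entropyDiag_sub_quadratic {X : Mode →L[ℂ] Mode} (hX : X.IsPositive) (hX1 : ‖X‖ ≤ 1)
    (a b c : ℝ) (φ : Mode) :
    (inner ℂ φ ((cfc (fun z : ℂ => ((Real.negMulLog z.re - (a + b * z.re + c * z.re ^ 2) : ℝ) : ℂ))
        X) φ)).re
      = entropyDiag X φ - (a * ‖φ‖ ^ 2 + b * (inner ℂ φ (X φ)).re + c * ‖X φ‖ ^ 2) := by
  have hN : IsStarNormal X := hX.isSelfAdjoint.isStarNormal
  have hc : Continuous fun z : ℂ => ((Real.negMulLog z.re : ℝ) : ℂ) := by fun_prop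
  have h1 : cfc (fun z : ℂ => ((Real.negMulLog z.re - (a + b * z.re + c * z.re ^ 2) : ℝ) : ℂ)) X
      = cfc (fun z : ℂ => ((Real.negMulLog z.re : ℝ) : ℂ)) X
        - (algebraMap ℂ _ (a : ℂ) + (b : ℂ) • X + (c : ℂ) • (X * X)) := by
    have h2 : cfc (fun z : ℂ => (a : ℂ) + (b : ℂ) * z + (c : ℂ) * (z * z)) X
        = algebraMap ℂ _ (a : ℂ) + (b : ℂ) • X + (c : ℂ) • (X * X) := by
      rw [cfc_add X (fun z => (a : ℂ) + (b : ℂ) * z) (fun z => (c : ℂ) * (z * z)) (by fun_prop)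
        (by fun_prop), cfc_const_add _ (fun z => (b : ℂ) * z) X (by fun_prop),
        cfc_const_mul_id (b : ℂ) X, cfc_const_mul _ (fun z => z * z) X (by fun_prop),
        cfc_mul (fun z => z) (fun z => z) X (by fun_prop) (by fun_prop), cfc_id' ℂ X]
    rw [← h2, ← cfc_sub _ _ X hc.continuousOn (by fun_prop)]
    refine cfc_congr fun z hz => ?_
    obtain ⟨hz', -, -⟩ := mem_Icc_of_mem_spectrum hX hX1 hz
    conv_rhs => rw [← hz', Complex.ofReal_re]
    push_cast
    ring
  rw [h1]
  have h3 : (inner ℂ φ (X (X φ))).re = ‖X φ‖ ^ 2 := inner_mul_self_eq hX.isSelfAdjoint φ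
  have h4 : (inner ℂ φ φ : ℂ).re = ‖φ‖ ^ 2 := by
    rw [inner_self_eq_norm_sq_to_K]; norm_cast
  simp only [sub_apply, add_apply,
    smul_apply, mul_apply_eq_comp, inner_sub_right, inner_add_right,
    inner_smul_right, Complex.sub_re, Complex.add_re, Complex.re_ofReal_mul, entropyDiag,
    Algebra.algebraMap_eq_smul_one, one_apply_eq_self, h3, h4]

/-- Operator inequality obtained from a quadratic minorant of `η` on `[0, 1]`. -/
theorem quadratic_le_entropyDiag {X : Mode →L[ℂ] Mode} (hX : X.IsPositive) (hX1 : ‖X‖ ≤ 1)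
    {a b c : ℝ} (h : ∀ x, 0 ≤ x → x ≤ 1 → a + b * x + c * x ^ 2 ≤ Real.negMulLog x) (φ : Mode) :
    a * ‖φ‖ ^ 2 + b * (inner ℂ φ (X φ)).re + c * ‖X φ‖ ^ 2 ≤ entropyDiag X φ := by
  have := re_inner_cfc_nonneg hX hX1 (fun x => Real.negMulLog x - (a + b * x + c * x ^ 2))
    (by fun_prop) (fun x h0 h1 => sub_nonneg.2 (h x h0 h1)) φ
  rw [entropyDiag_sub_quadratic hX hX1] at this
  linarith

theorem entropyDiag_le_affine {X : Mode →L[ℂ] Mode} (hX : X.IsPositive) (hX1 : ‖X‖ ≤ 1)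
    {a b : ℝ} (h : ∀ x, 0 ≤ x → x ≤ 1 → Real.negMulLog x ≤ a + b * x) (φ : Mode) :
    entropyDiag X φ ≤ a * ‖φ‖ ^ 2 + b * (inner ℂ φ (X φ)).re := by
  have := re_inner_cfc_nonneg hX hX1 (fun x => a + b * x - Real.negMulLog x)
    (by fun_prop) (fun x h0 h1 => sub_nonneg.2 (h x h0 h1)) φ
  have h2 : cfc (fun z : ℂ => ((a + b * z.re - Real.negMulLog z.re : ℝ) : ℂ)) X
      = - cfc (fun z : ℂ => ((Real.negMulLog z.re - (a + b * z.re + 0 * z.re ^ 2) : ℝ) : ℂ)) X := by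
    rw [← cfc_neg]
    refine cfc_congr fun z _ => ?_
    push_cast; ring
  rw [h2, neg_apply, inner_neg_right, Complex.neg_re,
    entropyDiag_sub_quadratic hX hX1] at this
  linarith

theorem entropyDiag_nonneg {X : Mode →L[ℂ] Mode} (hX : X.IsPositive) (hX1 : ‖X‖ ≤ 1) (φ : Mode) :
    0 ≤ entropyDiag X φ :=
  re_inner_cfc_nonneg hX hX1 _ Real.continuous_negMulLog (fun _ => Real.negMulLog_nonneg) φ

/-! ### Scalar bounds on `η` -/

theorem negMulLog_le_tangent {p x : ℝ} (hp : 0 < p) (hx : 0 ≤ x) :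
    Real.negMulLog x ≤ Real.negMulLog p + (-Real.log p - 1) * (x - p) := by
  rcases hx.eq_or_lt with rfl | hx
  · simp [Real.negMulLog]; linarith
  · have := Real.log_le_sub_one_of_pos (show 0 < p / x by positivity)
    rw [Real.log_div hp.ne' hx.ne'] at this
    have h2 := mul_le_mul_of_nonneg_left this hx.le
    have h3 : x * (p / x - 1) = p - x := by field_simp
    rw [h3] at h2
    simp only [Real.negMulLog]
    nlinarith

theorem tangent_sub_sq_le_negMulLog {p x : ℝ} (hp : 0 < p) (hx : 0 ≤ x) :
    Real.negMulLog p + (-Real.log p - 1) * (x - p) - (x - p) ^ 2 / p ≤ Real.negMulLog x := by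
  rcases hx.eq_or_lt with rfl | hx
  · simp only [Real.negMulLog, Real.log_zero]
    have : (0 - p) ^ 2 / p = p := by field_simp; ring
    rw [this]; linarith
  · have := Real.log_le_sub_one_of_pos (show 0 < x / p by positivity)
    rw [Real.log_div hx.ne' hp.ne'] at this
    have h2 := mul_le_mul_of_nonneg_left this hx.le
    have h3 : (x - p) ^ 2 / p = x * (x / p - 1) - x + p := by field_simp; ring
    rw [h3]
    simp only [Real.negMulLog]
    nlinarith

theorem linear_sub_sq_le_negMulLog (C : ℝ) {x : ℝ} (hx : 0 ≤ x) :
    C * x - Real.exp C * x ^ 2 ≤ Real.negMulLog x := by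
  rcases hx.eq_or_lt with rfl | hx
  · simp
  · have := Real.log_le_sub_one_of_pos (show 0 < Real.exp C * x by positivity)
    rw [Real.log_mul (Real.exp_pos C).ne' hx.ne', Real.log_exp] at this
    have h2 := mul_le_mul_of_nonneg_left this hx.le
    simp only [Real.negMulLog]
    nlinarith

theorem negMulLog_le_one {x : ℝ} (hx : 0 ≤ x) : Real.negMulLog x ≤ 1 := by
  have := negMulLog_le_tangent one_pos hx
  simp at this
  linarith

/-! ### Consequences for the entropy operator -/

theorem norm_sub_smul_sq (X : Mode →L[ℂ] Mode) (p : ℝ) (φ : Mode) :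
    ‖X φ - (p : ℂ) • φ‖ ^ 2 = ‖X φ‖ ^ 2 - 2 * p * (inner ℂ φ (X φ)).re + p ^ 2 * ‖φ‖ ^ 2 := by
  have h : (inner ℂ (X φ) φ).re = (inner ℂ φ (X φ)).re := inner_re_symm (𝕜 := ℂ) _ _
  rw [@norm_sub_sq ℂ, inner_smul_right, norm_smul, RCLike.re_to_complex, Complex.re_ofReal_mul, h,
    Complex.norm_real, mul_pow, Real.norm_eq_abs, sq_abs]
  ring

theorem entropyDiag_le_tangent {X : Mode →L[ℂ] Mode} (hX : X.IsPositive) (hX1 : ‖X‖ ≤ 1) {p : ℝ}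
    (hp : 0 < p) {φ : Mode} (hφ : ‖φ‖ = 1) :
    entropyDiag X φ ≤ Real.negMulLog p + (-Real.log p - 1) * ((inner ℂ φ (X φ)).re - p) := by
  have := entropyDiag_le_affine hX hX1 (a := Real.negMulLog p - (-Real.log p - 1) * p)
    (b := -Real.log p - 1)
    (fun x hx _ => (negMulLog_le_tangent hp hx).trans (le_of_eq (by ring))) φ
  rw [hφ] at this
  linarith

theorem tangent_sub_le_entropyDiag {X : Mode →L[ℂ] Mode} (hX : X.IsPositive) (hX1 : ‖X‖ ≤ 1) {p : ℝ}
    (hp : 0 < p) {φ : Mode} (hφ : ‖φ‖ = 1) :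
    Real.negMulLog p + (-Real.log p - 1) * ((inner ℂ φ (X φ)).re - p)
      - ‖X φ - (p : ℂ) • φ‖ ^ 2 / p ≤ entropyDiag X φ := by
  have := quadratic_le_entropyDiag hX hX1 (a := Real.negMulLog p - (-Real.log p - 1) * p - p)
    (b := -Real.log p - 1 + 2) (c := - (1 / p))
    (fun x hx _ => le_trans (le_of_eq (by field_simp; ring)) (tangent_sub_sq_le_negMulLog hp hx)) φ
  rw [norm_sub_smul_sq]
  rw [hφ] at this ⊢
  refine le_trans (le_of_eq ?_) this
  field_simp
  ring

theorem linear_sub_le_entropyDiag {X : Mode →L[ℂ] Mode} (hX : X.IsPositive) (hX1 : ‖X‖ ≤ 1) (C : ℝ)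
    (φ : Mode) :
    C * (inner ℂ φ (X φ)).re - Real.exp C * ‖X φ‖ ^ 2 ≤ entropyDiag X φ := by
  have := quadratic_le_entropyDiag hX hX1 (a := 0) (b := C) (c := - Real.exp C)
    (fun x hx _ => le_trans (le_of_eq (by ring)) (linear_sub_sq_le_negMulLog C hx)) φ
  linarith

/-- On the kernel of `X` the operator `η(X)` vanishes. -/
theorem entropyDiag_eq_zero {X : Mode →L[ℂ] Mode} (hX : X.IsPositive) (hX1 : ‖X‖ ≤ 1) {φ : Mode}
    (hφ : X φ = 0) : entropyDiag X φ = 0 := by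
  refine le_antisymm (le_of_forall_pos_le_add fun ε hε => ?_) (entropyDiag_nonneg hX hX1 φ)
  -- the tangent of `η` at `p` has constant term `p`, so a small `p` gives a small bound
  set p : ℝ := ε / (‖φ‖ ^ 2 + 1)
  have hp : 0 < p := by positivity
  have := entropyDiag_le_affine hX hX1 (a := p) (b := -Real.log p - 1)
    (fun x hx _ => (negMulLog_le_tangent hp hx).trans
      (le_of_eq (by simp only [Real.negMulLog]; ring))) φ
  rw [hφ, inner_zero_right] at this
  simp only [Complex.zero_re, mul_zero, add_zero] at this
  have h2 : p * ‖φ‖ ^ 2 ≤ ε := by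
    have : p * (‖φ‖ ^ 2 + 1) = ε := div_mul_cancel₀ _ (by positivity)
    nlinarith
  linarith

/-- As `η(X)` vanishes on the kernel of `X`, only the component of `φ` orthogonal to it matters,
and `η ≤ 1`. -/
theorem entropyDiag_le_norm_sq {X : Mode →L[ℂ] Mode} (hX : X.IsPositive) (hX1 : ‖X‖ ≤ 1)
    {φ χ : Mode} (h : X (φ - χ) = 0) : entropyDiag X φ ≤ ‖χ‖ ^ 2 := by
  obtain ⟨R, hR, hRX⟩ := exists_sqrt_cfc hX hX1 _ Real.continuous_negMulLog
    (fun _ => Real.negMulLog_nonneg)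
  have hd : ∀ ψ, entropyDiag X ψ = ‖R ψ‖ ^ 2 := fun ψ => by
    rw [entropyDiag, hRX, inner_mul_self_eq hR]
  have h0 : R (φ - χ) = 0 := by
    have := entropyDiag_eq_zero hX hX1 h
    rw [hd] at this
    simpa using this
  have h1 : R φ = R χ := by rwa [map_sub, sub_eq_zero] at h0
  have h2 := entropyDiag_le_affine hX hX1 (a := 1) (b := 0)
    (fun x hx _ => (negMulLog_le_one hx).trans (by simp)) χ
  rw [hd, h1, ← hd]
  linarith

/-! ### The entropy in an arbitrary orthonormal basis -/

/-- Parseval's identity in `[0, ∞]`. -/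
theorem ofReal_norm_sq_eq_tsum {ι : Type*} (b : HilbertBasis ι ℂ Mode) (v : Mode) :
    ENNReal.ofReal (‖v‖ ^ 2) = ∑' i, ENNReal.ofReal (‖(inner ℂ (b i) v : ℂ)‖ ^ 2) := by
  have h := lp.hasSum_norm (p := 2) (by norm_num) (b.repr v)
  simp only [b.repr_apply_apply, b.repr.norm_map] at h
  have h' : HasSum (fun i => ‖(inner ℂ (b i) v : ℂ)‖ ^ 2) (‖v‖ ^ 2) := by simpa using h
  rw [← h'.tsum_eq, ENNReal.ofReal_tsum_of_nonneg (fun _ => by positivity) h'.summable]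

theorem tsum_norm_sq_eq_of_hilbertBasis {ι κ : Type*} (b : HilbertBasis ι ℂ Mode)
    (b' : HilbertBasis κ ℂ Mode) {R : Mode →L[ℂ] Mode} (hR : IsSelfAdjoint R) :
    ∑' i, ENNReal.ofReal (‖R (b i)‖ ^ 2) = ∑' k, ENNReal.ofReal (‖R (b' k)‖ ^ 2) := by
  simp_rw [ofReal_norm_sq_eq_tsum b' (R (b _)), ofReal_norm_sq_eq_tsum b (R (b' _))]
  rw [ENNReal.tsum_comm]
  congr 1; ext k; congr 1; ext i
  rw [← ContinuousLinearMap.adjoint_inner_left, ← ContinuousLinearMap.star_eq_adjoint, hR.star_eq,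
    norm_inner_symm]

/-- The Fock basis as a Hilbert basis. -/
def fockBasis : HilbertBasis ℕ ℂ Mode := HilbertBasis.ofRepr (LinearIsometryEquiv.refl ℂ _)

theorem fockBasis_apply (n : ℕ) : fockBasis n = fock n := by
  have := fockBasis.repr_symm_single n
  rw [← this]
  rfl

/-- The entropy is the trace of `η(X)`, in any orthonormal basis. -/
theorem entropy_eq_tsum {X : Mode →L[ℂ] Mode} (hX : X.IsPositive) (hX1 : ‖X‖ ≤ 1) {ι : Type*}
    (b : HilbertBasis ι ℂ Mode) : entropy X = ∑' i, ENNReal.ofReal (entropyDiag X (b i)) := by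
  obtain ⟨R, hR, hRX⟩ := exists_sqrt_cfc hX hX1 _ Real.continuous_negMulLog
    (fun _ => Real.negMulLog_nonneg)
  have hd : ∀ ψ, entropyDiag X ψ = ‖R ψ‖ ^ 2 := fun ψ => by
    rw [entropyDiag, hRX, inner_mul_self_eq hR]
  have h1 : entropy X = ∑' n, ENNReal.ofReal (entropyDiag X (fockBasis n)) := by
    simp only [fockBasis_apply]; rfl
  rw [h1]
  simp only [hd]
  exact tsum_norm_sq_eq_of_hilbertBasis _ _ hR

/-- Every finite orthonormal family is part of an orthonormal basis. -/
theorem exists_hilbertBasis_sum {d : ℕ} {φ : Fin d → Mode} (hφ : Orthonormal ℂ φ) :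
    ∃ (κ : Type) (b : HilbertBasis (Fin d ⊕ κ) ℂ Mode), ∀ j, b (Sum.inl j) = φ j := by
  obtain ⟨w, b, hsw, hb⟩ := hφ.toSubtypeRange.exists_hilbertBasis_extension
  have hmem : ∀ j, φ j ∈ w := fun j => hsw ⟨j, rfl⟩
  have hinj : Function.Injective φ := hφ.linearIndependent.injective
  set κ := {x : w // (x : Mode) ∉ Set.range φ}
  set v : Fin d ⊕ κ → w := Sum.elim (fun j => ⟨φ j, hmem j⟩) (fun k => k.1) with hv
  have hvinj : Function.Injective v := by
    rintro (i | i) (j | j) h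
    · simp only [hv, Sum.elim_inl, Subtype.mk.injEq] at h
      rw [hinj h]
    · simp only [hv, Sum.elim_inl, Sum.elim_inr] at h
      exact absurd ⟨i, by rw [← h]⟩ j.2
    · simp only [hv, Sum.elim_inl, Sum.elim_inr] at h
      exact absurd ⟨j, by rw [h]⟩ i.2
    · simp only [hv, Sum.elim_inr] at h
      rw [Subtype.ext h]
  have hvsurj : Function.Surjective v := by
    intro x
    by_cases hx : (x : Mode) ∈ Set.range φ
    · obtain ⟨j, hj⟩ := hx
      exact ⟨Sum.inl j, Subtype.ext hj⟩
    · exact ⟨Sum.inr ⟨x, hx⟩, rfl⟩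
  have hon : Orthonormal ℂ (fun i => b (v i)) := b.orthonormal.comp v hvinj
  refine ⟨κ, HilbertBasis.mk hon ?_, fun j => ?_⟩
  · have : Set.range (fun i => b (v i)) = Set.range b := hvsurj.range_comp b
    rw [this, b.dense_span]
  · rw [HilbertBasis.coe_mk]
    simp [hb, hv]

/-! ### Sums of rank-one operators -/

/-- The positive operator `∑ s, |z s⟩⟨z s|` of a square-summable family of vectors. -/
def gramOp {ι : Type*} (z : ι → Mode) : Mode →L[ℂ] Mode :=
  ∑' s, InnerProductSpace.rankOne ℂ (z s) (z s)

section gramOp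

variable {ι : Type*} {z : ι → Mode}

theorem hasSum_gramOp (hz : Summable fun s => ‖z s‖ ^ 2) :
    HasSum (fun s => InnerProductSpace.rankOne ℂ (z s) (z s)) (gramOp z) := by
  refine Summable.hasSum (Summable.of_norm ?_)
  simpa only [InnerProductSpace.norm_rankOne, ← sq] using hz

theorem hasSum_gramOp_apply (hz : Summable fun s => ‖z s‖ ^ 2) (φ : Mode) :
    HasSum (fun s => (inner ℂ (z s) φ : ℂ) • z s) (gramOp z φ) :=
  (hasSum_gramOp hz).mapL (ContinuousLinearMap.apply ℂ Mode φ)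

theorem hasSum_inner_gramOp (hz : Summable fun s => ‖z s‖ ^ 2) (χ φ : Mode) :
    HasSum (fun s => (inner ℂ (z s) φ : ℂ) * inner ℂ χ (z s)) (inner ℂ χ (gramOp z φ)) := by
  have := (hasSum_gramOp_apply hz φ).mapL (innerSL ℂ χ)
  simpa only [innerSL_apply_apply, inner_smul_right] using this

theorem hasSum_inner_gramOp_self (hz : Summable fun s => ‖z s‖ ^ 2) (φ : Mode) :
    HasSum (fun s => ((‖(inner ℂ (z s) φ : ℂ)‖ ^ 2 : ℝ) : ℂ)) (inner ℂ φ (gramOp z φ)) := by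
  have := hasSum_inner_gramOp hz φ φ
  refine this.congr_fun fun s => ?_
  rw [← inner_conj_symm φ (z s), Complex.mul_conj, Complex.normSq_eq_norm_sq]

theorem hasSum_re_inner_gramOp_self (hz : Summable fun s => ‖z s‖ ^ 2) (φ : Mode) :
    HasSum (fun s => ‖(inner ℂ (z s) φ : ℂ)‖ ^ 2) (inner ℂ φ (gramOp z φ)).re := by
  simpa only [Complex.ofReal_re] using Complex.hasSum_re (hasSum_inner_gramOp_self hz φ)

theorem gramOp_isPositive (hz : Summable fun s => ‖z s‖ ^ 2) : (gramOp z).IsPositive := by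
  rw [ContinuousLinearMap.isPositive_iff_complex]
  intro φ
  have h1 : ((inner ℂ φ (gramOp z φ)).re : ℂ) = inner ℂ φ (gramOp z φ) := by
    have h2 := (Complex.hasSum_ofReal.2 (hasSum_re_inner_gramOp_self hz φ))
    exact h2.unique (hasSum_inner_gramOp_self hz φ)
  have h3 : inner ℂ (gramOp z φ) φ = inner ℂ φ (gramOp z φ) := by
    rw [← inner_conj_symm, ← h1, Complex.conj_ofReal]
  rw [h3]
  exact ⟨h1, (hasSum_re_inner_gramOp_self hz φ).nonneg fun _ => by positivity⟩

theorem norm_gramOp_le (hz : Summable fun s => ‖z s‖ ^ 2) : ‖gramOp z‖ ≤ ∑' s, ‖z s‖ ^ 2 := by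
  have h : Summable fun s => ‖InnerProductSpace.rankOne ℂ (z s) (z s)‖ := by
    simpa only [InnerProductSpace.norm_rankOne, ← sq] using hz
  refine (norm_tsum_le_tsum_norm h).trans (le_of_eq ?_)
  simp only [InnerProductSpace.norm_rankOne, ← sq]

/-- `G² ≤ (Tr G) G` for a positive trace-class operator `G`. -/
theorem norm_gramOp_apply_sq_le (hz : Summable fun s => ‖z s‖ ^ 2) (φ : Mode) :
    ‖gramOp z φ‖ ^ 2 ≤ (∑' s, ‖z s‖ ^ 2) * (inner ℂ φ (gramOp z φ)).re := by
  set G := gramOp z with hG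
  set T := ∑' s, ‖z s‖ ^ 2
  have h0 : 0 ≤ (inner ℂ φ (G φ)).re := (hasSum_re_inner_gramOp_self hz φ).nonneg
    fun _ => by positivity
  -- Cauchy–Schwarz on the partial sums of `G φ = ∑ s, ⟨z s, φ⟩ z s`
  have hcs : ‖G φ‖ ≤ √T * √((inner ℂ φ (G φ)).re) := by
    have hsum := hasSum_gramOp_apply hz φ
    have hs2 := hasSum_re_inner_gramOp_self hz φ
    refine le_of_tendsto hsum.norm (Eventually.of_forall fun s => ?_)
    calc ‖∑ i ∈ s, (inner ℂ (z i) φ : ℂ) • z i‖ ≤ ∑ i ∈ s, ‖(inner ℂ (z i) φ : ℂ)‖ * ‖z i‖ := by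
          refine (norm_sum_le _ _).trans (le_of_eq ?_)
          simp only [norm_smul]
      _ ≤ √(∑ i ∈ s, ‖(inner ℂ (z i) φ : ℂ)‖ ^ 2) * √(∑ i ∈ s, ‖z i‖ ^ 2) :=
          Real.sum_mul_le_sqrt_mul_sqrt _ _ _
      _ ≤ √((inner ℂ φ (G φ)).re) * √T := by
          gcongr
          · exact sum_le_hasSum s (fun _ _ => by positivity) hs2
          · exact hz.sum_le_tsum s (fun _ _ => by positivity)
      _ = _ := mul_comm _ _
  have hT : 0 ≤ T := tsum_nonneg fun _ => by positivity
  calc ‖G φ‖ ^ 2 ≤ (√T * √((inner ℂ φ (G φ)).re)) ^ 2 := by gcongr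
    _ = _ := by rw [mul_pow, Real.sq_sqrt hT, Real.sq_sqrt h0]

/-- The trace of `gramOp z` in any orthonormal basis. -/
theorem tsum_inner_gramOp {κ : Type*} (hz : Summable fun s => ‖z s‖ ^ 2)
    (b : HilbertBasis κ ℂ Mode) :
    ∑' k, ENNReal.ofReal (inner ℂ (b k) (gramOp z (b k))).re
      = ENNReal.ofReal (∑' s, ‖z s‖ ^ 2) := by
  have h1 : ∀ k, ENNReal.ofReal (inner ℂ (b k) (gramOp z (b k))).re
      = ∑' s, ENNReal.ofReal (‖(inner ℂ (b k) (z s) : ℂ)‖ ^ 2) := by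
    intro k
    have := hasSum_re_inner_gramOp_self hz (b k)
    rw [← this.tsum_eq, ENNReal.ofReal_tsum_of_nonneg (fun _ => by positivity) this.summable]
    simp only [norm_inner_symm]
  simp only [h1]
  rw [ENNReal.tsum_comm, ENNReal.ofReal_tsum_of_nonneg (fun _ => by positivity) hz]
  exact tsum_congr fun s => (ofReal_norm_sq_eq_tsum b (z s)).symm

end gramOp

/-! ### The Kraus operators -/

theorem hasSum_norm_sq (ψ : Mode) : HasSum (fun m => ‖ψ m‖ ^ 2) (‖ψ‖ ^ 2) := by
  have h := lp.hasSum_norm (p := 2) (by norm_num) ψ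
  simpa using h

theorem hasSum_of_tsum_ofReal {ι : Type*} {f : ι → ℝ} {a : ℝ} (hf : ∀ i, 0 ≤ f i) (ha : 0 ≤ a)
    (h : ∑' i, ENNReal.ofReal (f i) = ENNReal.ofReal a) : HasSum f a := by
  have h1 : Summable f := by
    have := ENNReal.summable_toReal (h.trans_ne ENNReal.ofReal_ne_top)
    refine this.congr fun i => ENNReal.toReal_ofReal (hf i)
  rw [← ENNReal.ofReal_tsum_of_nonneg hf h1,
    ENNReal.ofReal_eq_ofReal_iff (tsum_nonneg hf) ha] at h
  rw [← h]
  exact h1.hasSum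

theorem kraus_apply {lam : ℝ} (h0 : 0 ≤ lam) (h1 : lam ≤ 1) (l : ℕ) (ψ : Mode) (m : ℕ) :
    kraus lam l ψ m
      = (((-1) ^ l * √((m + l).choose l) * √lam ^ m * √(1 - lam) ^ l : ℝ) : ℂ) * ψ (m + l) := by
  rw [← krausCoeff_eq h0 h1]
  rfl

theorem norm_kraus_apply_sq {lam : ℝ} (h0 : 0 ≤ lam) (h1 : lam ≤ 1) (l : ℕ) (ψ : Mode) (m : ℕ) :
    ‖kraus lam l ψ m‖ ^ 2 = (m + l).choose l * lam ^ m * (1 - lam) ^ l * ‖ψ (m + l)‖ ^ 2 := by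
  rw [kraus_apply h0 h1, norm_mul, Complex.norm_real, mul_pow, Real.norm_eq_abs, sq_abs]
  congr 1
  rw [mul_pow, mul_pow, mul_pow, ← pow_mul, mul_comm l 2, pow_mul, neg_one_sq, one_pow,
    Real.sq_sqrt (by positivity), ← pow_mul, mul_comm m 2, pow_mul, Real.sq_sqrt h0, ← pow_mul,
    mul_comm l 2, pow_mul, Real.sq_sqrt (by linarith), one_mul]

theorem kraus_zero_apply {lam : ℝ} (h0 : 0 ≤ lam) (h1 : lam ≤ 1) (ψ : Mode) (m : ℕ) :
    kraus lam 0 ψ m = ((√lam ^ m : ℝ) : ℂ) * ψ m := by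
  rw [kraus_apply h0 h1]
  simp

theorem kraus_one_zero : kraus 1 0 = 1 := by
  ext ψ m
  rw [kraus_zero_apply zero_le_one le_rfl]
  simp

theorem kraus_one_succ (l : ℕ) : kraus 1 (l + 1) = 0 := by
  ext ψ m
  rw [kraus_apply zero_le_one le_rfl]
  simp

/-- The attenuator preserves the trace: `∑ l, B_l† B_l = 1`. -/
theorem hasSum_norm_kraus_sq {lam : ℝ} (h0 : 0 ≤ lam) (h1 : lam ≤ 1) (ψ : Mode) :
    HasSum (fun l => ‖kraus lam l ψ‖ ^ 2) (‖ψ‖ ^ 2) := by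
  refine hasSum_of_tsum_ofReal (fun _ => by positivity) (by positivity) ?_
  have e1 : ∀ χ : Mode, ENNReal.ofReal (‖χ‖ ^ 2) = ∑' m, ENNReal.ofReal (‖χ m‖ ^ 2) := fun χ => by
    rw [← (hasSum_norm_sq χ).tsum_eq,
      ENNReal.ofReal_tsum_of_nonneg (fun _ => by positivity) (hasSum_norm_sq χ).summable]
  simp only [e1]
  refine ENNReal.tsum_comm.trans ((ENNReal.tsum_prod
    (f := fun m l => ENNReal.ofReal (‖kraus lam l ψ m‖ ^ 2))).symm.trans ?_)
  refine ((Finset.HasAntidiagonal.sigmaAntidiagonalEquivProd (A := ℕ)).tsum_eq _).symm.trans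
    ((ENNReal.tsum_sigma' _).trans ?_)
  refine tsum_congr fun n => ?_
  rw [tsum_fintype]
  have hw : 0 ≤ 1 - lam := by linarith
  have e2 : ∀ q : Finset.HasAntidiagonal.antidiagonal n,
      ENNReal.ofReal (‖kraus lam q.1.2 ψ q.1.1‖ ^ 2)
      = (fun r : ℕ × ℕ => ENNReal.ofReal (n.choose r.1 * lam ^ r.1 * (1 - lam) ^ r.2
        * ‖ψ n‖ ^ 2)) q.1 := by
    rintro ⟨⟨m, l⟩, hq⟩
    obtain rfl : m + l = n := by simpa using hq
    have hch : (m + l).choose m = (m + l).choose l := Nat.choose_symm_add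
    rw [norm_kraus_apply_sq h0 h1]
    simp only [hch]
  refine (Finset.sum_congr rfl fun q _ => e2 q).trans ?_
  rw [Finset.sum_coe_sort (Finset.HasAntidiagonal.antidiagonal n) (fun r : ℕ × ℕ =>
    ENNReal.ofReal (n.choose r.1 * lam ^ r.1 * (1 - lam) ^ r.2 * ‖ψ n‖ ^ 2)),
    ← ENNReal.ofReal_sum_of_nonneg (fun _ _ => by positivity), ← Finset.sum_mul]
  have e3 := (Commute.all lam (1 - lam)).add_pow' n
  simp only [nsmul_eq_mul, add_sub_cancel, one_pow, ← mul_assoc] at e3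
  rw [← e3, one_mul]

theorem norm_kraus_le {lam : ℝ} (h0 : 0 ≤ lam) (h1 : lam ≤ 1) (l : ℕ) (ψ : Mode) :
    ‖kraus lam l ψ‖ ≤ ‖ψ‖ := by
  have := le_hasSum (hasSum_norm_kraus_sq h0 h1 ψ) l (fun _ _ => by positivity)
  exact (pow_le_pow_iff_left₀ (norm_nonneg _) (norm_nonneg _) two_ne_zero).1 this

theorem hasSum_norm_kraus_succ_sq {lam : ℝ} (h0 : 0 ≤ lam) (h1 : lam ≤ 1) (ψ : Mode) :
    HasSum (fun l => ‖kraus lam (l + 1) ψ‖ ^ 2) (‖ψ‖ ^ 2 - ‖kraus lam 0 ψ‖ ^ 2) := by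
  have := (hasSum_nat_add_iff' (f := fun l => ‖kraus lam l ψ‖ ^ 2) 1).2
    (hasSum_norm_kraus_sq h0 h1 ψ)
  simpa using this

/-- `χ = a ψ`, where `a` is the (unbounded) ladder operator. -/
def IsLowering (ψ χ : Mode) : Prop := ∀ m, χ m = ((√((m + 1 : ℕ) : ℝ) : ℝ) : ℂ) * ψ (m + 1)

/-- `B_{l+1} = - √((1 - λ) / (l + 1)) B_l a`. -/
theorem kraus_succ_of_isLowering {lam : ℝ} (h0 : 0 ≤ lam) (h1 : lam ≤ 1) {ψ χ : Mode}
    (h : IsLowering ψ χ) (l : ℕ) :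
    kraus lam (l + 1) ψ = ((-(√(1 - lam) / √((l + 1 : ℕ) : ℝ)) : ℝ) : ℂ) • kraus lam l χ := by
  ext m
  rw [lp.coeFn_smul, Pi.smul_apply, smul_eq_mul, kraus_apply h0 h1, kraus_apply h0 h1, h,
    ← mul_assoc, ← mul_assoc, ← Complex.ofReal_mul, ← Complex.ofReal_mul]
  congr 2
  have hch : ((m + (l + 1)).choose (l + 1)) * (l + 1) = (m + l + 1) * ((m + l).choose l) := by
    have := Nat.add_one_mul_choose_eq (m + l) l
    rw [← add_assoc]; exact this.symm
  have hch' : √(((m + (l + 1)).choose (l + 1) : ℕ) : ℝ) * √((l + 1 : ℕ) : ℝ)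
      = √((m + l + 1 : ℕ) : ℝ) * √(((m + l).choose l : ℕ) : ℝ) := by
    rw [← Real.sqrt_mul (by positivity), ← Real.sqrt_mul (by positivity)]
    congr 1
    exact_mod_cast hch
  have hl : √((l + 1 : ℕ) : ℝ) ≠ 0 := by positivity
  have : √(((m + (l + 1)).choose (l + 1) : ℕ) : ℝ)
      = √((m + l + 1 : ℕ) : ℝ) * √(((m + l).choose l : ℕ) : ℝ) / √((l + 1 : ℕ) : ℝ) := by
    rw [← hch']; field_simp
  rw [this]
  ring

theorem norm_kraus_zero_le_of_le {lam mu : ℝ} (h0 : 0 ≤ lam) (hlm : lam ≤ mu) (h1 : mu ≤ 1)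
    (ψ : Mode) : ‖kraus lam 0 ψ‖ ≤ ‖kraus mu 0 ψ‖ := by
  refine (pow_le_pow_iff_left₀ (norm_nonneg _) (norm_nonneg _) two_ne_zero).1
    (hasSum_le (fun m => ?_) (hasSum_norm_sq (kraus lam 0 ψ)) (hasSum_norm_sq (kraus mu 0 ψ)))
  rw [norm_kraus_apply_sq h0 (hlm.trans h1), norm_kraus_apply_sq (h0.trans hlm) h1]
  simp only [add_zero, Nat.choose_zero_right, Nat.cast_one, pow_zero, mul_one, one_mul]
  gcongr

theorem kraus_zero_injective {lam : ℝ} (h0 : 0 < lam) (h1 : lam ≤ 1) :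
    Function.Injective (kraus lam 0) := by
  intro ψ χ h
  ext m
  have := congrArg (fun ξ : Mode => ξ m) h
  simp only [kraus_zero_apply h0.le h1] at this
  exact mul_left_cancel₀ (by norm_cast; positivity) this

/-! ### The output of the attenuator -/

/-- The vectors `√p_i B_l ψ_i`, whose rank-one projectors add up to the output state. -/
def outVec {d : ℕ} (p : Fin d → ℝ) (ψ : Fin d → Mode) (lam : ℝ) (s : ℕ × Fin d) : Mode :=
  ((√(p s.2) : ℝ) : ℂ) • kraus lam s.1 (ψ s.2)

section output

variable {d : ℕ} {p : Fin d → ℝ} {ψ : Fin d → Mode} {lam : ℝ}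

theorem norm_outVec_sq (hp : ∀ i, 0 ≤ p i) (s : ℕ × Fin d) :
    ‖outVec p ψ lam s‖ ^ 2 = p s.2 * ‖kraus lam s.1 (ψ s.2)‖ ^ 2 := by
  rw [outVec, norm_smul, mul_pow, Complex.norm_real, Real.norm_eq_abs, sq_abs,
    Real.sq_sqrt (hp _)]

theorem hasSum_norm_outVec_sq (hp : ∀ i, 0 ≤ p i) (h0 : 0 ≤ lam) (h1 : lam ≤ 1) :
    HasSum (fun s => ‖outVec p ψ lam s‖ ^ 2) (∑ i, p i * ‖ψ i‖ ^ 2) := by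
  refine hasSum_of_tsum_ofReal (fun _ => by positivity)
    (Finset.sum_nonneg fun i _ => mul_nonneg (hp i) (by positivity)) ?_
  have hs : ∀ i, HasSum (fun l => p i * ‖kraus lam l (ψ i)‖ ^ 2) (p i * ‖ψ i‖ ^ 2) :=
    fun i => (hasSum_norm_kraus_sq h0 h1 (ψ i)).mul_left _
  simp only [norm_outVec_sq hp]
  rw [ENNReal.tsum_prod (f := fun l i => ENNReal.ofReal (p i * ‖kraus lam l (ψ i)‖ ^ 2)),
    ENNReal.tsum_comm, tsum_fintype, ENNReal.ofReal_sum_of_nonneg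
      (fun i _ => mul_nonneg (hp i) (by positivity))]
  refine Finset.sum_congr rfl fun i _ => ?_
  rw [← (hs i).tsum_eq, ENNReal.ofReal_tsum_of_nonneg
    (fun l => mul_nonneg (hp i) (by positivity)) (hs i).summable]

theorem attenuator_eq_gramOp (hp : ∀ i, 0 ≤ p i) (h0 : 0 ≤ lam) (h1 : lam ≤ 1) :
    attenuator lam (∑ i, (p i : ℂ) • InnerProductSpace.rankOne ℂ (ψ i) (ψ i))
      = gramOp (outVec p ψ lam) := by
  have hsum := hasSum_gramOp (hasSum_norm_outVec_sq (ψ := ψ) hp h0 h1).summable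
  have h2 := hsum.prod_fiberwise (fun l => hasSum_fintype _)
  rw [attenuator, ← h2.tsum_eq]
  refine tsum_congr fun l => ?_
  rw [Finset.mul_sum, Finset.sum_mul]
  refine Finset.sum_congr rfl fun i _ => ?_
  ext1 φ
  simp only [outVec, mul_apply_eq_comp, smul_apply, InnerProductSpace.rankOne_apply,
    ContinuousLinearMap.star_eq_adjoint, ContinuousLinearMap.adjoint_inner_right, map_smul,
    inner_smul_left, smul_smul, Complex.conj_ofReal]
  congr 1
  have : ((√(p i) : ℝ) : ℂ) * ((√(p i) : ℝ) : ℂ) = (p i : ℂ) := by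
    rw [← Complex.ofReal_mul, Real.mul_self_sqrt (hp i)]
  rw [← this]
  ring

theorem attenuator_one (X : Mode →L[ℂ] Mode) : attenuator 1 X = X := by
  rw [attenuator, tsum_eq_single 0]
  · simp [kraus_one_zero]
  · intro l hl
    obtain ⟨k, rfl⟩ := Nat.exists_eq_succ_of_ne_zero hl
    simp [kraus_one_succ]

end output

/-! ### Spectral decomposition of a state with finite support -/

theorem inner_fock_left (n : ℕ) (ψ : Mode) : inner ℂ (fock n) ψ = ψ n := by
  rw [fock, lp.inner_single_left]
  simp

theorem exists_spectral_decomposition {ρ : Mode →L[ℂ] Mode} (hρ : IsState ρ)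
    (hfin : HasFiniteSupport ρ) :
    ∃ (d : ℕ) (p : Fin d → ℝ) (ψ : Fin d → Mode), Orthonormal ℂ ψ ∧ (∀ i, 0 < p i) ∧ Antitone p ∧
      ∑ i, p i = 1 ∧ ρ = ∑ i, (p i : ℂ) • InnerProductSpace.rankOne ℂ (ψ i) (ψ i) := by
  set N : Submodule ℂ Mode := LinearMap.ker (ρ : Mode →ₗ[ℂ] Mode) with hN
  have hNclosed : IsClosed (N : Set Mode) := ρ.isClosed_ker
  have : CompleteSpace N := hNclosed.completeSpace_coe
  set K : Submodule ℂ Mode := Nᗮ with hK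
  have : FiniteDimensional ℂ K := hfin
  have hsymm : (ρ : Mode →ₗ[ℂ] Mode).IsSymmetric := hρ.isPositive.isSymmetric
  have hKinv : ∀ x ∈ K, (ρ : Mode →ₗ[ℂ] Mode) x ∈ K := by
    intro x _
    rw [hK, Submodule.mem_orthogonal]
    intro y hy
    rw [← hsymm y x, LinearMap.mem_ker.1 hy, inner_zero_left]
  have hT := hsymm.restrict_invariant hKinv
  set T := (ρ : Mode →ₗ[ℂ] Mode).restrict hKinv
  set b := hT.eigenvectorBasis rfl with hb
  set p := hT.eigenvalues rfl with hp
  set ψ : Fin (Module.finrank ℂ K) → Mode := fun i => (b i : Mode) with hψ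
  have heig : ∀ i, ρ (ψ i) = (p i : ℂ) • ψ i := fun i => by
    have := congrArg (Subtype.val) (hT.apply_eigenvectorBasis rfl i)
    exact this
  have hon : Orthonormal ℂ ψ := b.orthonormal.comp_linearIsometry K.subtypeₗᵢ
  have hdecomp : ρ = ∑ i, (p i : ℂ) • InnerProductSpace.rankOne ℂ (ψ i) (ψ i) := by
    ext1 x
    have hx : x - K.starProjection x ∈ N := by
      have h1 := K.sub_starProjection_mem_orthogonal x
      have h2 : Kᗮ = N := Submodule.orthogonal_orthogonal N
      rwa [h2] at h1
    have h2 : ρ x = ρ (K.starProjection x) := by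
      have := LinearMap.mem_ker.1 hx
      rw [map_sub, sub_eq_zero] at this
      exact this
    have h3 : K.starProjection x = ∑ i, (inner ℂ (ψ i) x : ℂ) • ψ i := by
      have := b.sum_repr' (K.orthogonalProjectionOnto x)
      have h4 := congrArg Subtype.val this
      rw [Submodule.starProjection_apply, ← h4]
      simp [hψ]
    rw [h2, h3, map_sum, sum_apply]
    refine Finset.sum_congr rfl fun i _ => ?_
    rw [map_smul, heig, smul_apply, InnerProductSpace.rankOne_apply, smul_comm]
  have hpos : ∀ i, 0 < p i := by
    intro i
    refine lt_of_le_of_ne ?_ fun h0 => ?_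
    · have h1 := hρ.isPositive.inner_nonneg_right (ψ i)
      rw [heig, inner_smul_right, inner_self_eq_norm_sq_to_K, hon.1 i] at h1
      simpa using (Complex.le_def.1 h1).1
    · have h1 : ψ i ∈ N := by
        rw [hN, LinearMap.mem_ker]
        change ρ (ψ i) = 0
        rw [heig, ← h0]; simp
      have h2 : inner ℂ (ψ i) (ψ i) = (0 : ℂ) := (Submodule.mem_orthogonal N _).1 (b i).2 _ h1
      rw [inner_self_eq_zero] at h2
      have := hon.1 i
      rw [h2] at this
      simp at this
  refine ⟨_, p, ψ, hon, hpos, hT.eigenvalues_antitone rfl, ?_, hdecomp⟩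
  have h1 : HasSum (fun n => inner ℂ (fock n) (ρ (fock n))) ((∑ i, p i : ℝ) : ℂ) := by
    have h2 : ∀ i, HasSum (fun n => ((p i * ‖ψ i n‖ ^ 2 : ℝ) : ℂ)) ((p i : ℝ) : ℂ) := fun i => by
      have := (hasSum_norm_sq (ψ i)).mul_left (p i)
      rw [hon.1 i, one_pow, mul_one] at this
      exact Complex.hasSum_ofReal.2 this
    have h3 := hasSum_sum (s := Finset.univ) fun i _ => h2 i
    rw [← Complex.ofReal_sum] at h3
    refine h3.congr_fun fun n => ?_
    conv_lhs => rw [hdecomp]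
    rw [sum_apply, inner_sum]
    refine Finset.sum_congr rfl fun i _ => ?_
    rw [smul_apply, InnerProductSpace.rankOne_apply, inner_smul_right, inner_smul_right,
      ← inner_conj_symm, inner_fock_left, mul_comm (starRingEnd ℂ _), Complex.mul_conj,
      Complex.normSq_eq_norm_sq, ← Complex.ofReal_mul]
  exact_mod_cast h1.unique hρ.trace_eq_one

/-! ### Splitting the output by the number of lost photons -/

/-- The part of the output state in which at least `k` photons have been lost. -/
def lossOp {d : ℕ} (p : Fin d → ℝ) (ψ : Fin d → Mode) (lam : ℝ) (k : ℕ) : Mode →L[ℂ] Mode :=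
  gramOp fun s : ℕ × Fin d => outVec p ψ lam (s.1 + k, s.2)

section loss

variable {d : ℕ} {p : Fin d → ℝ} {ψ : Fin d → Mode} {lam : ℝ}

theorem summable_loss (hp : ∀ i, 0 ≤ p i) (h0 : 0 ≤ lam) (h1 : lam ≤ 1) (k : ℕ) :
    Summable fun s : ℕ × Fin d => ‖outVec p ψ lam (s.1 + k, s.2)‖ ^ 2 := by
  refine (hasSum_norm_outVec_sq (ψ := ψ) hp h0 h1).summable.comp_injective
    (i := fun s : ℕ × Fin d => (s.1 + k, s.2)) ?_
  rintro ⟨a, b⟩ ⟨a', b'⟩ h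
  simpa using h

theorem hasSum_loss (hp : ∀ i, 0 ≤ p i) (h0 : 0 ≤ lam) (h1 : lam ≤ 1) (k : ℕ) :
    HasSum (fun s : ℕ × Fin d => ‖outVec p ψ lam (s.1 + k, s.2)‖ ^ 2)
      (∑ i, p i * ∑' l, ‖kraus lam (l + k) (ψ i)‖ ^ 2) := by
  have h := (summable_loss (ψ := ψ) hp h0 h1 k).hasSum
  have h2 := h.prod_fiberwise (fun l => hasSum_fintype _)
  have h3 : HasSum (fun l => ∑ i, ‖outVec p ψ lam (l + k, i)‖ ^ 2)
      (∑ i, p i * ∑' l, ‖kraus lam (l + k) (ψ i)‖ ^ 2) := by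
    refine hasSum_sum fun i _ => ?_
    simp only [norm_outVec_sq hp]
    exact (((hasSum_norm_kraus_sq h0 h1 (ψ i)).summable.comp_injective
      (add_left_injective k)).hasSum).mul_left _
  rwa [h2.unique h3] at h

theorem lossOp_zero : lossOp p ψ lam 0 = gramOp (outVec p ψ lam) := rfl

theorem lossOp_eq_add (hp : ∀ i, 0 ≤ p i) (h0 : 0 ≤ lam) (h1 : lam ≤ 1) (k : ℕ) :
    lossOp p ψ lam k = (∑ i, InnerProductSpace.rankOne ℂ (outVec p ψ lam (k, i))
      (outVec p ψ lam (k, i))) + lossOp p ψ lam (k + 1) := by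
  have h2 := (hasSum_gramOp (summable_loss (ψ := ψ) hp h0 h1 k)).prod_fiberwise
    (fun l => hasSum_fintype _)
  have h3 := (hasSum_gramOp (summable_loss (ψ := ψ) hp h0 h1 (k + 1))).prod_fiberwise
    (fun l => hasSum_fintype _)
  rw [lossOp, lossOp, ← h2.tsum_eq, ← h3.tsum_eq, h2.summable.tsum_eq_zero_add]
  simp only [zero_add, add_assoc, add_comm 1 k]

theorem re_inner_rankOne (z φ : Mode) :
    (inner ℂ φ (InnerProductSpace.rankOne ℂ z z φ)).re = ‖(inner ℂ z φ : ℂ)‖ ^ 2 := by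
  rw [InnerProductSpace.rankOne_apply, inner_smul_right, ← inner_conj_symm φ z, Complex.mul_conj,
    Complex.normSq_eq_norm_sq, Complex.ofReal_re]

theorem norm_inner_outVec_sq (hp : ∀ i, 0 ≤ p i) (k : ℕ) (i : Fin d) (φ : Mode) :
    ‖(inner ℂ (outVec p ψ lam (k, i)) φ : ℂ)‖ ^ 2
      = p i * ‖(inner ℂ φ (kraus lam k (ψ i)) : ℂ)‖ ^ 2 := by
  rw [outVec, inner_smul_left, norm_mul, mul_pow, norm_inner_symm, Complex.conj_ofReal,
    Complex.norm_real, Real.norm_eq_abs, sq_abs, Real.sq_sqrt (hp i)]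

theorem re_inner_lossOp (hp : ∀ i, 0 ≤ p i) (h0 : 0 ≤ lam) (h1 : lam ≤ 1) (k : ℕ) (φ : Mode) :
    (inner ℂ φ (lossOp p ψ lam k φ)).re = (∑ i, p i * ‖(inner ℂ φ (kraus lam k (ψ i)) : ℂ)‖ ^ 2)
      + (inner ℂ φ (lossOp p ψ lam (k + 1) φ)).re := by
  rw [lossOp_eq_add hp h0 h1 k, add_apply, sum_apply, inner_add_right, inner_sum, Complex.add_re,
    Complex.re_sum]
  simp only [re_inner_rankOne, norm_inner_outVec_sq hp]

theorem re_inner_lossOp_nonneg (hp : ∀ i, 0 ≤ p i) (h0 : 0 ≤ lam) (h1 : lam ≤ 1) (k : ℕ)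
    (φ : Mode) : 0 ≤ (inner ℂ φ (lossOp p ψ lam k φ)).re :=
  (hasSum_re_inner_gramOp_self (summable_loss hp h0 h1 k) φ).nonneg fun _ => by positivity

theorem norm_lossOp_le (hp : ∀ i, 0 ≤ p i) (h0 : 0 ≤ lam) (h1 : lam ≤ 1) (k : ℕ) :
    ‖lossOp p ψ lam k‖ ≤ ∑ i, p i * ∑' l, ‖kraus lam (l + k) (ψ i)‖ ^ 2 := by
  rw [← (hasSum_loss hp h0 h1 k).tsum_eq]
  exact norm_gramOp_le (summable_loss hp h0 h1 k)

theorem re_inner_lossOp_le (hp : ∀ i, 0 ≤ p i) (h0 : 0 ≤ lam) (h1 : lam ≤ 1) (k : ℕ)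
    {φ : Mode} (hφ : ‖φ‖ = 1) :
    (inner ℂ φ (lossOp p ψ lam k φ)).re ≤ ∑ i, p i * ∑' l, ‖kraus lam (l + k) (ψ i)‖ ^ 2 := by
  refine ((Complex.re_le_norm _).trans (norm_inner_le_norm _ _)).trans ?_
  rw [hφ, one_mul]
  refine ((lossOp p ψ lam k).le_opNorm φ).trans ?_
  rw [hφ, mul_one]
  exact norm_lossOp_le hp h0 h1 k

theorem lossOp_zero_isPositive (hp : ∀ i, 0 ≤ p i) (h0 : 0 ≤ lam) (h1 : lam ≤ 1) :
    (lossOp p ψ lam 0).IsPositive := gramOp_isPositive (summable_loss hp h0 h1 0)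

theorem norm_lossOp_zero_le_one (hp : ∀ i, 0 ≤ p i) (hsum : ∑ i, p i = 1) (hψ : Orthonormal ℂ ψ)
    (h0 : 0 ≤ lam) (h1 : lam ≤ 1) : ‖lossOp p ψ lam 0‖ ≤ 1 := by
  refine (norm_lossOp_le hp h0 h1 0).trans (le_of_eq ?_)
  rw [← hsum]
  refine Finset.sum_congr rfl fun i _ => ?_
  simp only [add_zero]
  rw [(hasSum_norm_kraus_sq h0 h1 (ψ i)).tsum_eq, hψ.1 i]
  ring

theorem entropy_eq_sum_add_tsum {X : Mode →L[ℂ] Mode} (hX : X.IsPositive) (hX1 : ‖X‖ ≤ 1)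
    {κ : Type*} (b : HilbertBasis (Fin d ⊕ κ) ℂ Mode) :
    entropy X = ENNReal.ofReal (∑ j, entropyDiag X (b (Sum.inl j)))
      + ∑' k, ENNReal.ofReal (entropyDiag X (b (Sum.inr k))) := by
  rw [entropy_eq_tsum hX hX1 b,
    (HasSum.sum (ENNReal.summable.hasSum) (ENNReal.summable.hasSum)).tsum_eq,
    ENNReal.ofReal_sum_of_nonneg (fun _ _ => entropyDiag_nonneg hX hX1 _), tsum_fintype]
  rfl

/-- The entropy of a state with finite support. -/
theorem entropy_of_spectral_decomposition (hp : ∀ i, 0 < p i) (hsum : ∑ i, p i = 1)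
    (hψ : Orthonormal ℂ ψ) :
    entropy (∑ i, (p i : ℂ) • InnerProductSpace.rankOne ℂ (ψ i) (ψ i))
      = ENNReal.ofReal (∑ i, Real.negMulLog (p i)) := by
  have hp' : ∀ i, 0 ≤ p i := fun i => (hp i).le
  set ρ := ∑ i, (p i : ℂ) • InnerProductSpace.rankOne ℂ (ψ i) (ψ i) with hρ
  have hρeq : ρ = lossOp p ψ 1 0 := by
    rw [lossOp_zero, ← attenuator_eq_gramOp hp' zero_le_one le_rfl, attenuator_one]
  have hpos : ρ.IsPositive := hρeq ▸ lossOp_zero_isPositive hp' zero_le_one le_rfl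
  have hn : ‖ρ‖ ≤ 1 := hρeq ▸ norm_lossOp_zero_le_one hp' hsum hψ zero_le_one le_rfl
  have happ : ∀ φ, ρ φ = ∑ i, (p i : ℂ) • (inner ℂ (ψ i) φ : ℂ) • ψ i := fun φ => by
    rw [hρ, sum_apply]; rfl
  have heig : ∀ j, ρ (ψ j) = (p j : ℂ) • ψ j := fun j => by
    rw [happ, Finset.sum_eq_single j]
    · rw [inner_self_eq_norm_sq_to_K, hψ.1 j]; simp
    · intro i _ hij; rw [hψ.2 hij]; simp
    · simp
  obtain ⟨κ, b, hb⟩ := exists_hilbertBasis_sum hψ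
  have hker : ∀ k, ρ (b (Sum.inr k)) = 0 := fun k => by
    rw [happ]
    refine Finset.sum_eq_zero fun i _ => ?_
    rw [← hb, b.orthonormal.2 (by simp)]; simp
  have hdiag : ∀ j, entropyDiag ρ (ψ j) = Real.negMulLog (p j) := fun j => by
    have h1 := entropyDiag_le_tangent hpos hn (hp j) (hψ.1 j)
    have h2 := tangent_sub_le_entropyDiag hpos hn (hp j) (hψ.1 j)
    have h3 : (inner ℂ (ψ j) (ρ (ψ j))).re = p j := by
      rw [heig, inner_smul_right, inner_self_eq_norm_sq_to_K, hψ.1 j]; simp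
    rw [h3] at h1 h2
    rw [heig] at h2
    simp only [sub_self, mul_zero, add_zero, norm_zero] at h1 h2
    refine le_antisymm h1 (le_trans (le_of_eq ?_) h2)
    simp
  rw [entropy_eq_sum_add_tsum hpos hn b]
  simp only [entropyDiag_eq_zero hpos hn (hker _), hb, hdiag, ENNReal.ofReal_zero, tsum_zero,
    add_zero]

end loss

/-! ### The domain of the ladder operator -/

theorem IsLowering.hasSum {v χ : Mode} (h : IsLowering v χ) :
    HasSum (fun m : ℕ => (m : ℝ) * ‖v m‖ ^ 2) (‖χ‖ ^ 2) := by
  rw [← hasSum_nat_add_iff' 1]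
  simp only [Finset.range_one, Finset.sum_singleton, Nat.cast_zero, zero_mul, sub_zero]
  refine (hasSum_norm_sq χ).congr_fun fun m => ?_
  rw [h m, norm_mul, mul_pow, Complex.norm_real, Real.norm_eq_abs, sq_abs,
    Real.sq_sqrt (by positivity)]

theorem IsLowering.hasSum_sq {v χ ξ : Mode} (h : IsLowering v χ) (h' : IsLowering χ ξ) :
    HasSum (fun m : ℕ => (m : ℝ) ^ 2 * ‖v m‖ ^ 2) (‖χ‖ ^ 2 + ‖ξ‖ ^ 2) := by
  rw [← hasSum_nat_add_iff' 1]
  simp only [Finset.range_one, Finset.sum_singleton, Nat.cast_zero, ne_eq, OfNat.ofNat_ne_zero,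
    not_false_eq_true, zero_pow, zero_mul, sub_zero]
  refine ((hasSum_norm_sq χ).add h'.hasSum).congr_fun fun m => ?_
  rw [h m, norm_mul, mul_pow, Complex.norm_real, Real.norm_eq_abs, sq_abs,
    Real.sq_sqrt (by positivity)]
  push_cast
  ring

theorem IsLowering.sum {ι : Type*} [Fintype ι] {v χ : ι → Mode} (h : ∀ i, IsLowering (v i) (χ i))
    (c : ι → ℂ) : IsLowering (∑ i, c i • v i) (∑ i, c i • χ i) := by
  intro m
  rw [lp.coeFn_sum, lp.coeFn_sum, Finset.sum_apply, Finset.sum_apply, Finset.mul_sum]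
  refine Finset.sum_congr rfl fun i _ => ?_
  rw [lp.coeFn_smul, lp.coeFn_smul, Pi.smul_apply, Pi.smul_apply, h i m, smul_eq_mul, smul_eq_mul]
  ring

/-- The vector `a† ψ`, for `ψ` in the domain of `a`: the commutation relation gives its norm. -/
theorem IsLowering.exists_raising {ψ χ : Mode} (h : IsLowering ψ χ) :
    ∃ ω : Mode, ‖ω‖ ^ 2 = ‖ψ‖ ^ 2 + ‖χ‖ ^ 2 ∧
      ∀ v ξ : Mode, IsLowering v ξ → inner ℂ ω v = (inner ℂ ψ ξ : ℂ) := by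
  set w : ℕ → ℂ := fun n => ((√(n : ℝ) : ℝ) : ℂ) * ψ (n - 1) with hw
  have hs : HasSum (fun n => ‖w n‖ ^ 2) (‖ψ‖ ^ 2 + ‖χ‖ ^ 2) := by
    rw [← hasSum_nat_add_iff' 1]
    simp only [hw, Finset.range_one, Finset.sum_singleton, Nat.cast_zero, Real.sqrt_zero,
      Complex.ofReal_zero, zero_mul, norm_zero, ne_eq, OfNat.ofNat_ne_zero, not_false_eq_true,
      zero_pow, sub_zero]
    refine ((hasSum_norm_sq ψ).add h.hasSum).congr_fun fun m => ?_
    rw [norm_mul, mul_pow, Complex.norm_real, Real.norm_eq_abs, sq_abs,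
      Real.sq_sqrt (by positivity), Nat.add_sub_cancel]
    push_cast
    ring
  have hmem : Memℓp w 2 := memℓp_gen (by simpa using hs.summable)
  refine ⟨⟨w, hmem⟩, ?_, fun v ξ hv => ?_⟩
  · exact (hasSum_norm_sq ⟨w, hmem⟩).unique hs
  · have h1 := lp.hasSum_inner (𝕜 := ℂ) (⟨w, hmem⟩ : Mode) v
    have h2 := lp.hasSum_inner (𝕜 := ℂ) ψ ξ
    rw [← hasSum_nat_add_iff' 1] at h1
    have h0 : w 0 = 0 := by simp [hw]
    refine (sub_eq_self.2 ?_).symm.trans (h1.unique (h2.congr_fun fun m => ?_))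
    · simp only [Finset.range_one, Finset.sum_singleton]
      change inner ℂ (w 0) (v 0) = 0
      rw [h0, inner_zero_left]
    · change inner ℂ (w (m + 1)) (v (m + 1)) = inner ℂ (ψ m) (ξ m)
      rw [hv m]
      simp only [hw, Nat.add_sub_cancel, RCLike.inner_apply, map_mul, Complex.conj_ofReal]
      ring

theorem sqrt_exp_neg_pow (t : ℝ) (m : ℕ) : √(Real.exp (-t)) ^ m = Real.exp (-(m * t / 2)) := by
  rw [← Real.exp_half, ← Real.exp_nat_mul]
  congr 1; ring

theorem norm_kraus_zero_sub_sq_le {v χ ξ : Mode} (h : IsLowering v χ) (h' : IsLowering χ ξ) {t : ℝ}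
    (ht : 0 ≤ t) :
    ‖kraus (Real.exp (-t)) 0 v - v‖ ^ 2 ≤ t ^ 2 * (‖χ‖ ^ 2 + ‖ξ‖ ^ 2) := by
  have h1 : Real.exp (-t) ≤ 1 := Real.exp_le_one_iff.2 (by linarith)
  refine hasSum_le (fun m => ?_) (hasSum_norm_sq _) ((h.hasSum_sq h').mul_left (t ^ 2))
  rw [lp.coeFn_sub, Pi.sub_apply, kraus_zero_apply (Real.exp_pos _).le h1, ← sub_one_mul, norm_mul,
    mul_pow, ← mul_assoc]
  gcongr
  rw [← mul_pow, ← Complex.ofReal_one, ← Complex.ofReal_sub, Complex.norm_real, Real.norm_eq_abs,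
    sq_abs, sqrt_exp_neg_pow]
  have e0 : 0 ≤ (m : ℝ) * t := by positivity
  have e1 : Real.exp (-(m * t / 2)) ≤ 1 := Real.exp_le_one_iff.2 (by linarith)
  have e2 := Real.add_one_le_exp (-(m * t / 2))
  nlinarith

/-! ### Supports invariant under the ladder operator -/

section invariant

variable {d : ℕ} {p : Fin d → ℝ} {ψ : Fin d → Mode} {A : Fin d → Fin d → ℂ}

/-- The span of the eigenvectors is invariant under the ladder operator, which acts on it by the
matrix `A`. -/
def IsInvariant (ψ : Fin d → Mode) (A : Fin d → Fin d → ℂ) : Prop :=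
  ∀ j, IsLowering (ψ j) (∑ i, A i j • ψ i)

theorem norm_sq_sum_smul (hψ : Orthonormal ℂ ψ) (c : Fin d → ℂ) :
    ‖∑ i, c i • ψ i‖ ^ 2 = ∑ i, ‖c i‖ ^ 2 := by
  have h : inner ℂ (∑ i, c i • ψ i) (∑ i, c i • ψ i) = ((∑ i, ‖c i‖ ^ 2 : ℝ) : ℂ) := by
    rw [hψ.inner_sum]
    push_cast
    refine Finset.sum_congr rfl fun i _ => ?_
    rw [mul_comm, Complex.mul_conj, Complex.normSq_eq_norm_sq]
    norm_cast
  rw [← @inner_self_eq_norm_sq ℂ, h, RCLike.re_to_complex, Complex.ofReal_re]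

/-- The commutation relation `a a† = a† a + 1` compressed to the support. -/
theorem row_le_one_add_column (hψ : Orthonormal ℂ ψ) (hA : IsInvariant ψ A) (i : Fin d) :
    ∑ j, ‖A i j‖ ^ 2 ≤ 1 + ∑ k, ‖A k i‖ ^ 2 := by
  obtain ⟨ω, hω, hin⟩ := (hA i).exists_raising
  have h1 : ∀ j, ‖A i j‖ = ‖(inner ℂ (ψ j) ω : ℂ)‖ := fun j => by
    rw [norm_inner_symm, hin _ _ (hA j), hψ.inner_right_fintype]
  rw [norm_sq_sum_smul hψ, hψ.1 i, one_pow] at hω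
  rw [← hω]
  simp only [h1]
  exact hψ.sum_inner_products_le ω

theorem exists_isLowering_mem_span (hA : IsInvariant ψ A) {v : Mode}
    (hv : v ∈ Submodule.span ℂ (Set.range ψ)) :
    ∃ χ ∈ Submodule.span ℂ (Set.range ψ), IsLowering v χ := by
  obtain ⟨c, rfl⟩ := (Submodule.mem_span_range_iff_exists_fun ℂ).1 hv
  refine ⟨_, ?_, IsLowering.sum hA c⟩
  exact Submodule.sum_mem _ fun i _ => Submodule.smul_mem _ _ (Submodule.sum_mem _ fun j _ =>
    Submodule.smul_mem _ _ (Submodule.subset_span ⟨j, rfl⟩))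

theorem kraus_mem_map (hA : IsInvariant ψ A) {lam : ℝ} (h0 : 0 ≤ lam) (h1 : lam ≤ 1) (l : ℕ) :
    ∀ v ∈ Submodule.span ℂ (Set.range ψ), kraus lam l v ∈
      (Submodule.span ℂ (Set.range ψ)).map (kraus lam 0 : Mode →ₗ[ℂ] Mode) := by
  induction l with
  | zero => intro v hv; exact ⟨v, hv, rfl⟩
  | succ l ih =>
    intro v hv
    obtain ⟨χ, hχ, hlow⟩ := exists_isLowering_mem_span hA hv
    rw [kraus_succ_of_isLowering h0 h1 hlow]
    exact Submodule.smul_mem _ _ (ih χ hχ)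

theorem exists_norm_kraus_zero_sub_le (hψ : Orthonormal ℂ ψ) (hA : IsInvariant ψ A) :
    ∃ K : ℝ, 0 ≤ K ∧ ∀ v ∈ Submodule.span ℂ (Set.range ψ), ∀ t : ℝ, 0 ≤ t →
      ‖kraus (Real.exp (-t)) 0 v - v‖ ≤ K * t * ‖v‖ := by
  have hi : ∀ i, ∃ K : ℝ, 0 ≤ K ∧ ∀ t : ℝ, 0 ≤ t →
      ‖kraus (Real.exp (-t)) 0 (ψ i) - ψ i‖ ≤ K * t := by
    intro i
    obtain ⟨χ, hχ, h⟩ := exists_isLowering_mem_span hA (Submodule.subset_span ⟨i, rfl⟩)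
    obtain ⟨ξ, -, h'⟩ := exists_isLowering_mem_span hA hχ
    refine ⟨√(‖χ‖ ^ 2 + ‖ξ‖ ^ 2), Real.sqrt_nonneg _, fun t ht => ?_⟩
    refine (pow_le_pow_iff_left₀ (norm_nonneg _) (by positivity) two_ne_zero).1 ?_
    rw [mul_pow, Real.sq_sqrt (by positivity), mul_comm]
    exact norm_kraus_zero_sub_sq_le h h' ht
  choose K hK0 hK using hi
  refine ⟨∑ i, K i, Finset.sum_nonneg fun i _ => hK0 i, fun v hv t ht => ?_⟩
  obtain ⟨c, rfl⟩ := (Submodule.mem_span_range_iff_exists_fun ℂ).1 hv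
  have hc : ∀ i, ‖c i‖ ≤ ‖∑ i, c i • ψ i‖ := fun i => by
    have := norm_inner_le_norm (𝕜 := ℂ) (ψ i) (∑ i, c i • ψ i)
    rwa [hψ.inner_right_fintype, hψ.1 i, one_mul] at this
  rw [map_sum, ← Finset.sum_sub_distrib, Finset.sum_mul, Finset.sum_mul]
  refine (norm_sum_le _ _).trans (Finset.sum_le_sum fun i _ => ?_)
  rw [map_smul, ← smul_sub, norm_smul, mul_comm]
  exact mul_le_mul (hK i t ht) (hc i) (norm_nonneg _) (mul_nonneg (hK0 i) ht)

/-- At most a fraction of order `t²` of the state loses two photons or more. -/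
theorem tsum_norm_kraus_two_le {v χ ξ : Mode} (h : IsLowering v χ) (h' : IsLowering χ ξ) {t : ℝ}
    (ht : 0 ≤ t) : ∑' l, ‖kraus (Real.exp (-t)) (l + 2) v‖ ^ 2 ≤ t ^ 2 * ‖ξ‖ ^ 2 := by
  have h0 := (Real.exp_pos (-t)).le
  have h1 : Real.exp (-t) ≤ 1 := Real.exp_le_one_iff.2 (by linarith)
  have hs := (hasSum_norm_kraus_sq h0 h1 ξ).mul_left (t ^ 2)
  rw [← hs.tsum_eq]
  refine Summable.tsum_le_tsum (fun l => ?_) ((hasSum_norm_kraus_sq h0 h1 v).summable.comp_injective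
    (add_left_injective 2)) hs.summable
  rw [kraus_succ_of_isLowering h0 h1 h, kraus_succ_of_isLowering h0 h1 h', norm_smul, norm_smul,
    mul_pow, mul_pow, ← mul_assoc]
  gcongr
  rw [Complex.norm_real, Complex.norm_real, Real.norm_eq_abs, Real.norm_eq_abs, sq_abs, sq_abs,
    neg_sq, neg_sq, div_pow, div_pow, Real.sq_sqrt (by linarith), Real.sq_sqrt (by positivity),
    Real.sq_sqrt (by positivity)]
  have e1 : 1 - Real.exp (-t) ≤ t := by linarith [Real.add_one_le_exp (-t)]
  have e0 : 0 ≤ 1 - Real.exp (-t) := by linarith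
  have hdiv : ∀ n : ℕ, (1 - Real.exp (-t)) / ((n + 1 : ℕ) : ℝ) ≤ t := fun n =>
    (div_le_self e0 (by push_cast; linarith [Nat.cast_nonneg (α := ℝ) n])).trans e1
  rw [sq t]
  exact mul_le_mul (hdiv _) (hdiv _) (by positivity) ht

end invariant

/-! ### First-order expansion of the output for an invariant support -/

section expansion

open Asymptotics

variable {d : ℕ} {p : Fin d → ℝ} {ψ : Fin d → Mode} {A : Fin d → Fin d → ℂ}

theorem exp_neg_le_one {t : ℝ} (ht : 0 ≤ t) : Real.exp (-t) ≤ 1 :=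
  Real.exp_le_one_iff.2 (by linarith)

theorem eventually_mem_Ioc {ε : ℝ} (hε : 0 < ε) : ∀ᶠ t : ℝ in 𝓝[>] 0, 0 < t ∧ t ≤ ε :=
  Ioc_mem_nhdsGT hε

theorem isBigO_of_le {h : ℝ → ℝ} {n : ℕ} (C : ℝ) {ε : ℝ} (hε : 0 < ε)
    (hh : ∀ t, 0 < t → t ≤ ε → |h t| ≤ C * t ^ n) : h =O[𝓝[>] 0] fun t : ℝ => t ^ n := by
  refine IsBigO.of_bound C ((eventually_mem_Ioc hε).mono fun t ht => ?_)
  have := ht.1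
  rw [Real.norm_eq_abs, Real.norm_eq_abs, abs_of_pos (by positivity : (0 : ℝ) < t ^ n)]
  exact hh t ht.1 ht.2

theorem isBigO_one_sub_exp_sub :
    (fun t : ℝ => (1 - Real.exp (-t)) - t) =O[𝓝[>] 0] fun t : ℝ => t ^ 2 := by
  refine isBigO_of_le 1 one_pos fun t h0 h1 => ?_
  have := Real.abs_exp_sub_one_sub_id_le (x := -t) (by rw [abs_neg, abs_of_pos h0]; exact h1)
  rw [abs_le] at this ⊢
  constructor <;> linarith

theorem isBigO_one_sub_exp_mul {s : ℝ → ℝ} {s₀ : ℝ}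
    (hs : (fun t => s t - s₀) =O[𝓝[>] 0] fun t : ℝ => t ^ 1) :
    (fun t : ℝ => (1 - Real.exp (-t)) * s t - t * s₀) =O[𝓝[>] 0] fun t : ℝ => t ^ 2 := by
  have ht : (fun t : ℝ => 1 - Real.exp (-t)) =O[𝓝[>] 0] fun t : ℝ => t ^ 1 := by
    refine isBigO_of_le 1 one_pos fun t h0 h1 => ?_
    have := Real.add_one_le_exp (-t)
    rw [abs_of_nonneg (by linarith [exp_neg_le_one h0.le])]
    linarith
  have h1 := ht.mul hs
  have h2 := isBigO_one_sub_exp_sub.mul (isBigO_const_const s₀ one_ne_zero (𝓝[>] (0 : ℝ)))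
  simp only [mul_one] at h2
  have h3 : (fun t : ℝ => t ^ 1 * t ^ 1) = fun t : ℝ => t ^ 2 := by ext t; ring
  rw [h3] at h1
  exact (h1.add h2).congr_left fun t => by ring

theorem abs_norm_sq_sub_norm_sq_le {E : Type*} [NormedAddCommGroup E] {x y : E} {B : ℝ}
    (hx : ‖x‖ ≤ B) (hy : ‖y‖ ≤ B) : |‖x‖ ^ 2 - ‖y‖ ^ 2| ≤ ‖x - y‖ * (2 * B) := by
  rw [sq_sub_sq, abs_mul, abs_of_nonneg (show 0 ≤ ‖x‖ + ‖y‖ by positivity), mul_comm]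
  exact mul_le_mul (abs_norm_sub_norm_le x y) (by linarith) (by positivity) (norm_nonneg _)

theorem isBigO_norm_inner_kraus_zero (hψ : Orthonormal ℂ ψ) (hA : IsInvariant ψ A) {v χ : Mode}
    (hχ : χ ∈ Submodule.span ℂ (Set.range ψ)) (hv : ‖v‖ = 1) :
    (fun t : ℝ => ‖(inner ℂ v (kraus (Real.exp (-t)) 0 χ) : ℂ)‖ ^ 2 - ‖(inner ℂ v χ : ℂ)‖ ^ 2)
      =O[𝓝[>] 0] fun t : ℝ => t ^ 1 := by
  obtain ⟨K, hK0, hK⟩ := exists_norm_kraus_zero_sub_le hψ hA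
  refine isBigO_of_le (K * ‖χ‖ * (2 * ‖χ‖)) one_pos fun t h0 _ => ?_
  have hin : ∀ ξ : Mode, ‖(inner ℂ v ξ : ℂ)‖ ≤ ‖ξ‖ := fun ξ => by
    have := norm_inner_le_norm (𝕜 := ℂ) v ξ
    rwa [hv, one_mul] at this
  refine (abs_norm_sq_sub_norm_sq_le ((hin _).trans (norm_kraus_le (Real.exp_pos _).le
    (exp_neg_le_one h0.le) 0 χ)) (hin χ)).trans ?_
  rw [← inner_sub_right]
  calc _ ≤ (K * t * ‖χ‖) * (2 * ‖χ‖) := by gcongr; exact (hin _).trans (hK χ hχ t h0.le)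
    _ = _ := by ring

theorem isBigO_norm_kraus_zero (hψ : Orthonormal ℂ ψ) (hA : IsInvariant ψ A) {χ : Mode}
    (hχ : χ ∈ Submodule.span ℂ (Set.range ψ)) :
    (fun t : ℝ => ‖kraus (Real.exp (-t)) 0 χ‖ ^ 2 - ‖χ‖ ^ 2) =O[𝓝[>] 0] fun t : ℝ => t ^ 1 := by
  obtain ⟨K, hK0, hK⟩ := exists_norm_kraus_zero_sub_le hψ hA
  refine isBigO_of_le (K * ‖χ‖ * (2 * ‖χ‖)) one_pos fun t h0 _ => ?_
  refine (abs_norm_sq_sub_norm_sq_le (norm_kraus_le (Real.exp_pos _).le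
    (exp_neg_le_one h0.le) 0 χ) le_rfl).trans ?_
  calc _ ≤ (K * t * ‖χ‖) * (2 * ‖χ‖) := by gcongr; exact hK χ hχ t h0.le
    _ = _ := by ring

theorem mem_span_eigenvector (j : Fin d) : ψ j ∈ Submodule.span ℂ (Set.range ψ) :=
  Submodule.subset_span ⟨j, rfl⟩

theorem ladder_mem_span (j : Fin d) :
    ∑ i, A i j • ψ i ∈ Submodule.span ℂ (Set.range ψ) :=
  Submodule.sum_mem _ fun i _ => Submodule.smul_mem _ _ (mem_span_eigenvector i)

theorem kraus_one_eq (hA : IsInvariant ψ A) {t : ℝ} (ht : 0 ≤ t) (j : Fin d) :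
    kraus (Real.exp (-t)) 1 (ψ j)
      = ((-√(1 - Real.exp (-t)) : ℝ) : ℂ) • kraus (Real.exp (-t)) 0 (∑ i, A i j • ψ i) := by
  have := kraus_succ_of_isLowering (Real.exp_pos (-t)).le (exp_neg_le_one ht) (hA j) 0
  simpa using this

theorem norm_sqrt_smul_sq {t : ℝ} (ht : 0 ≤ t) :
    ‖((-√(1 - Real.exp (-t)) : ℝ) : ℂ)‖ ^ 2 = 1 - Real.exp (-t) := by
  rw [Complex.norm_real, Real.norm_eq_abs, sq_abs, neg_sq,
    Real.sq_sqrt (by linarith [exp_neg_le_one ht])]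

theorem isBigO_norm_inner_kraus_one (hψ : Orthonormal ℂ ψ) (hA : IsInvariant ψ A) (i j : Fin d) :
    (fun t : ℝ => ‖(inner ℂ (ψ i) (kraus (Real.exp (-t)) 1 (ψ j)) : ℂ)‖ ^ 2 - t * ‖A i j‖ ^ 2)
      =O[𝓝[>] 0] fun t : ℝ => t ^ 2 := by
  have h := isBigO_one_sub_exp_mul
    (isBigO_norm_inner_kraus_zero hψ hA (ladder_mem_span (A := A) j) (hψ.1 i))
  refine h.congr' ((eventually_mem_Ioc one_pos).mono fun t ht => ?_) EventuallyEq.rfl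
  beta_reduce
  rw [kraus_one_eq hA ht.1.le, inner_smul_right, norm_mul, mul_pow, norm_sqrt_smul_sq ht.1.le,
    hψ.inner_right_fintype]

theorem isBigO_norm_kraus_one (hψ : Orthonormal ℂ ψ) (hA : IsInvariant ψ A) (j : Fin d) :
    (fun t : ℝ => ‖kraus (Real.exp (-t)) 1 (ψ j)‖ ^ 2 - t * ∑ k, ‖A k j‖ ^ 2)
      =O[𝓝[>] 0] fun t : ℝ => t ^ 2 := by
  have h := isBigO_one_sub_exp_mul (isBigO_norm_kraus_zero hψ hA (ladder_mem_span (A := A) j))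
  refine h.congr' ((eventually_mem_Ioc one_pos).mono fun t ht => ?_) EventuallyEq.rfl
  beta_reduce
  rw [kraus_one_eq hA ht.1.le, norm_smul, mul_pow, norm_sqrt_smul_sq ht.1.le,
    norm_sq_sum_smul hψ]

theorem isBigO_tsum_norm_kraus_two (hA : IsInvariant ψ A) (j : Fin d) :
    (fun t : ℝ => ∑' l, ‖kraus (Real.exp (-t)) (l + 2) (ψ j)‖ ^ 2)
      =O[𝓝[>] 0] fun t : ℝ => t ^ 2 := by
  obtain ⟨ξ, -, h'⟩ := exists_isLowering_mem_span hA (ladder_mem_span (A := A) j)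
  refine isBigO_of_le (‖ξ‖ ^ 2) one_pos fun t h0 _ => ?_
  rw [abs_of_nonneg (tsum_nonneg fun _ => by positivity), mul_comm]
  exact tsum_norm_kraus_two_le (hA j) h' h0.le

theorem tsum_norm_kraus_one_eq {lam : ℝ} (h0 : 0 ≤ lam) (h1 : lam ≤ 1) (v : Mode) :
    ∑' l, ‖kraus lam (l + 1) v‖ ^ 2
      = ‖kraus lam 1 v‖ ^ 2 + ∑' l, ‖kraus lam (l + 2) v‖ ^ 2 := by
  exact ((hasSum_norm_kraus_sq h0 h1 v).summable.comp_injective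
    (add_left_injective 1)).tsum_eq_zero_add

/-- The no-loss amplitude: `|⟨ψ, D ψ⟩|² = 1 - t ‖a ψ‖² + O(t²)`. -/
theorem isBigO_norm_inner_kraus_zero_self (hψ : Orthonormal ℂ ψ) (hA : IsInvariant ψ A)
    (i : Fin d) :
    (fun t : ℝ => ‖(inner ℂ (ψ i) (kraus (Real.exp (-t)) 0 (ψ i)) : ℂ)‖ ^ 2
      - (1 - t * ∑ k, ‖A k i‖ ^ 2)) =O[𝓝[>] 0] fun t : ℝ => t ^ 2 := by
  obtain ⟨K, hK0, hK⟩ := exists_norm_kraus_zero_sub_le hψ hA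
  have hdiff : (fun t : ℝ => ‖(inner ℂ (ψ i) (kraus (Real.exp (-t)) 0 (ψ i)) : ℂ)‖ ^ 2
      - ‖kraus (Real.exp (-t)) 0 (ψ i)‖ ^ 2) =O[𝓝[>] 0] fun t : ℝ => t ^ 2 := by
    refine isBigO_of_le (K ^ 2) one_pos fun t h0 _ => ?_
    set y := kraus (Real.exp (-t)) 0 (ψ i) - ψ i with hy
    have hy' : kraus (Real.exp (-t)) 0 (ψ i) = ψ i + y := by rw [hy]; abel
    have hyn : ‖y‖ ≤ K * t := by
      have := hK _ (mem_span_eigenvector i) t h0.le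
      rwa [hψ.1 i, mul_one] at this
    have hin : ‖(inner ℂ (ψ i) y : ℂ)‖ ≤ ‖y‖ := by
      have := norm_inner_le_norm (𝕜 := ℂ) (ψ i) y
      rwa [hψ.1 i, one_mul] at this
    have e1 : ‖(inner ℂ (ψ i) (ψ i + y) : ℂ)‖ ^ 2
        = 1 + 2 * (inner ℂ (ψ i) y : ℂ).re + ‖(inner ℂ (ψ i) y : ℂ)‖ ^ 2 := by
      rw [inner_add_right, inner_self_eq_norm_sq_to_K, hψ.1 i, ← Complex.normSq_eq_norm_sq,
        ← Complex.normSq_eq_norm_sq, Complex.normSq_apply, Complex.normSq_apply]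
      simp
      ring
    have e2 : ‖ψ i + y‖ ^ 2 = 1 + 2 * (inner ℂ (ψ i) y : ℂ).re + ‖y‖ ^ 2 := by
      rw [@norm_add_sq ℂ, hψ.1 i, one_pow]; rfl
    rw [hy', e1, e2, ← mul_pow]
    have e3 : ‖(inner ℂ (ψ i) y : ℂ)‖ ^ 2 ≤ ‖y‖ ^ 2 := by gcongr
    have e4 : ‖y‖ ^ 2 ≤ (K * t) ^ 2 := by gcongr
    rw [abs_le]
    constructor <;> linarith [sq_nonneg ‖(inner ℂ (ψ i) y : ℂ)‖]
  have h2 := (hdiff.sub (isBigO_norm_kraus_one hψ hA i)).sub (isBigO_tsum_norm_kraus_two hA i)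
  refine h2.congr' ((eventually_mem_Ioc one_pos).mono fun t ht => ?_) EventuallyEq.rfl
  have h0 := (Real.exp_pos (-t)).le
  have h1 := exp_neg_le_one ht.1.le
  have e1 := (hasSum_norm_kraus_succ_sq h0 h1 (ψ i)).tsum_eq
  rw [tsum_norm_kraus_one_eq h0 h1, hψ.1 i] at e1
  simp only
  linarith

theorem isBigO_norm_inner_kraus_zero_of_ne (hψ : Orthonormal ℂ ψ) (hA : IsInvariant ψ A)
    {i j : Fin d} (hij : i ≠ j) :
    (fun t : ℝ => ‖(inner ℂ (ψ i) (kraus (Real.exp (-t)) 0 (ψ j)) : ℂ)‖ ^ 2)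
      =O[𝓝[>] 0] fun t : ℝ => t ^ 2 := by
  obtain ⟨K, hK0, hK⟩ := exists_norm_kraus_zero_sub_le hψ hA
  refine isBigO_of_le (K ^ 2) one_pos fun t h0 _ => ?_
  rw [abs_of_nonneg (by positivity), ← mul_pow]
  gcongr
  have h1 : inner ℂ (ψ i) (kraus (Real.exp (-t)) 0 (ψ j))
      = (inner ℂ (ψ i) (kraus (Real.exp (-t)) 0 (ψ j) - ψ j) : ℂ) := by
    rw [inner_sub_right, hψ.2 hij, sub_zero]
  rw [h1]
  refine (norm_inner_le_norm _ _).trans ?_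
  have := hK _ (mem_span_eigenvector j) t h0.le
  rwa [hψ.1 i, one_mul, ← mul_one (K * t), ← hψ.1 j]

/-- The rate of change of the population of the `i`-th eigenvector. -/
def popRate (p : Fin d → ℝ) (A : Fin d → Fin d → ℂ) (i : Fin d) : ℝ :=
  ∑ j, p j * ‖A i j‖ ^ 2 - p i * ∑ k, ‖A k i‖ ^ 2

theorem isBigO_population (hψ : Orthonormal ℂ ψ) (hp : ∀ i, 0 ≤ p i) (hA : IsInvariant ψ A)
    (i : Fin d) :
    (fun t : ℝ => (inner ℂ (ψ i) (lossOp p ψ (Real.exp (-t)) 0 (ψ i))).re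
      - (p i + t * popRate p A i)) =O[𝓝[>] 0] fun t : ℝ => t ^ 2 := by
  have h0 : (fun t : ℝ => ∑ j, p j * (‖(inner ℂ (ψ i) (kraus (Real.exp (-t)) 0 (ψ j)) : ℂ)‖ ^ 2
      - if i = j then (1 - t * ∑ k, ‖A k i‖ ^ 2) else 0)) =O[𝓝[>] 0] fun t : ℝ => t ^ 2 := by
    refine IsBigO.fun_sum fun j _ => IsBigO.const_mul_left ?_ _
    split_ifs with h
    · subst h; exact isBigO_norm_inner_kraus_zero_self hψ hA i
    · simp only [sub_zero]; exact isBigO_norm_inner_kraus_zero_of_ne hψ hA h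
  have h1 : (fun t : ℝ => ∑ j, p j * (‖(inner ℂ (ψ i) (kraus (Real.exp (-t)) 1 (ψ j)) : ℂ)‖ ^ 2
      - t * ‖A i j‖ ^ 2)) =O[𝓝[>] 0] fun t : ℝ => t ^ 2 :=
    IsBigO.fun_sum fun j _ => IsBigO.const_mul_left (isBigO_norm_inner_kraus_one hψ hA i j) _
  have h2 : (fun t : ℝ => (inner ℂ (ψ i) (lossOp p ψ (Real.exp (-t)) 2 (ψ i))).re)
      =O[𝓝[>] 0] fun t : ℝ => t ^ 2 := by
    have hs : (fun t : ℝ => ∑ j, p j * ∑' l, ‖kraus (Real.exp (-t)) (l + 2) (ψ j)‖ ^ 2)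
        =O[𝓝[>] 0] fun t : ℝ => t ^ 2 :=
      IsBigO.fun_sum fun j _ => IsBigO.const_mul_left (isBigO_tsum_norm_kraus_two hA j) _
    refine IsBigO.trans (IsBigO.of_bound 1 ((eventually_mem_Ioc one_pos).mono fun t ht => ?_)) hs
    have e0 := (Real.exp_pos (-t)).le
    have e1 := exp_neg_le_one ht.1.le
    have e2 := re_inner_lossOp_le (p := p) (ψ := ψ) hp e0 e1 2 (hψ.1 i)
    have e3 := re_inner_lossOp_nonneg (p := p) (ψ := ψ) hp e0 e1 2 (ψ i)
    rw [one_mul, Real.norm_eq_abs, Real.norm_eq_abs, abs_of_nonneg e3, abs_of_nonneg (e3.trans e2)]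
    exact e2
  refine ((h0.add h1).add h2).congr' ((eventually_mem_Ioc one_pos).mono fun t ht => ?_)
    EventuallyEq.rfl
  have e0 := (Real.exp_pos (-t)).le
  have e1 := exp_neg_le_one ht.1.le
  simp only
  rw [re_inner_lossOp hp e0 e1 0, re_inner_lossOp hp e0 e1 1]
  simp only [mul_sub, Finset.sum_sub_distrib, mul_ite, mul_zero, Finset.sum_ite_eq,
    Finset.mem_univ, if_true, popRate, mul_one]
  have e3 : ∑ j, p j * (t * ‖A i j‖ ^ 2) = t * ∑ j, p j * ‖A i j‖ ^ 2 := by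
    rw [Finset.mul_sum]; exact Finset.sum_congr rfl fun j _ => by ring
  rw [e3]
  ring

/-- The eigenvectors of the input are eigenvectors of the output up to an error of order `t`. -/
theorem isBigO_norm_output_sub (hψ : Orthonormal ℂ ψ) (hp : ∀ i, 0 ≤ p i) (hA : IsInvariant ψ A)
    (i : Fin d) :
    (fun t : ℝ => ‖lossOp p ψ (Real.exp (-t)) 0 (ψ i) - (p i : ℂ) • ψ i‖ ^ 2)
      =O[𝓝[>] 0] fun t : ℝ => t ^ 2 := by
  obtain ⟨K, hK0, hK⟩ := exists_norm_kraus_zero_sub_le hψ hA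
  have hloss : (fun t : ℝ => ∑ j, p j * ∑' l, ‖kraus (Real.exp (-t)) (l + 1) (ψ j)‖ ^ 2)
      =O[𝓝[>] 0] fun t : ℝ => t ^ 1 := by
    refine IsBigO.fun_sum fun j _ => IsBigO.const_mul_left ?_ _
    refine isBigO_of_le (2 * K) one_pos fun t h0 _ => ?_
    have e0 := (Real.exp_pos (-t)).le
    have e1 := exp_neg_le_one h0.le
    rw [(hasSum_norm_kraus_succ_sq e0 e1 (ψ j)).tsum_eq]
    have h3 := abs_norm_sq_sub_norm_sq_le le_rfl (norm_kraus_le e0 e1 0 (ψ j))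
    rw [norm_sub_rev, hψ.1 j] at h3
    rw [hψ.1 j]
    refine h3.trans ?_
    have := hK _ (mem_span_eigenvector j) t h0.le
    rw [hψ.1 j] at this
    linarith
  have hzero : (fun t : ℝ => ∑ j, p j * (2 * (K * t))) =O[𝓝[>] 0] fun t : ℝ => t ^ 1 := by
    refine isBigO_of_le (∑ j, p j * (2 * K)) one_pos fun t h0 _ => ?_
    rw [Finset.sum_mul, abs_of_nonneg (Finset.sum_nonneg fun j _ =>
      mul_nonneg (hp j) (by positivity))]
    exact (Finset.sum_congr rfl fun j _ => by ring).le
  have hsq := (hzero.add hloss).pow 2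
  have e3 : (fun t : ℝ => (t ^ 1) ^ 2) = fun t : ℝ => t ^ 2 := by ext t; ring
  rw [e3] at hsq
  refine IsBigO.trans (IsBigO.of_bound 1 ((eventually_mem_Ioc one_pos).mono fun t ht => ?_)) hsq
  have e0 := (Real.exp_pos (-t)).le
  have e1 := exp_neg_le_one ht.1.le
  rw [one_mul, Real.norm_eq_abs, Real.norm_eq_abs, abs_of_nonneg (by positivity),
    abs_of_nonneg (by positivity)]
  have hin : (p i : ℂ) • ψ i = ∑ j, (p j : ℂ) • (inner ℂ (ψ j) (ψ i) : ℂ) • ψ j := by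
    rw [Finset.sum_eq_single i]
    · rw [inner_self_eq_norm_sq_to_K, hψ.1 i]; simp
    · intro j _ hji; rw [hψ.2 hji]; simp
    · simp
  have hY : ∀ j, InnerProductSpace.rankOne ℂ (outVec p ψ (Real.exp (-t)) (0, j))
      (outVec p ψ (Real.exp (-t)) (0, j)) (ψ i)
      = (p j : ℂ) • (inner ℂ (kraus (Real.exp (-t)) 0 (ψ j)) (ψ i) : ℂ) •
        kraus (Real.exp (-t)) 0 (ψ j) := fun j => by
    rw [InnerProductSpace.rankOne_apply, outVec, inner_smul_left, Complex.conj_ofReal, smul_smul,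
      smul_smul]
    congr 1
    have : ((√(p j) : ℝ) : ℂ) * ((√(p j) : ℝ) : ℂ) = (p j : ℂ) := by
      rw [← Complex.ofReal_mul, Real.mul_self_sqrt (hp j)]
    rw [← this]
    ring
  gcongr
  rw [lossOp_eq_add hp e0 e1 0, add_apply, sum_apply, add_sub_right_comm, hin,
    ← Finset.sum_sub_distrib]
  refine (norm_add_le _ _).trans (add_le_add ((norm_sum_le _ _).trans
    (Finset.sum_le_sum fun j _ => ?_)) ?_)
  · rw [hY j, ← smul_sub, norm_smul, Complex.norm_real, Real.norm_eq_abs, abs_of_nonneg (hp j)]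
    refine mul_le_mul_of_nonneg_left ?_ (hp j)
    set x := kraus (Real.exp (-t)) 0 (ψ j) with hx
    have hd : ‖x - ψ j‖ ≤ K * t := by
      have := hK _ (mem_span_eigenvector j) t ht.1.le
      rwa [hψ.1 j, mul_one] at this
    have hxn : ‖x‖ ≤ 1 := by
      have := norm_kraus_le e0 e1 0 (ψ j)
      rwa [hψ.1 j] at this
    have e4 : (inner ℂ x (ψ i) : ℂ) • x - (inner ℂ (ψ j) (ψ i) : ℂ) • ψ j
        = (inner ℂ (x - ψ j) (ψ i) : ℂ) • x + (inner ℂ (ψ j) (ψ i) : ℂ) • (x - ψ j) := by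
      rw [inner_sub_left]; module
    rw [e4]
    have e5 : ‖(inner ℂ (x - ψ j) (ψ i) : ℂ)‖ ≤ K * t := by
      have := norm_inner_le_norm (𝕜 := ℂ) (x - ψ j) (ψ i)
      rw [hψ.1 i, mul_one] at this
      exact this.trans hd
    have e6 : ‖(inner ℂ (ψ j) (ψ i) : ℂ)‖ ≤ 1 := by
      have := norm_inner_le_norm (𝕜 := ℂ) (ψ j) (ψ i)
      rwa [hψ.1 i, hψ.1 j, mul_one] at this
    refine (norm_add_le _ _).trans ?_
    rw [norm_smul, norm_smul]
    have := ht.1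
    have e7 := mul_le_mul e5 hxn (norm_nonneg _) (by positivity)
    have e8 := mul_le_mul e6 hd (norm_nonneg _) zero_le_one
    linarith
  · have := (lossOp p ψ (Real.exp (-t)) (0 + 1)).le_opNorm (ψ i)
    rw [hψ.1 i, mul_one] at this
    exact this.trans (norm_lossOp_le hp e0 e1 1)

/-- The output is supported in the image of the support under the no-loss Kraus operator, which
makes an angle of order `t` with the support; so `η` of the output has trace of order `t²` on the
orthogonal complement of the support. -/
theorem exists_tsum_entropyDiag_le (hψ : Orthonormal ℂ ψ) (hp : ∀ i, 0 ≤ p i)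
    (hsum : ∑ i, p i = 1) (hA : IsInvariant ψ A) {κ : Type} (b : HilbertBasis (Fin d ⊕ κ) ℂ Mode)
    (hb : ∀ j, b (Sum.inl j) = ψ j) :
    ∃ C : ℝ, ∃ ε > 0, 0 ≤ C ∧ ∀ t, 0 < t → t ≤ ε →
      ∑' k, ENNReal.ofReal (entropyDiag (lossOp p ψ (Real.exp (-t)) 0) (b (Sum.inr k)))
        ≤ ENNReal.ofReal (C * t ^ 2) := by
  obtain ⟨K, hK0, hK⟩ := exists_norm_kraus_zero_sub_le hψ hA
  set V := Submodule.span ℂ (Set.range ψ) with hV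
  have hfin : FiniteDimensional ℂ V := FiniteDimensional.span_of_finite ℂ (Set.finite_range ψ)
  set n := Module.finrank ℂ V
  refine ⟨n * (4 * K ^ 2), 1 / (2 * K + 1), by positivity, by positivity, fun t h0 htε => ?_⟩
  have e0 := (Real.exp_pos (-t)).le
  have e1 := exp_neg_le_one h0.le
  set X := lossOp p ψ (Real.exp (-t)) 0 with hX
  have hpos : X.IsPositive := lossOp_zero_isPositive hp e0 e1
  have hX1 : ‖X‖ ≤ 1 := norm_lossOp_zero_le_one hp hsum hψ e0 e1
  set W := V.map (kraus (Real.exp (-t)) 0 : Mode →ₗ[ℂ] Mode) with hW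
  have hWfin : FiniteDimensional ℂ W := inferInstance
  have hWn : Module.finrank ℂ W ≤ n := Submodule.finrank_map_le _ _
  set χ := stdOrthonormalBasis ℂ W
  have hKt : K * t ≤ 1 / 2 := by
    have : t * (2 * K + 1) ≤ 1 := by
      have := (le_div_iff₀ (by positivity)).1 htε
      linarith
    nlinarith
  have hker : ∀ φ, X (φ - W.starProjection φ) = 0 := fun φ => by
    have horth := W.sub_starProjection_mem_orthogonal φ
    have hs := hasSum_gramOp_apply (summable_loss (p := p) (ψ := ψ) hp e0 e1 0)
      (φ - W.starProjection φ)
    refine hs.unique ?_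
    refine (hasSum_zero).congr_fun fun s => ?_
    have hmem : outVec p ψ (Real.exp (-t)) (s.1 + 0, s.2) ∈ W :=
      Submodule.smul_mem _ _ (kraus_mem_map hA e0 e1 _ _ (mem_span_eigenvector _))
    rw [(Submodule.mem_orthogonal W _).1 horth _ hmem, zero_smul]
  have hproj : ∀ φ, ‖W.starProjection φ‖ ^ 2 = ∑ j, ‖(inner ℂ (χ j : Mode) φ : ℂ)‖ ^ 2 := by
    intro φ
    rw [Submodule.starProjection_apply, Submodule.norm_coe,
      ← χ.sum_sq_norm_inner_right (W.orthogonalProjectionOnto φ)]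
    refine Finset.sum_congr rfl fun j _ => ?_
    congr 2
    rw [Submodule.coe_inner, ← Submodule.starProjection_apply,
      ← W.inner_starProjection_left_eq_right, Submodule.starProjection_apply,
      Submodule.orthogonalProjectionOnto_mem_subspace_eq_self]
  have hangle : ∀ j, ∑' k, ENNReal.ofReal (‖(inner ℂ (χ j : Mode) (b (Sum.inr k)) : ℂ)‖ ^ 2)
      ≤ ENNReal.ofReal (4 * K ^ 2 * t ^ 2) := by
    intro j
    obtain ⟨v, hv, hvχ⟩ := (χ j).2
    have hvχ' : kraus (Real.exp (-t)) 0 v = (χ j : Mode) := hvχ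
    have hd := hK v hv t h0.le
    rw [hvχ'] at hd
    have hχ1 : ‖(χ j : Mode)‖ = 1 := χ.orthonormal.1 j
    have hv2 : ‖v‖ ≤ 2 := by
      have h1 := norm_sub_norm_le v (χ j : Mode)
      rw [norm_sub_rev] at h1
      have h2 : K * t * ‖v‖ ≤ 1 / 2 * ‖v‖ := by gcongr
      linarith
    have hd2 : ‖(χ j : Mode) - v‖ ≤ 2 * K * t := by
      have : K * t * ‖v‖ ≤ K * t * 2 := by gcongr
      linarith
    have hin : ∀ k, ‖(inner ℂ (χ j : Mode) (b (Sum.inr k)) : ℂ)‖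
        = ‖(inner ℂ (b (Sum.inr k)) ((χ j : Mode) - v) : ℂ)‖ := by
      intro k
      have hvk : inner ℂ (b (Sum.inr k)) v = (0 : ℂ) := by
        obtain ⟨c, rfl⟩ := (Submodule.mem_span_range_iff_exists_fun ℂ).1 hv
        rw [inner_sum]
        refine Finset.sum_eq_zero fun i _ => ?_
        rw [inner_smul_right, ← hb, b.orthonormal.2 (by simp), mul_zero]
      rw [norm_inner_symm, inner_sub_right, hvk, sub_zero]
    simp only [hin]
    calc _ ≤ ∑' i, ENNReal.ofReal (‖(inner ℂ (b i) ((χ j : Mode) - v) : ℂ)‖ ^ 2) :=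
          ENNReal.tsum_comp_le_tsum_of_injective Sum.inr_injective _
      _ = ENNReal.ofReal (‖(χ j : Mode) - v‖ ^ 2) := (ofReal_norm_sq_eq_tsum b _).symm
      _ ≤ _ := by
          refine ENNReal.ofReal_le_ofReal ?_
          calc _ ≤ (2 * K * t) ^ 2 := by gcongr
            _ = _ := by ring
  calc _ ≤ ∑' k, ∑ j, ENNReal.ofReal (‖(inner ℂ (χ j : Mode) (b (Sum.inr k)) : ℂ)‖ ^ 2) := by
        refine ENNReal.tsum_le_tsum fun k => ?_
        rw [← ENNReal.ofReal_sum_of_nonneg fun _ _ => by positivity]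
        refine ENNReal.ofReal_le_ofReal ?_
        rw [← hproj]
        exact entropyDiag_le_norm_sq hpos hX1 (hker _)
    _ = ∑ j, ∑' k, ENNReal.ofReal (‖(inner ℂ (χ j : Mode) (b (Sum.inr k)) : ℂ)‖ ^ 2) :=
        Summable.tsum_finsetSum fun _ _ => ENNReal.summable
    _ ≤ ∑ j : Fin (Module.finrank ℂ W), ENNReal.ofReal (4 * K ^ 2 * t ^ 2) :=
        Finset.sum_le_sum fun j _ => hangle j
    _ ≤ _ := by
        rw [← ENNReal.ofReal_sum_of_nonneg fun _ _ => by positivity]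
        refine ENNReal.ofReal_le_ofReal ?_
        rw [Finset.sum_const, Finset.card_univ, Fintype.card_fin, nsmul_eq_mul, mul_assoc]
        have : (Module.finrank ℂ W : ℝ) ≤ n := by exact_mod_cast hWn
        rw [mul_assoc, ← mul_assoc 4]
        exact mul_le_mul_of_nonneg_right this (by positivity)

end expansion

/-! ### The entropy derivative for an invariant support -/

section derivative

open Asymptotics

variable {d : ℕ} {p : Fin d → ℝ} {ψ : Fin d → Mode} {A : Fin d → Fin d → ℂ}

/-- The diagonal of `η(X)` in the eigenbasis is squeezed between the tangent of `η` and its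
quadratic correction. -/
theorem isBigO_entropyDiag (hψ : Orthonormal ℂ ψ) (hp : ∀ i, 0 < p i) (hsum : ∑ i, p i = 1)
    (hA : IsInvariant ψ A) (i : Fin d) :
    (fun t : ℝ => entropyDiag (lossOp p ψ (Real.exp (-t)) 0) (ψ i)
      - (Real.negMulLog (p i) + t * ((-Real.log (p i) - 1) * popRate p A i)))
      =O[𝓝[>] 0] fun t : ℝ => t ^ 2 := by
  have hp' : ∀ i, 0 ≤ p i := fun i => (hp i).le
  have h1 := ((isBigO_population hψ hp' hA i).const_mul_left (-Real.log (p i) - 1)).norm_left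
  have h2 := (isBigO_norm_output_sub hψ hp' hA i).const_mul_left (1 / p i)
  refine IsBigO.trans (IsBigO.of_bound 1 ((eventually_mem_Ioc one_pos).mono fun t ht => ?_))
    (h1.add h2)
  have e0 := (Real.exp_pos (-t)).le
  have e1 := exp_neg_le_one ht.1.le
  have hpos := lossOp_zero_isPositive (p := p) (ψ := ψ) hp' e0 e1
  have hX1 := norm_lossOp_zero_le_one (p := p) (ψ := ψ) hp' hsum hψ e0 e1
  have hu := entropyDiag_le_tangent hpos hX1 (hp i) (hψ.1 i)
  have hl := tangent_sub_le_entropyDiag hpos hX1 (hp i) (hψ.1 i)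
  set X := lossOp p ψ (Real.exp (-t)) 0
  set q := (inner ℂ (ψ i) (X (ψ i))).re
  set c := -Real.log (p i) - 1
  have hpi := hp i
  have hn : 0 ≤ 1 / p i * ‖X (ψ i) - (p i : ℂ) • ψ i‖ ^ 2 := by positivity
  have e2 : ‖X (ψ i) - (p i : ℂ) • ψ i‖ ^ 2 / p i
      = 1 / p i * ‖X (ψ i) - (p i : ℂ) • ψ i‖ ^ 2 := by ring
  rw [e2] at hl
  rw [one_mul, Real.norm_eq_abs, Real.norm_eq_abs, Real.norm_eq_abs,
    abs_of_nonneg (add_nonneg (abs_nonneg _) hn)]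
  have e3 := le_abs_self (c * (q - (p i + t * popRate p A i)))
  have e4 := neg_abs_le (c * (q - (p i + t * popRate p A i)))
  rw [abs_le]
  constructor <;> linarith

/-- A function `S0 + D t + O(t²)` has right derivative `D`. -/
theorem hasRightDeriv_of_isBigO {S : ℝ → ENNReal} {a : ℝ → ℝ} {b : ℝ → ENNReal} {C S₀ D : ℝ}
    (hS0 : S 0 = ENNReal.ofReal S₀) (hS₀ : 0 ≤ S₀) (hC : 0 ≤ C)
    (hS : ∀ᶠ t in 𝓝[>] 0, 0 ≤ a t ∧ S t = ENNReal.ofReal (a t) + b t ∧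
      b t ≤ ENNReal.ofReal (C * t ^ 2))
    (ha : (fun t => a t - (S₀ + t * D)) =O[𝓝[>] 0] fun t : ℝ => t ^ 2) :
    HasRightDeriv (fun t => (S t : EReal)) (D : EReal) 0 := by
  set r : ℝ → ℝ := fun t => a t + (b t).toReal - (S₀ + t * D) with hr
  have hrO : r =O[𝓝[>] 0] fun t : ℝ => t ^ 2 := by
    have hbO : (fun t => (b t).toReal) =O[𝓝[>] 0] fun t : ℝ => t ^ 2 := by
      refine IsBigO.of_bound C (hS.mono fun t ht => ?_)
      rw [Real.norm_eq_abs, Real.norm_eq_abs, abs_of_nonneg ENNReal.toReal_nonneg,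
        abs_of_nonneg (by positivity)]
      exact ENNReal.toReal_le_of_le_ofReal (by positivity) ht.2.2
    refine (ha.add hbO).congr_left fun t => ?_
    simp only [hr]; ring
  have hlim : Tendsto (fun t => D + r t / t) (𝓝[>] 0) (𝓝 D) := by
    have h1 : (fun t => r t / t) =O[𝓝[>] 0] fun t : ℝ => t := by
      have h2 := hrO.mul (isBigO_refl (fun t : ℝ => t⁻¹) (𝓝[>] 0))
      refine h2.congr' (Eventually.of_forall fun t => (div_eq_mul_inv _ _).symm)
        ((eventually_mem_Ioc one_pos).mono fun t ht => ?_)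
      have := ht.1.ne'
      field_simp
    have h3 : Tendsto (fun t : ℝ => t) (𝓝[>] 0) (𝓝 0) :=
      tendsto_nhdsWithin_of_tendsto_nhds tendsto_id
    have h4 := h1.trans_tendsto h3
    simpa using h4.const_add D
  refine (continuous_coe_real_ereal.tendsto D).comp hlim |>.congr' ?_
  filter_upwards [hS, eventually_mem_Ioc one_pos] with t ht ht0
  have hb : b t = ENNReal.ofReal (b t).toReal :=
    (ENNReal.ofReal_toReal (ht.2.2.trans_lt ENNReal.ofReal_lt_top).ne).symm
  have hSt : S t = ENNReal.ofReal (a t + (b t).toReal) := by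
    rw [ht.2.1, ENNReal.ofReal_add ht.1 ENNReal.toReal_nonneg, ← hb]
  rw [hSt, hS0, EReal.coe_ennreal_ofReal, EReal.coe_ennreal_ofReal,
    max_eq_left (add_nonneg ht.1 ENNReal.toReal_nonneg), max_eq_left hS₀, sub_zero,
    ← EReal.coe_sub, ← EReal.coe_div, Function.comp_apply, EReal.coe_eq_coe_iff]
  have := ht0.1.ne'
  simp only [hr]
  field_simp
  ring

theorem attenuator_exp_zero_eq (X : Mode →L[ℂ] Mode) : attenuator (Real.exp (-0)) X = X := by
  rw [neg_zero, Real.exp_zero, attenuator_one]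

theorem negMulLog_eigenvalue_nonneg (hp : ∀ i, 0 < p i) (hsum : ∑ i, p i = 1) :
    0 ≤ ∑ i, Real.negMulLog (p i) :=
  Finset.sum_nonneg fun i _ => Real.negMulLog_nonneg (hp i).le (by
    rw [← hsum]; exact Finset.single_le_sum (fun j _ => (hp j).le) (Finset.mem_univ i))

theorem hasRightDeriv_entropy_of_isInvariant (hψ : Orthonormal ℂ ψ) (hp : ∀ i, 0 < p i)
    (hsum : ∑ i, p i = 1) (hA : IsInvariant ψ A) :
    HasRightDeriv (fun t => (entropy (attenuator (Real.exp (-t))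
      (∑ i, (p i : ℂ) • InnerProductSpace.rankOne ℂ (ψ i) (ψ i))) : EReal))
      ((∑ i, (-Real.log (p i) - 1) * popRate p A i : ℝ) : EReal) 0 := by
  have hp' : ∀ i, 0 ≤ p i := fun i => (hp i).le
  obtain ⟨κ, b, hb⟩ := exists_hilbertBasis_sum hψ
  obtain ⟨C, ε, hε, hC, htail⟩ := exists_tsum_entropyDiag_le hψ hp' hsum hA b hb
  refine hasRightDeriv_of_isBigO (S₀ := ∑ i, Real.negMulLog (p i)) (C := C)
    (a := fun t => ∑ i, entropyDiag (lossOp p ψ (Real.exp (-t)) 0) (ψ i))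
    (b := fun t => ∑' k, ENNReal.ofReal (entropyDiag (lossOp p ψ (Real.exp (-t)) 0)
      (b (Sum.inr k)))) ?_ (negMulLog_eigenvalue_nonneg hp hsum) hC ?_ ?_
  · rw [attenuator_exp_zero_eq, entropy_of_spectral_decomposition hp hsum hψ]
  · filter_upwards [eventually_mem_Ioc hε] with t ht
    have e0 := (Real.exp_pos (-t)).le
    have e1 := exp_neg_le_one ht.1.le
    have hpos := lossOp_zero_isPositive (p := p) (ψ := ψ) hp' e0 e1
    have hX1 := norm_lossOp_zero_le_one (p := p) (ψ := ψ) hp' hsum hψ e0 e1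
    refine ⟨Finset.sum_nonneg fun i _ => entropyDiag_nonneg hpos hX1 _, ?_, htail t ht.1 ht.2⟩
    rw [attenuator_eq_gramOp hp' e0 e1, ← lossOp_zero, entropy_eq_sum_add_tsum hpos hX1 b]
    simp only [hb]
  · refine (IsBigO.fun_sum (s := Finset.univ) fun i _ =>
      isBigO_entropyDiag hψ hp hsum hA i).congr_left fun t => ?_
    rw [Finset.sum_sub_distrib, Finset.sum_add_distrib, ← Finset.mul_sum]

/-- The derivative of the entropy as a sum over transitions between eigenvectors. -/
theorem sum_log_mul_popRate :
    ∑ i, (-Real.log (p i) - 1) * popRate p A i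
      = - ∑ i, ∑ j, ‖A i j‖ ^ 2 * p j * (Real.log (p i) - Real.log (p j)) := by
  have h1 : ∀ c : Fin d → ℝ, ∑ i, c i * (p i * ∑ k, ‖A k i‖ ^ 2)
      = ∑ i, ∑ j, c j * (p j * ‖A i j‖ ^ 2) := fun c => by
    rw [Finset.sum_comm]
    refine Finset.sum_congr rfl fun i _ => ?_
    rw [Finset.mul_sum, Finset.mul_sum]
  simp only [popRate, mul_sub, Finset.sum_sub_distrib]
  rw [h1, ← Finset.sum_sub_distrib, ← Finset.sum_sub_distrib, ← Finset.sum_neg_distrib]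
  refine Finset.sum_congr rfl fun i _ => ?_
  rw [Finset.mul_sum, ← Finset.sum_sub_distrib, ← Finset.sum_sub_distrib,
    ← Finset.sum_neg_distrib]
  exact Finset.sum_congr rfl fun j _ => by ring

theorem f_le_derivative (hψ : Orthonormal ℂ ψ) (hp : ∀ i, 0 < p i) (hanti : Antitone p)
    (hsum : ∑ i, p i = 1) (hA : IsInvariant ψ A) :
    f (∑ i, Real.negMulLog (p i)) ≤ ∑ i, (-Real.log (p i) - 1) * popRate p A i := by
  rw [sum_log_mul_popRate]
  exact f_le_neg_sum_rate_mul_log p hp hanti hsum _ (fun _ _ => by positivity)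
    (row_le_one_add_column hψ hA)

end derivative

/-! ### The no-loss part of the output -/

section frame

variable {d : ℕ} {p : Fin d → ℝ} {ψ : Fin d → Mode}

/-- The no-loss Kraus operator is bounded below on a finite-dimensional space, uniformly for short
times, since its norm on any vector decreases in time. -/
theorem exists_le_norm_kraus_zero (W : Submodule ℂ Mode) [FiniteDimensional ℂ W] :
    ∃ c : ℝ, 0 < c ∧ ∀ v ∈ W, ∀ t : ℝ, 0 ≤ t → t ≤ 1 →
      c * ‖v‖ ≤ ‖kraus (Real.exp (-t)) 0 v‖ := by
  set T : W →ₗ[ℂ] Mode := (kraus (Real.exp (-1)) 0 : Mode →ₗ[ℂ] Mode) ∘ₗ W.subtype with hT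
  have hker : LinearMap.ker T = ⊥ := by
    rw [LinearMap.ker_eq_bot]
    exact (kraus_zero_injective (Real.exp_pos _) (exp_neg_le_one zero_le_one)).comp
      Subtype.val_injective
  obtain ⟨K, hK, hT'⟩ := T.exists_antilipschitzWith hker
  refine ⟨(K : ℝ)⁻¹, by positivity, fun v hv t h0 h1 => ?_⟩
  have h := hT'.le_mul_dist ⟨v, hv⟩ 0
  rw [map_zero, dist_zero_right, dist_zero_right] at h
  have h2 : ‖T ⟨v, hv⟩‖ ≤ ‖kraus (Real.exp (-t)) 0 v‖ :=
    norm_kraus_zero_le_of_le (Real.exp_pos _).le (Real.exp_le_exp.2 (by linarith))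
      (exp_neg_le_one h0) v
  rw [inv_mul_le_iff₀ (by positivity)]
  exact h.trans (by gcongr)

/-- The probability of losing at least one photon. -/
def lossProb (p : Fin d → ℝ) (ψ : Fin d → Mode) (lam : ℝ) : ℝ :=
  ∑ i, p i * ∑' l, ‖kraus lam (l + 1) (ψ i)‖ ^ 2

theorem lossProb_eq {lam : ℝ} (h0 : 0 ≤ lam) (h1 : lam ≤ 1) :
    lossProb p ψ lam = ∑ i, p i * (‖ψ i‖ ^ 2 - ‖kraus lam 0 (ψ i)‖ ^ 2) :=
  Finset.sum_congr rfl fun i _ => by rw [(hasSum_norm_kraus_succ_sq h0 h1 (ψ i)).tsum_eq]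

theorem lossProb_nonneg (hp : ∀ i, 0 ≤ p i) (lam : ℝ) : 0 ≤ lossProb p ψ lam :=
  Finset.sum_nonneg fun i _ => mul_nonneg (hp i) (tsum_nonneg fun _ => by positivity)

/-- The no-loss part `∑ i, p_i |D ψ_i⟩⟨D ψ_i|` of the output. -/
def noLossOp (p : Fin d → ℝ) (ψ : Fin d → Mode) (lam : ℝ) : Mode →L[ℂ] Mode :=
  ∑ i, InnerProductSpace.rankOne ℂ (outVec p ψ lam (0, i)) (outVec p ψ lam (0, i))

theorem noLossOp_apply (lam : ℝ) (φ : Mode) :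
    noLossOp p ψ lam φ
      = ∑ i, (inner ℂ (outVec p ψ lam (0, i)) φ : ℂ) • outVec p ψ lam (0, i) := by
  rw [noLossOp, sum_apply]; rfl

theorem sum_smul_outVec_zero (lam : ℝ) (u : Fin d → ℂ) :
    ∑ i, u i • outVec p ψ lam (0, i)
      = kraus lam 0 (∑ i, (u i * ((√(p i) : ℝ) : ℂ)) • ψ i) := by
  rw [map_sum]
  refine Finset.sum_congr rfl fun i _ => ?_
  rw [outVec, map_smul, smul_smul]

/-- Spectral decomposition of the no-loss part, through the Gram matrix of its vectors.  The entropy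
of the input exceeds that of the no-loss part by at most a multiple of the loss probability. -/
theorem exists_noLoss_spectral_decomposition (hψ : Orthonormal ℂ ψ) (hp : ∀ i, 0 < p i)
    (hsum : ∑ i, p i = 1) :
    ∃ ymin : ℝ, 0 < ymin ∧ ∀ t : ℝ, 0 ≤ t → t ≤ 1 →
      ∃ (φ : Fin d → Mode) (y : Fin d → ℝ), Orthonormal ℂ φ ∧
        (∀ j, φ j ∈ (Submodule.span ℂ (Set.range ψ)).map
          (kraus (Real.exp (-t)) 0 : Mode →ₗ[ℂ] Mode)) ∧
        (∀ j, noLossOp p ψ (Real.exp (-t)) (φ j) = (y j : ℂ) • φ j) ∧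
        (∀ χ, (∀ j, inner ℂ (φ j) χ = (0 : ℂ)) → noLossOp p ψ (Real.exp (-t)) χ = 0) ∧
        (∀ j, ymin ≤ y j ∧ y j ≤ 1) ∧
        ∑ i, Real.negMulLog (p i) ≤ ∑ j, Real.negMulLog (y j)
          + |Real.log ymin| * lossProb p ψ (Real.exp (-t)) := by
  have hne : Nonempty (Fin d) := by
    by_contra h
    rw [not_nonempty_iff] at h
    simp at hsum
  have hV : FiniteDimensional ℂ (Submodule.span ℂ (Set.range ψ)) :=
    FiniteDimensional.span_of_finite ℂ (Set.finite_range ψ)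
  obtain ⟨c, hc, hcV⟩ := exists_le_norm_kraus_zero (Submodule.span ℂ (Set.range ψ))
  obtain ⟨i₀, hi₀⟩ := Finite.exists_min p
  refine ⟨c ^ 2 * p i₀, by have := hp i₀; positivity, fun t ht0 ht1 => ?_⟩
  set ymin := c ^ 2 * p i₀ with hymin
  have hymin0 : 0 < ymin := by have := hp i₀; positivity
  have e0 := (Real.exp_pos (-t)).le
  have e1 := exp_neg_le_one ht0
  set lam := Real.exp (-t)
  set w : Fin d → Mode := fun i => outVec p ψ lam (0, i) with hw
  set G : Matrix (Fin d) (Fin d) ℂ := Matrix.of fun i j => inner ℂ (w i) (w j) with hG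
  have hGh : G.IsHermitian := by
    ext i j
    simp [hG]
  set u := hGh.eigenvectorBasis with hu
  set y := hGh.eigenvalues with hy
  set T : (Fin d → ℂ) → Mode := fun x => ∑ i, x i • w i with hT
  have hGu : ∀ j i, ∑ k, (inner ℂ (w i) (w k) : ℂ) * u j k = (y j : ℂ) * u j i := fun j i => by
    have := congrFun (hGh.mulVec_eigenvectorBasis j) i
    simpa [Matrix.mulVec, dotProduct, hG] using this
  have hwT : ∀ j i, inner ℂ (w i) (T (u j)) = (y j : ℂ) * u j i := fun j i => by
    rw [hT, inner_sum, ← hGu]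
    refine Finset.sum_congr rfl fun k _ => ?_
    rw [inner_smul_right, mul_comm]
  have hTT : ∀ k j, inner ℂ (T (u k)) (T (u j)) = (y j : ℂ) * inner ℂ (u k) (u j) := fun k j => by
    conv_lhs => rw [hT]
    rw [sum_inner, PiLp.inner_apply, Finset.mul_sum]
    refine Finset.sum_congr rfl fun i _ => ?_
    rw [inner_smul_left]
    change _ * inner ℂ (w i) (T (u j)) = _
    rw [hwT, RCLike.inner_apply]
    ring
  have hnormu : ∀ j, ∑ i, ‖u j i‖ ^ 2 = 1 := fun j => by
    have := u.orthonormal.1 j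
    rw [EuclideanSpace.norm_eq, Real.sqrt_eq_one] at this
    exact this
  have hnormu' : ∀ i, ∑ j, ‖u j i‖ ^ 2 = 1 := fun i => by
    have := u.sum_sq_norm_inner_right (EuclideanSpace.single i (1 : ℂ))
    simpa [EuclideanSpace.inner_single_right] using this
  have hynorm : ∀ j, y j = ‖T (u j)‖ ^ 2 := fun j => by
    have := hTT j j
    rw [inner_self_eq_norm_sq_to_K, inner_self_eq_norm_sq_to_K, u.orthonormal.1 j] at this
    simp only [Complex.coe_algebraMap, Complex.ofReal_one, one_pow, mul_one] at this
    exact_mod_cast this.symm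
  set r : Fin d → ℝ := fun j => ∑ i, ‖u j i‖ ^ 2 * p i with hr
  set v : Fin d → Mode := fun j => ∑ i, (u j i * ((√(p i) : ℝ) : ℂ)) • ψ i with hv
  have hvmem : ∀ j, v j ∈ Submodule.span ℂ (Set.range ψ) := fun j =>
    Submodule.sum_mem _ fun i _ => Submodule.smul_mem _ _ (mem_span_eigenvector i)
  have hTv : ∀ j, T (u j) = kraus lam 0 (v j) := fun j => sum_smul_outVec_zero lam _
  have hrv : ∀ j, r j = ‖v j‖ ^ 2 := fun j => by
    rw [hv, norm_sq_sum_smul hψ]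
    refine Finset.sum_congr rfl fun i _ => ?_
    rw [norm_mul, mul_pow, Complex.norm_real, Real.norm_eq_abs, sq_abs, Real.sq_sqrt (hp i).le]
  have hrlow : ∀ j, p i₀ ≤ r j := fun j => by
    calc p i₀ = ∑ i, ‖u j i‖ ^ 2 * p i₀ := by rw [← Finset.sum_mul, hnormu, one_mul]
      _ ≤ r j := Finset.sum_le_sum fun i _ => mul_le_mul_of_nonneg_left (hi₀ i) (by positivity)
  have hp1 : ∀ i, p i ≤ 1 := fun i => by
    rw [← hsum]; exact Finset.single_le_sum (fun j _ => (hp j).le) (Finset.mem_univ i)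
  have hrup : ∀ j, r j ≤ 1 := fun j => by
    calc r j ≤ ∑ i, ‖u j i‖ ^ 2 * 1 :=
          Finset.sum_le_sum fun i _ => mul_le_mul_of_nonneg_left (hp1 i) (by positivity)
      _ = 1 := by simp only [mul_one, hnormu]
  have hyr : ∀ j, y j ≤ r j := fun j => by
    rw [hynorm, hrv, hTv]
    have := norm_kraus_le e0 e1 0 (v j)
    gcongr
  have hylow : ∀ j, ymin ≤ y j := fun j => by
    have h1 := hcV (v j) (hvmem j) t ht0 ht1
    calc ymin ≤ c ^ 2 * r j := mul_le_mul_of_nonneg_left (hrlow j) (by positivity)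
      _ = (c * ‖v j‖) ^ 2 := by rw [hrv]; ring
      _ ≤ y j := by rw [hynorm, hTv]; gcongr
  have hypos : ∀ j, 0 < y j := fun j => hymin0.trans_le (hylow j)
  have hsqrt : ∀ j, ((√(y j) : ℝ) : ℂ) ≠ 0 := fun j => by
    have := hypos j
    norm_cast; positivity
  set φ : Fin d → Mode := fun j => ((√(y j) : ℝ) : ℂ)⁻¹ • T (u j) with hφ
  have hY : ∀ j, noLossOp p ψ lam (T (u j)) = (y j : ℂ) • T (u j) := fun j => by
    rw [noLossOp_apply]
    change ∑ i, (inner ℂ (w i) (T (u j)) : ℂ) • w i = _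
    simp only [hwT]
    rw [hT, Finset.smul_sum]
    simp only [mul_smul]
  refine ⟨φ, y, ?_, fun j => ?_, fun j => ?_, fun χ hχ => ?_, fun j => ⟨hylow j,
    (hyr j).trans (hrup j)⟩, ?_⟩
  · rw [orthonormal_iff_ite]
    intro k j
    rw [hφ, inner_smul_left, inner_smul_right, hTT, orthonormal_iff_ite.1 u.orthonormal k j]
    split_ifs with h
    · subst h
      have h2 : ((√(y k) : ℝ) : ℂ) * ((√(y k) : ℝ) : ℂ) = (y k : ℂ) := by
        rw [← Complex.ofReal_mul, Real.mul_self_sqrt (hypos k).le]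
      have := hsqrt k
      rw [← h2, map_inv₀, Complex.conj_ofReal]
      field_simp
    · simp
  · refine Submodule.smul_mem _ _ ?_
    rw [hTv]
    exact ⟨v j, hvmem j, rfl⟩
  · rw [hφ, map_smul, hY, smul_comm]
  · have hg : ∀ i, inner ℂ (w i) χ = (0 : ℂ) := by
      set gv : EuclideanSpace ℂ (Fin d) := WithLp.toLp 2 fun i => inner ℂ (w i) χ with hgv
      have h1 : ∀ j, inner ℂ (u j) gv = (0 : ℂ) := fun j => by
        have h2 : inner ℂ (T (u j)) χ = (0 : ℂ) := by
          have := hχ j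
          rw [hφ, inner_smul_left] at this
          exact (mul_eq_zero.1 this).resolve_left (by simpa using hsqrt j)
        rw [← h2, hT, sum_inner, PiLp.inner_apply]
        refine Finset.sum_congr rfl fun i _ => ?_
        rw [inner_smul_left, RCLike.inner_apply, mul_comm]
      have h3 : gv = 0 := by
        have := u.sum_sq_norm_inner_right gv
        simp only [h1, norm_zero, ne_eq, OfNat.ofNat_ne_zero, not_false_eq_true, zero_pow,
          Finset.sum_const_zero] at this
        simpa using this.symm
      intro i
      have := congrArg (fun x : EuclideanSpace ℂ (Fin d) => x i) h3
      simpa [hgv] using this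
    rw [noLossOp_apply]
    refine Finset.sum_eq_zero fun i _ => ?_
    have := hg i
    rw [hw] at this
    rw [this, zero_smul]
  · have hysum : ∑ j, y j = ∑ i, p i * ‖kraus lam 0 (ψ i)‖ ^ 2 := by
      have h1 := hGh.trace_eq_sum_eigenvalues
      rw [Matrix.trace] at h1
      have h2 : ∀ i, G.diag i = ((p i * ‖kraus lam 0 (ψ i)‖ ^ 2 : ℝ) : ℂ) := fun i => by
        have := norm_outVec_sq (p := p) (ψ := ψ) (lam := lam) (fun i => (hp i).le) (0, i)
        rw [← this]
        simp only [Matrix.diag_apply, hG, Matrix.of_apply, hw]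
        rw [inner_self_eq_norm_sq_to_K]
        norm_cast
      simp only [h2] at h1
      have h3 : ((∑ i, p i * ‖kraus lam 0 (ψ i)‖ ^ 2 : ℝ) : ℂ) = ((∑ j, y j : ℝ) : ℂ) := by
        rw [Complex.ofReal_sum, Complex.ofReal_sum]; exact h1
      exact_mod_cast h3.symm
    have hrsum : ∑ j, r j = 1 := by
      rw [hr, Finset.sum_comm, ← hsum]
      refine Finset.sum_congr rfl fun i _ => ?_
      rw [← Finset.sum_mul, hnormu', one_mul]
    have hδ : lossProb p ψ lam = ∑ j, (r j - y j) := by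
      rw [Finset.sum_sub_distrib, hrsum, hysum, lossProb_eq e0 e1, ← hsum, ← Finset.sum_sub_distrib]
      refine Finset.sum_congr rfl fun i _ => ?_
      rw [hψ.1 i]; ring
    have h1 : ∑ i, Real.negMulLog (p i) = ∑ j, ∑ i, ‖u j i‖ ^ 2 * Real.negMulLog (p i) := by
      rw [Finset.sum_comm]
      refine Finset.sum_congr rfl fun i _ => ?_
      rw [← Finset.sum_mul, hnormu', one_mul]
    rw [h1, hδ, Finset.mul_sum, ← Finset.sum_add_distrib]
    refine Finset.sum_le_sum fun j _ => ?_
    calc ∑ i, ‖u j i‖ ^ 2 * Real.negMulLog (p i)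
        ≤ ∑ i, ‖u j i‖ ^ 2 * (Real.negMulLog (y j) + (-Real.log (y j) - 1) * (p i - y j)) :=
          Finset.sum_le_sum fun i _ => mul_le_mul_of_nonneg_left
            (negMulLog_le_tangent (hypos j) (hp i).le) (by positivity)
      _ = Real.negMulLog (y j) + (-Real.log (y j) - 1) * (r j - y j) := by
          have h2 : ∀ i, ‖u j i‖ ^ 2 * (Real.negMulLog (y j) + (-Real.log (y j) - 1) * (p i - y j))
              = ‖u j i‖ ^ 2 * (Real.negMulLog (y j) - (-Real.log (y j) - 1) * y j)
                + (-Real.log (y j) - 1) * (‖u j i‖ ^ 2 * p i) := fun i => by ring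
          simp only [h2]
          rw [Finset.sum_add_distrib, ← Finset.sum_mul, hnormu, ← Finset.mul_sum]
          ring
      _ ≤ _ := by
          have h3 : -Real.log (y j) ≤ |Real.log ymin| :=
            (neg_le_neg (Real.log_le_log hymin0 (hylow j))).trans (neg_le_abs _)
          have h4 : 0 ≤ r j - y j := sub_nonneg.2 (hyr j)
          nlinarith

end frame

/-! ### Infinite entropy production -/

section leak

variable {d : ℕ} {p : Fin d → ℝ} {ψ : Fin d → Mode} {lam : ℝ}

/-- The probability that a photon is lost and that the output is then found in the span of the
orthonormal vectors `φ j`. -/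
def caughtProb (p : Fin d → ℝ) (ψ : Fin d → Mode) (lam : ℝ) (φ : Fin d → Mode) : ℝ :=
  ∑ j, (inner ℂ (φ j) (lossOp p ψ lam 1 (φ j))).re

theorem hasSum_lossProb (hp : ∀ i, 0 ≤ p i) (h0 : 0 ≤ lam) (h1 : lam ≤ 1) :
    HasSum (fun s : ℕ × Fin d => ‖outVec p ψ lam (s.1 + 1, s.2)‖ ^ 2) (lossProb p ψ lam) :=
  hasSum_loss hp h0 h1 1

theorem tsum_inner_lossOp_compl (hp : ∀ i, 0 ≤ p i) (h0 : 0 ≤ lam) (h1 : lam ≤ 1) {κ : Type*}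
    (b : HilbertBasis (Fin d ⊕ κ) ℂ Mode) {φ : Fin d → Mode} (hb : ∀ j, b (Sum.inl j) = φ j) :
    ENNReal.ofReal (caughtProb p ψ lam φ)
      + ∑' k, ENNReal.ofReal (inner ℂ (b (Sum.inr k)) (lossOp p ψ lam 1 (b (Sum.inr k)))).re
      = ENNReal.ofReal (lossProb p ψ lam) := by
  rw [← (hasSum_lossProb (ψ := ψ) hp h0 h1).tsum_eq,
    ← tsum_inner_gramOp (summable_loss hp h0 h1 1) b,
    (HasSum.sum (ENNReal.summable.hasSum) (ENNReal.summable.hasSum)).tsum_eq, caughtProb,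
    ENNReal.ofReal_sum_of_nonneg (fun _ _ => re_inner_lossOp_nonneg hp h0 h1 1 _)]
  simp only [← hb]
  exact congrArg (· + _) (tsum_fintype _).symm

/-- Lower bound for the output entropy.  The rare events in which a photon is lost and the output
leaves the support of the no-loss part contribute with a logarithmically large factor `C`. -/
theorem le_entropy_output (hp : ∀ i, 0 ≤ p i) (hsum : ∑ i, p i = 1) (hψ : Orthonormal ℂ ψ)
    (h0 : 0 ≤ lam) (h1 : lam ≤ 1) {φ : Fin d → Mode} {y : Fin d → ℝ} {ymin C : ℝ}
    (hφ : Orthonormal ℂ φ) (hY : ∀ j, noLossOp p ψ lam (φ j) = (y j : ℂ) • φ j)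
    (hker : ∀ χ, (∀ j, inner ℂ (φ j) χ = (0 : ℂ)) → noLossOp p ψ lam χ = 0)
    (hymin : 0 < ymin) (hy : ∀ j, ymin ≤ y j ∧ y j ≤ 1) (hC : 1 ≤ C)
    (hCδ : Real.exp C * lossProb p ψ lam ≤ 1) :
    ENNReal.ofReal (∑ j, Real.negMulLog (y j)
        - (1 + lossProb p ψ lam / ymin) * lossProb p ψ lam
        + (C - 1) * (lossProb p ψ lam - caughtProb p ψ lam φ))
      ≤ entropy (lossOp p ψ lam 0) := by
  obtain ⟨κ, b, hb⟩ := exists_hilbertBasis_sum hφ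
  set δ := lossProb p ψ lam with hδ
  set X := lossOp p ψ lam 0 with hX
  set Z := lossOp p ψ lam 1 with hZ
  have hXZ : ∀ χ, X χ = noLossOp p ψ lam χ + Z χ := fun χ => by
    rw [hX, lossOp_eq_add hp h0 h1 0]; rfl
  have hpos := lossOp_zero_isPositive (ψ := ψ) hp h0 h1
  have hle := norm_lossOp_zero_le_one hp hsum hψ h0 h1
  have hδ0 : 0 ≤ δ := lossProb_nonneg hp lam
  have hZ0 : ∀ χ, 0 ≤ (inner ℂ χ (Z χ)).re := re_inner_lossOp_nonneg hp h0 h1 1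
  have hZsq : ∀ χ, ‖Z χ‖ ^ 2 ≤ δ * (inner ℂ χ (Z χ)).re := fun χ => by
    rw [hδ, ← (hasSum_lossProb (ψ := ψ) hp h0 h1).tsum_eq]
    exact norm_gramOp_apply_sq_le (summable_loss hp h0 h1 1) χ
  have hdecomp := tsum_inner_lossOp_compl (ψ := ψ) hp h0 h1 b hb
  rw [← hδ] at hdecomp
  set z := caughtProb p ψ lam φ with hz
  have hz0 : 0 ≤ z := Finset.sum_nonneg fun j _ => hZ0 _
  have hzδ : z ≤ δ := by
    rw [← ENNReal.ofReal_le_ofReal_iff hδ0, ← hdecomp]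
    exact le_self_add
  have hcompl : ∑' k, ENNReal.ofReal (inner ℂ (b (Sum.inr k)) (Z (b (Sum.inr k)))).re
      = ENNReal.ofReal (δ - z) := by
    rw [ENNReal.ofReal_sub _ hz0, ← hdecomp, ENNReal.add_sub_cancel_left ENNReal.ofReal_ne_top]
  rw [entropy_eq_sum_add_tsum hpos hle b]
  have hfirst : ∑ j, Real.negMulLog (y j) - (1 + δ / ymin) * δ
      ≤ ∑ j, entropyDiag X (b (Sum.inl j)) := by
    have h2 : ∀ j, Real.negMulLog (y j) - (1 + δ / ymin) * (inner ℂ (φ j) (Z (φ j))).re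
        ≤ entropyDiag X (b (Sum.inl j)) := fun j => by
      have hyj : 0 < y j := hymin.trans_le (hy j).1
      have hdiff : X (φ j) - (y j : ℂ) • φ j = Z (φ j) := by
        rw [hXZ, hY, add_sub_cancel_left]
      have hre : (inner ℂ (φ j) (X (φ j))).re - y j = (inner ℂ (φ j) (Z (φ j))).re := by
        rw [← hdiff, inner_sub_right, inner_smul_right, inner_self_eq_norm_sq_to_K, hφ.1 j]
        simp
      have h3 := tangent_sub_le_entropyDiag hpos hle hyj (hφ.1 j)
      rw [hre, hdiff] at h3
      rw [hb]
      refine le_trans ?_ h3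
      have h4 : 0 ≤ -Real.log (y j) := by
        have := Real.log_nonpos hyj.le (hy j).2
        linarith
      have h5 : ‖Z (φ j)‖ ^ 2 / y j ≤ δ / ymin * (inner ℂ (φ j) (Z (φ j))).re := by
        calc ‖Z (φ j)‖ ^ 2 / y j ≤ (δ * (inner ℂ (φ j) (Z (φ j))).re) / ymin :=
              div_le_div₀ (mul_nonneg hδ0 (hZ0 _)) (hZsq _) hymin (hy j).1
          _ = _ := by ring
      have h6 := mul_nonneg h4 (hZ0 (φ j))
      linarith
    calc ∑ j, Real.negMulLog (y j) - (1 + δ / ymin) * δ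
        ≤ ∑ j, Real.negMulLog (y j) - (1 + δ / ymin) * z := by gcongr
      _ = ∑ j, (Real.negMulLog (y j) - (1 + δ / ymin) * (inner ℂ (φ j) (Z (φ j))).re) := by
          rw [Finset.sum_sub_distrib, ← Finset.mul_sum]; rfl
      _ ≤ _ := Finset.sum_le_sum fun j _ => h2 j
  have hsecond : ENNReal.ofReal ((C - 1) * (δ - z))
      ≤ ∑' k, ENNReal.ofReal (entropyDiag X (b (Sum.inr k))) := by
    rw [ENNReal.ofReal_mul (by linarith), ← hcompl, ← ENNReal.tsum_mul_left]
    refine ENNReal.tsum_le_tsum fun k => ?_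
    rw [← ENNReal.ofReal_mul (by linarith)]
    refine ENNReal.ofReal_le_ofReal ?_
    have hXb : X (b (Sum.inr k)) = Z (b (Sum.inr k)) := by
      rw [hXZ, hker, zero_add]
      intro j
      rw [← hb]
      exact b.orthonormal.2 (by simp)
    have h3 := linear_sub_le_entropyDiag hpos hle C (b (Sum.inr k))
    rw [hXb] at h3
    refine le_trans ?_ h3
    have h4 := mul_le_mul_of_nonneg_left (hZsq (b (Sum.inr k))) (Real.exp_pos C).le
    have h5 := mul_le_mul_of_nonneg_right hCδ (hZ0 (b (Sum.inr k)))
    nlinarith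
  calc _ ≤ ENNReal.ofReal (∑ j, Real.negMulLog (y j) - (1 + δ / ymin) * δ)
        + ENNReal.ofReal ((C - 1) * (δ - z)) := ENNReal.ofReal_add_le
    _ ≤ _ := add_le_add (ENNReal.ofReal_le_ofReal hfirst) hsecond

/-- The probability of a loss tends to zero at short times. -/
theorem tendsto_lossProb (p : Fin d → ℝ) (ψ : Fin d → Mode) :
    Tendsto (fun t : ℝ => lossProb p ψ (Real.exp (-t))) (𝓝[>] 0) (𝓝 0) := by
  have hnorm : ∀ χ : Mode, Tendsto (fun t : ℝ => ‖kraus (Real.exp (-t)) 0 χ‖ ^ 2) (𝓝[>] 0)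
      (𝓝 (‖χ‖ ^ 2)) := fun χ => by
    have h := tendsto_tsum_of_dominated_convergence (𝓕 := 𝓝[>] (0 : ℝ))
      (f := fun (t : ℝ) m => Real.exp (-t) ^ m * ‖χ m‖ ^ 2) (g := fun m => ‖χ m‖ ^ 2)
      (bound := fun m => ‖χ m‖ ^ 2) (summable_norm_sq χ) (fun m => ?_) ?_
    · rw [(hasSum_norm_sq χ).tsum_eq] at h
      refine h.congr' ?_
      filter_upwards [self_mem_nhdsWithin] with t (ht : 0 < t)
      rw [← (hasSum_norm_sq (kraus (Real.exp (-t)) 0 χ)).tsum_eq]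
      refine tsum_congr fun m => ?_
      rw [norm_kraus_apply_sq (Real.exp_pos _).le (exp_neg_le_one ht.le)]
      simp
    · have : Continuous fun t : ℝ => Real.exp (-t) ^ m * ‖χ m‖ ^ 2 := by fun_prop
      have h2 := (this.tendsto 0).mono_left (nhdsWithin_le_nhds (s := Set.Ioi 0))
      simpa using h2
    · filter_upwards [self_mem_nhdsWithin] with t (ht : 0 < t) m
      rw [Real.norm_of_nonneg (by positivity)]
      exact mul_le_of_le_one_left (by positivity)
        (pow_le_one₀ (Real.exp_pos _).le (exp_neg_le_one ht.le))
  have h2 : Tendsto (fun t : ℝ => ∑ i, p i * (‖ψ i‖ ^ 2 - ‖kraus (Real.exp (-t)) 0 (ψ i)‖ ^ 2))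
      (𝓝[>] 0) (𝓝 (∑ i, p i * (‖ψ i‖ ^ 2 - ‖ψ i‖ ^ 2))) :=
    tendsto_finsetSum _ fun i _ => ((tendsto_const_nhds.sub (hnorm (ψ i))).const_mul (p i))
  simp only [sub_self, mul_zero, Finset.sum_const_zero] at h2
  refine h2.congr' ?_
  filter_upwards [self_mem_nhdsWithin] with t (ht : 0 < t)
  exact (lossProb_eq (Real.exp_pos _).le (exp_neg_le_one ht.le)).symm

/-- If a fixed fraction of the lost photons takes the output out of the support of its no-loss part,
and the loss probability grows at least linearly in time, then the entropy grows infinitely fast,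
as `- δ ln δ` does in the loss probability `δ`. -/
theorem hasRightDeriv_entropy_top (hψ : Orthonormal ℂ ψ) (hp : ∀ i, 0 < p i)
    (hsum : ∑ i, p i = 1) {c c' : ℝ} (hc : 0 < c) (hc' : 0 < c')
    (hlin : ∀ᶠ t in 𝓝[>] (0 : ℝ), c' * t ≤ lossProb p ψ (Real.exp (-t)))
    (hleak : ∀ᶠ t in 𝓝[>] (0 : ℝ), ∀ φ : Fin d → Mode, Orthonormal ℂ φ →
      (∀ j, φ j ∈ (Submodule.span ℂ (Set.range ψ)).map
        (kraus (Real.exp (-t)) 0 : Mode →ₗ[ℂ] Mode)) →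
      c * lossProb p ψ (Real.exp (-t))
        ≤ lossProb p ψ (Real.exp (-t)) - caughtProb p ψ (Real.exp (-t)) φ) :
    HasRightDeriv (fun t : ℝ => (entropy (attenuator (Real.exp (-t))
      (∑ i, (p i : ℂ) • InnerProductSpace.rankOne ℂ (ψ i) (ψ i))) : EReal)) ⊤ 0 := by
  have hp' : ∀ i, 0 ≤ p i := fun i => (hp i).le
  obtain ⟨ymin, hymin, hspec⟩ := exists_noLoss_spectral_decomposition hψ hp hsum
  rw [HasRightDeriv, EReal.tendsto_nhds_top_iff_real]
  intro M
  -- large enough for the gain `(C - 1) c δ` to exceed all losses of order `δ` by `(|M| + 1) t`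
  set C : ℝ := 1 + (1 + 1 / ymin + |Real.log ymin| + (|M| + 1) / c') / c with hC
  have hCnum : 0 ≤ 1 + 1 / ymin + |Real.log ymin| + (|M| + 1) / c' := by positivity
  have hC1 : 1 ≤ C := by
    rw [hC]
    have := div_nonneg hCnum hc.le
    linarith
  have hsmall : ∀ᶠ t in 𝓝[>] (0 : ℝ), lossProb p ψ (Real.exp (-t)) < Real.exp (-C) :=
    (tendsto_lossProb p ψ).eventually_lt_const (Real.exp_pos _)
  filter_upwards [hlin, hleak, hsmall, eventually_mem_Ioc (zero_lt_one)]
    with t hlin hleak hsmall ⟨ht0, ht1⟩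
  have e0 := (Real.exp_pos (-t)).le
  have e1 := exp_neg_le_one ht0.le
  obtain ⟨φ, y, hφ, hφmem, hY, hker, hy, hent⟩ := hspec t ht0.le ht1
  have hδ0 : 0 ≤ lossProb p ψ (Real.exp (-t)) := lossProb_nonneg hp' _
  have hlk := hleak φ hφ hφmem
  set lam := Real.exp (-t)
  set δ := lossProb p ψ lam
  have hCδ : Real.exp C * δ ≤ 1 := by
    calc Real.exp C * δ ≤ Real.exp C * Real.exp (-C) := by gcongr
      _ = 1 := by rw [← Real.exp_add, add_neg_cancel, Real.exp_zero]
  have hδ1 : δ ≤ 1 := hsmall.le.trans (Real.exp_le_one_iff.2 (by linarith))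
  have hlow := le_entropy_output hp' hsum hψ e0 e1 hφ hY hker hymin hy hC1 hCδ
  set S₀ := ∑ i, Real.negMulLog (p i) with hS₀
  have hgain : S₀ + (|M| + 1) * t ≤ ∑ j, Real.negMulLog (y j) - (1 + δ / ymin) * δ
      + (C - 1) * (δ - caughtProb p ψ lam φ) := by
    have h1 : (C - 1) * (c * δ) = (1 + 1 / ymin + |Real.log ymin| + (|M| + 1) / c') * δ := by
      rw [hC]; field_simp; ring
    have h2 : (C - 1) * (c * δ) ≤ (C - 1) * (δ - caughtProb p ψ lam φ) :=
      mul_le_mul_of_nonneg_left hlk (by linarith)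
    have h3 : (|M| + 1) * t ≤ (|M| + 1) / c' * δ := by
      rw [div_mul_eq_mul_div, le_div_iff₀ hc']
      have := mul_le_mul_of_nonneg_left hlin (by positivity : 0 ≤ |M| + 1)
      linarith
    have h4 : δ / ymin * δ ≤ 1 / ymin * δ := by gcongr
    linarith
  have hval : ((S₀ + (|M| + 1) * t : ℝ) : EReal)
      ≤ (entropy (attenuator lam (∑ i, (p i : ℂ) • InnerProductSpace.rankOne ℂ (ψ i) (ψ i))) :
        EReal) := by
    rw [attenuator_eq_gramOp hp' e0 e1, ← lossOp_zero]
    have h1 : (((ENNReal.ofReal (S₀ + (|M| + 1) * t) : ENNReal)) : EReal)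
        ≤ (entropy (lossOp p ψ lam 0) : EReal) :=
      EReal.coe_ennreal_le_coe_ennreal_iff.2 ((ENNReal.ofReal_le_ofReal hgain).trans hlow)
    refine le_trans ?_ h1
    rw [EReal.coe_ennreal_ofReal]
    exact EReal.coe_le_coe_iff.2 (le_max_left _ _)
  have hS0 : (entropy (attenuator (Real.exp (-0))
      (∑ i, (p i : ℂ) • InnerProductSpace.rankOne ℂ (ψ i) (ψ i))) : EReal) = (S₀ : EReal) := by
    rw [attenuator_exp_zero_eq, entropy_of_spectral_decomposition hp hsum hψ,
      EReal.coe_ennreal_ofReal, max_eq_left]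
    exact negMulLog_eigenvalue_nonneg hp hsum
  rw [hS0]
  calc (M : EReal) < ((|M| + 1 : ℝ) : EReal) :=
        EReal.coe_lt_coe_iff.2 ((le_abs_self M).trans_lt (lt_add_one _))
    _ = (((S₀ + (|M| + 1) * t : ℝ) : EReal) - (S₀ : EReal)) / ((t - 0 : ℝ) : EReal) := by
        rw [← EReal.coe_sub, ← EReal.coe_div]
        congr 1
        rw [sub_zero, add_sub_cancel_left, mul_div_assoc, div_self ht0.ne', mul_one]
    _ ≤ _ := EReal.div_le_div_right_of_nonneg
        (EReal.coe_nonneg.2 (by linarith)) (EReal.sub_le_sub hval le_rfl)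

end leak

/-! ### Finite mean photon number without invariance -/

section bessel

variable {d : ℕ} {p : Fin d → ℝ} {ψ : Fin d → Mode} {lam : ℝ}

theorem norm_sub_sum_inner_smul_sq {φ : Fin d → Mode} (hφ : Orthonormal ℂ φ) (z : Mode) :
    ‖z - ∑ j, (inner ℂ (φ j) z : ℂ) • φ j‖ ^ 2 = ‖z‖ ^ 2 - ∑ j, ‖(inner ℂ z (φ j) : ℂ)‖ ^ 2 := by
  have h : (inner ℂ z (∑ j, (inner ℂ (φ j) z : ℂ) • φ j) : ℂ)
      = ((∑ j, ‖(inner ℂ z (φ j) : ℂ)‖ ^ 2 : ℝ) : ℂ) := by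
    rw [inner_sum]
    push_cast
    refine Finset.sum_congr rfl fun j _ => ?_
    rw [inner_smul_right, ← inner_conj_symm (φ j) z, mul_comm, Complex.mul_conj,
      Complex.normSq_eq_norm_sq]
    norm_cast
  rw [@norm_sub_sq ℂ, h, norm_sq_sum_smul hφ, RCLike.re_to_complex, Complex.ofReal_re]
  simp only [norm_inner_symm z]
  ring

/-- The loss events are weighted by the squared distance of their output from the span of the
`φ j`. -/
theorem hasSum_leak (hp : ∀ i, 0 ≤ p i) (h0 : 0 ≤ lam) (h1 : lam ≤ 1) {φ : Fin d → Mode}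
    (hφ : Orthonormal ℂ φ) :
    HasSum (fun s : ℕ × Fin d => ‖outVec p ψ lam (s.1 + 1, s.2)
        - ∑ j, (inner ℂ (φ j) (outVec p ψ lam (s.1 + 1, s.2)) : ℂ) • φ j‖ ^ 2)
      (lossProb p ψ lam - caughtProb p ψ lam φ) := by
  simp only [norm_sub_sum_inner_smul_sq hφ]
  exact (hasSum_lossProb hp h0 h1).sub (hasSum_sum fun j _ =>
    hasSum_re_inner_gramOp_self (summable_loss hp h0 h1 1) (φ j))

theorem caughtProb_nonneg (hp : ∀ i, 0 ≤ p i) (h0 : 0 ≤ lam) (h1 : lam ≤ 1) (φ : Fin d → Mode) :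
    0 ≤ caughtProb p ψ lam φ :=
  Finset.sum_nonneg fun _ _ => re_inner_lossOp_nonneg hp h0 h1 1 _

theorem half_le_one_sub_exp_neg {x : ℝ} (h0 : 0 ≤ x) (h1 : x ≤ 1) : x / 2 ≤ 1 - Real.exp (-x) := by
  have h2 : Real.exp (-x) ≤ 1 / (1 + x) := by
    rw [Real.exp_neg, ← one_div]
    exact one_div_le_one_div_of_le (by linarith) (by linarith [Real.add_one_le_exp x])
  have h3 : 1 / (1 + x) ≤ 1 - x / 2 := by
    rw [div_le_iff₀ (by linarith)]
    nlinarith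
  linarith

theorem lossProb_le (hp : ∀ i, 0 ≤ p i) {χ : Fin d → Mode} (hχ : ∀ j, IsLowering (ψ j) (χ j))
    {t : ℝ} (ht : 0 ≤ t) :
    lossProb p ψ (Real.exp (-t)) ≤ (∑ i, p i * ‖χ i‖ ^ 2) * t := by
  have e0 := (Real.exp_pos (-t)).le
  have e1 := exp_neg_le_one ht
  rw [lossProb, Finset.sum_mul]
  refine Finset.sum_le_sum fun i _ => ?_
  rw [mul_assoc]
  refine mul_le_mul_of_nonneg_left ?_ (hp i)
  refine hasSum_le (fun l => ?_) (hasSum_norm_kraus_succ_sq e0 e1 (ψ i)).summable.hasSum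
    ((hasSum_norm_kraus_sq e0 e1 (χ i)).mul_right t)
  rw [kraus_succ_of_isLowering e0 e1 (hχ i), norm_smul, mul_pow, mul_comm]
  refine mul_le_mul_of_nonneg_left ?_ (by positivity)
  rw [Complex.norm_real, Real.norm_eq_abs, sq_abs, neg_sq, div_pow, Real.sq_sqrt (by linarith),
    Real.sq_sqrt (by positivity)]
  refine (div_le_self (by linarith) ?_).trans (by linarith [Real.add_one_le_exp (-t)])
  push_cast
  linarith [Nat.cast_nonneg (α := ℝ) l]

/-- Infinite entropy production when the mean photon number is finite, and the ladder operator does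
not preserve the support: the loss of a single photon already leaves the support at a finite
rate. -/
theorem hasRightDeriv_entropy_top_of_notMem (hψ : Orthonormal ℂ ψ) (hp : ∀ i, 0 < p i)
    (hsum : ∑ i, p i = 1) {χ : Fin d → Mode} (hχ : ∀ j, IsLowering (ψ j) (χ j)) {j₀ : Fin d}
    (hj₀ : χ j₀ ∉ Submodule.span ℂ (Set.range ψ)) :
    HasRightDeriv (fun t : ℝ => (entropy (attenuator (Real.exp (-t))
      (∑ i, (p i : ℂ) • InnerProductSpace.rankOne ℂ (ψ i) (ψ i))) : EReal)) ⊤ 0 := by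
  have hp' : ∀ i, 0 ≤ p i := fun i => (hp i).le
  set V := Submodule.span ℂ (Set.range ψ) with hV
  have hfin : FiniteDimensional ℂ V := FiniteDimensional.span_of_finite ℂ (Set.finite_range ψ)
  obtain ⟨c, hc, hcW⟩ := exists_le_norm_kraus_zero (V ⊔ Submodule.span ℂ {χ j₀})
  set ζ := Metric.infDist (χ j₀) (V : Set Mode) with hζ
  have hζ0 : 0 < ζ :=
    (V.closed_of_finiteDimensional.notMem_iff_infDist_pos ⟨0, V.zero_mem⟩).1 hj₀
  have hdist : ∀ a : ℂ, ∀ v ∈ V, ‖a‖ * ζ ≤ ‖a • χ j₀ - v‖ := fun a v hv => by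
    by_cases ha : a = 0
    · rw [ha, norm_zero, zero_mul]; positivity
    · have h1 : a • χ j₀ - v = a • (χ j₀ - a⁻¹ • v) := by
        rw [smul_sub, smul_smul, mul_inv_cancel₀ ha, one_smul]
      rw [h1, norm_smul]
      refine mul_le_mul_of_nonneg_left ?_ (norm_nonneg _)
      rw [← dist_eq_norm]
      exact Metric.infDist_le_dist_of_mem (V.smul_mem _ hv)
  set k := c ^ 2 * ζ ^ 2 * p j₀ / 2 with hk
  have hk0 : 0 < k := by have := hp j₀; positivity
  set K := ∑ i, p i * ‖χ i‖ ^ 2 with hK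
  have hK0 : 0 ≤ K := Finset.sum_nonneg fun i _ => mul_nonneg (hp' i) (by positivity)
  have hleak : ∀ t : ℝ, 0 < t → t ≤ 1 → ∀ φ : Fin d → Mode, Orthonormal ℂ φ →
      (∀ j, φ j ∈ V.map (kraus (Real.exp (-t)) 0 : Mode →ₗ[ℂ] Mode)) →
      k * t ≤ lossProb p ψ (Real.exp (-t)) - caughtProb p ψ (Real.exp (-t)) φ := by
    intro t ht0 ht1 φ hφ hmem
    have e0 := (Real.exp_pos (-t)).le
    have e1 := exp_neg_le_one ht0.le
    have h1 := le_hasSum (hasSum_leak (ψ := ψ) hp' e0 e1 hφ) (0, j₀) fun _ _ => by positivity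
    refine le_trans ?_ h1
    have hz : outVec p ψ (Real.exp (-t)) (0 + 1, j₀)
        = kraus (Real.exp (-t)) 0 (((-(√(p j₀) * √(1 - Real.exp (-t))) : ℝ) : ℂ) • χ j₀) := by
      rw [outVec, kraus_succ_of_isLowering e0 e1 (hχ j₀), smul_smul, map_smul]
      congr 1
      push_cast
      simp
    obtain ⟨v, hv, hDv⟩ := Submodule.sum_mem (V.map (kraus (Real.exp (-t)) 0 : Mode →ₗ[ℂ] Mode))
      (t := Finset.univ)
      (f := fun j => (inner ℂ (φ j) (outVec p ψ (Real.exp (-t)) (0 + 1, j₀)) : ℂ) • φ j)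
      fun j _ => Submodule.smul_mem _ _ (hmem j)
    change k * t ≤ ‖outVec p ψ (Real.exp (-t)) (0 + 1, j₀)
        - ∑ j, (inner ℂ (φ j) (outVec p ψ (Real.exp (-t)) (0 + 1, j₀)) : ℂ) • φ j‖ ^ 2
    rw [← hDv, hz]
    set a : ℂ := ((-(√(p j₀) * √(1 - Real.exp (-t))) : ℝ) : ℂ) with ha
    have ha2 : ‖a‖ ^ 2 = p j₀ * (1 - Real.exp (-t)) := by
      rw [ha, Complex.norm_real, Real.norm_eq_abs, sq_abs, neg_sq, mul_pow, Real.sq_sqrt (hp' _),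
        Real.sq_sqrt (by linarith)]
    have h2 : c * (‖a‖ * ζ) ≤ ‖kraus (Real.exp (-t)) 0 (a • χ j₀) - kraus (Real.exp (-t)) 0 v‖ := by
      rw [← map_sub]
      refine (mul_le_mul_of_nonneg_left (hdist a v hv) hc.le).trans
        (hcW _ (Submodule.sub_mem _ ?_ ?_) t ht0.le ht1)
      · exact Submodule.mem_sup_right (Submodule.smul_mem _ _ (Submodule.mem_span_singleton_self _))
      · exact Submodule.mem_sup_left hv
    calc k * t = c ^ 2 * ζ ^ 2 * p j₀ * (t / 2) := by rw [hk]; ring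
      _ ≤ c ^ 2 * ζ ^ 2 * p j₀ * (1 - Real.exp (-t)) :=
          mul_le_mul_of_nonneg_left (half_le_one_sub_exp_neg ht0.le ht1)
            (by have := hp' j₀; positivity)
      _ = (c * (‖a‖ * ζ)) ^ 2 := by rw [mul_pow, mul_pow, ha2]; ring
      _ ≤ _ := by gcongr; exact h2
  refine hasRightDeriv_entropy_top hψ hp hsum (c := k / (K + 1)) (c' := k) (by positivity) hk0 ?_ ?_
  · obtain ⟨_, _, hspec⟩ := exists_noLoss_spectral_decomposition hψ hp hsum
    filter_upwards [eventually_mem_Ioc zero_lt_one] with t ⟨ht0, ht1⟩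
    obtain ⟨φ, -, hφ, hmem, -⟩ := hspec t ht0.le ht1
    have h1 := hleak t ht0 ht1 φ hφ hmem
    have h2 := caughtProb_nonneg (ψ := ψ) hp' (Real.exp_pos (-t)).le (exp_neg_le_one ht0.le) φ
    linarith
  · filter_upwards [eventually_mem_Ioc zero_lt_one] with t ⟨ht0, ht1⟩ φ hφ hmem
    refine le_trans ?_ (hleak t ht0 ht1 φ hφ hmem)
    rw [div_mul_eq_mul_div, div_le_iff₀ (by positivity), mul_assoc]
    refine mul_le_mul_of_nonneg_left ?_ hk0.le
    have := lossProb_le hp' hχ ht0.le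
    linarith

end bessel

/-! ### Infinite mean photon number -/

section infinite

variable {d : ℕ} {p : Fin d → ℝ} {ψ : Fin d → Mode} {lam : ℝ}

/-- The loss probability grows superlinearly when the mean photon number is infinite. -/
theorem eventually_mul_le_lossProb (hp : ∀ i, 0 < p i) {j₀ : Fin d}
    (hj₀ : ¬ Summable fun m : ℕ => (m : ℝ) * ‖ψ j₀ m‖ ^ 2) (K : ℝ) :
    ∀ᶠ t in 𝓝[>] (0 : ℝ), K * t ≤ lossProb p ψ (Real.exp (-t)) := by
  have hp' : ∀ i, 0 ≤ p i := fun i => (hp i).le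
  rw [not_summable_iff_tendsto_nat_atTop_of_nonneg (fun _ => by positivity)] at hj₀
  obtain ⟨N, hN⟩ := (hj₀.eventually_ge_atTop (2 * K / p j₀)).exists
  filter_upwards [eventually_mem_Ioc (ε := 1 / (N + 1 : ℝ)) (by positivity)] with t ⟨ht0, ht1⟩
  have e0 := (Real.exp_pos (-t)).le
  have e1 := exp_neg_le_one ht0.le
  rw [lossProb_eq e0 e1]
  have hterm : ∀ i, 0 ≤ p i * (‖ψ i‖ ^ 2 - ‖kraus (Real.exp (-t)) 0 (ψ i)‖ ^ 2) := fun i => by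
    have := norm_kraus_le e0 e1 0 (ψ i)
    exact mul_nonneg (hp' i) (sub_nonneg.2 (by gcongr))
  refine le_trans ?_ (Finset.single_le_sum (fun i _ => hterm i) (Finset.mem_univ j₀))
  have hs := (hasSum_norm_sq (ψ j₀)).sub (hasSum_norm_sq (kraus (Real.exp (-t)) 0 (ψ j₀)))
  have hval : ∀ m, ‖ψ j₀ m‖ ^ 2 - ‖kraus (Real.exp (-t)) 0 (ψ j₀) m‖ ^ 2
      = (1 - Real.exp (-(m * t))) * ‖ψ j₀ m‖ ^ 2 := fun m => by
    rw [norm_kraus_apply_sq e0 e1, ← Real.exp_nat_mul]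
    simp only [add_zero, Nat.choose_zero_right, Nat.cast_one, pow_zero, mul_one, one_mul, mul_neg]
    ring
  have hpart : t / 2 * ∑ m ∈ Finset.range N, (m : ℝ) * ‖ψ j₀ m‖ ^ 2
      ≤ ‖ψ j₀‖ ^ 2 - ‖kraus (Real.exp (-t)) 0 (ψ j₀)‖ ^ 2 := by
    refine le_trans ?_ (sum_le_hasSum (Finset.range N) (fun m _ => ?_) hs)
    · rw [Finset.mul_sum]
      refine Finset.sum_le_sum fun m hm => ?_
      rw [hval, ← mul_assoc]
      refine mul_le_mul_of_nonneg_right ?_ (by positivity)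
      have hmN : (m : ℝ) ≤ N + 1 := by
        have := Finset.mem_range.1 hm
        exact_mod_cast (by omega : m ≤ N + 1)
      have hmt : (m : ℝ) * t ≤ 1 := by
        calc (m : ℝ) * t ≤ (N + 1) * (1 / (N + 1)) := by gcongr
          _ = 1 := by field_simp
      have := half_le_one_sub_exp_neg (by positivity) hmt
      linarith
    · rw [hval]
      have : Real.exp (-(m * t)) ≤ 1 := exp_neg_le_one (by positivity)
      exact mul_nonneg (by linarith) (by positivity)
  rw [div_le_iff₀ (hp j₀)] at hN
  have h1 := mul_le_mul_of_nonneg_left hpart (hp' j₀)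
  nlinarith

/-- The probability of finding few photons after a loss is at most linear in time. -/
theorem re_inner_fock_lossOp_le (hp : ∀ i, 0 ≤ p i) (hsum : ∑ i, p i = 1) (hψ : Orthonormal ℂ ψ)
    {t : ℝ} (ht0 : 0 ≤ t) (ht1 : t ≤ 1 / 2) (m : ℕ) :
    (inner ℂ (fock m) (lossOp p ψ (Real.exp (-t)) 1 (fock m))).re ≤ 2 ^ (m + 1) * t := by
  have e0 := (Real.exp_pos (-t)).le
  have e1 := exp_neg_le_one ht0
  set lam := Real.exp (-t) with hlam
  have hτ : 1 - lam ≤ t := by linarith [Real.add_one_le_exp (-t)]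
  have h := (hasSum_re_inner_gramOp_self (summable_loss (ψ := ψ) hp e0 e1 1)
    (fock m)).prod_fiberwise (fun l => hasSum_fintype _)
  have hs : ∀ i, Summable fun l => ‖ψ i (m + (l + 1))‖ ^ 2 := fun i =>
    (summable_norm_sq (ψ i)).comp_injective (i := fun l => m + (l + 1)) fun a b hab => by
      simpa using hab
  have hbound : HasSum (fun l => ∑ i, p i * (2 ^ (m + 1) * t * ‖ψ i (m + (l + 1))‖ ^ 2))
      (∑ i, p i * (2 ^ (m + 1) * t * ∑' l, ‖ψ i (m + (l + 1))‖ ^ 2)) :=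
    hasSum_sum fun i _ => ((hs i).hasSum.mul_left _).mul_left _
  refine (hasSum_le (fun l => ?_) h hbound).trans ?_
  · refine Finset.sum_le_sum fun i _ => ?_
    rw [norm_inner_outVec_sq hp, inner_fock_left, norm_kraus_apply_sq e0 e1]
    refine mul_le_mul_of_nonneg_left (mul_le_mul_of_nonneg_right ?_ (by positivity)) (hp i)
    have hch : ((m + (l + 1)).choose (l + 1) : ℝ) ≤ 2 ^ (m + (l + 1)) := by
      exact_mod_cast Nat.choose_le_two_pow _ _
    have hτ0 : 0 ≤ 1 - lam := by linarith
    -- the factor `2 ^ l` in the binomial coefficient is compensated by `(1 - λ) ^ l`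
    have hpow : (2 * (1 - lam)) ^ l ≤ 1 := pow_le_one₀ (by linarith) (by linarith)
    calc ((m + (l + 1)).choose (l + 1) : ℝ) * lam ^ m * (1 - lam) ^ (l + 1)
        ≤ 2 ^ (m + (l + 1)) * 1 * (1 - lam) ^ (l + 1) := by
          gcongr
          exact pow_le_one₀ e0 e1
      _ = 2 ^ (m + 1) * (1 - lam) * (2 * (1 - lam)) ^ l := by rw [mul_pow]; ring
      _ ≤ 2 ^ (m + 1) * t * 1 := by gcongr
      _ = 2 ^ (m + 1) * t := mul_one _
  · calc ∑ i, p i * (2 ^ (m + 1) * t * ∑' l, ‖ψ i (m + (l + 1))‖ ^ 2)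
        ≤ ∑ i, p i * (2 ^ (m + 1) * t * 1) := by
          refine Finset.sum_le_sum fun i _ => mul_le_mul_of_nonneg_left
            (mul_le_mul_of_nonneg_left ?_ (by positivity)) (hp i)
          calc ∑' l, ‖ψ i (m + (l + 1))‖ ^ 2 ≤ ∑' n, ‖ψ i n‖ ^ 2 :=
                (hs i).tsum_le_tsum_of_inj (fun l => m + (l + 1))
                  (fun a b hab => by simpa using hab) (fun _ _ => by positivity)
                  (fun _ => le_rfl) (summable_norm_sq (ψ i))
            _ = 1 := by rw [(hasSum_norm_sq (ψ i)).tsum_eq, hψ.1 i, one_pow]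
      _ = 2 ^ (m + 1) * t := by rw [← Finset.sum_mul, hsum]; ring

/-- Splitting of an inner product at photon number `M`. -/
theorem norm_inner_sq_le_split {φ : Mode} (hφ : ‖φ‖ = 1) (z : Mode) (M : ℕ) :
    ‖(inner ℂ z φ : ℂ)‖ ^ 2 ≤ 2 * ∑ m ∈ Finset.range M, ‖z m‖ ^ 2
      + 2 * (∑' m, ‖φ (m + M)‖ ^ 2) * ‖z‖ ^ 2 := by
  set S := weightedShift M (fun _ => 1) (fun _ => norm_one.le) with hS
  have hSapply : ∀ (χ : Mode) m, S χ m = χ (m + M) := fun χ m => one_mul _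
  have hSz : ‖S z‖ ^ 2 ≤ ‖z‖ ^ 2 := by
    rw [← (hasSum_norm_sq (S z)).tsum_eq, ← (hasSum_norm_sq z).tsum_eq]
    refine (hasSum_norm_sq (S z)).summable.tsum_le_tsum_of_inj (fun m => m + M)
      (add_left_injective M) (fun _ _ => by positivity) (fun m => ?_) (summable_norm_sq z)
    rw [hSapply]
  have hsplit : (inner ℂ z φ : ℂ)
      = ∑ m ∈ Finset.range M, inner ℂ (z m) (φ m) + inner ℂ (S z) (S φ) := by
    have h1 := lp.hasSum_inner (𝕜 := ℂ) z φ
    have h2 := lp.hasSum_inner (𝕜 := ℂ) (S z) (S φ)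
    simp only [hSapply] at h2
    rw [← h1.tsum_eq, ← h2.tsum_eq, h1.summable.sum_add_tsum_nat_add]
  have hlow : ‖∑ m ∈ Finset.range M, (inner ℂ (z m) (φ m) : ℂ)‖ ^ 2
      ≤ ∑ m ∈ Finset.range M, ‖z m‖ ^ 2 := by
    have h1 : ‖∑ m ∈ Finset.range M, (inner ℂ (z m) (φ m) : ℂ)‖
        ≤ ∑ m ∈ Finset.range M, ‖z m‖ * ‖φ m‖ :=
      (norm_sum_le _ _).trans (Finset.sum_le_sum fun m _ => norm_inner_le_norm _ _)
    have h2 : ∑ m ∈ Finset.range M, ‖φ m‖ ^ 2 ≤ 1 := by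
      have := sum_le_hasSum (Finset.range M) (fun _ _ => by positivity) (hasSum_norm_sq φ)
      rwa [hφ, one_pow] at this
    calc _ ≤ (∑ m ∈ Finset.range M, ‖z m‖ * ‖φ m‖) ^ 2 := by gcongr
      _ ≤ (∑ m ∈ Finset.range M, ‖z m‖ ^ 2) * ∑ m ∈ Finset.range M, ‖φ m‖ ^ 2 :=
          Finset.sum_mul_sq_le_sq_mul_sq _ _ _
      _ ≤ (∑ m ∈ Finset.range M, ‖z m‖ ^ 2) * 1 :=
          mul_le_mul_of_nonneg_left h2 (Finset.sum_nonneg fun _ _ => by positivity)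
      _ = _ := mul_one _
  have hhigh : ‖(inner ℂ (S z) (S φ) : ℂ)‖ ^ 2 ≤ (∑' m, ‖φ (m + M)‖ ^ 2) * ‖z‖ ^ 2 := by
    have h1 : ‖S φ‖ ^ 2 = ∑' m, ‖φ (m + M)‖ ^ 2 := by
      rw [← (hasSum_norm_sq (S φ)).tsum_eq]
      simp only [hSapply]
    calc _ ≤ (‖S z‖ * ‖S φ‖) ^ 2 := by gcongr; exact norm_inner_le_norm _ _
      _ = ‖S φ‖ ^ 2 * ‖S z‖ ^ 2 := by ring
      _ ≤ _ := by rw [h1]; gcongr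
  calc ‖(inner ℂ z φ : ℂ)‖ ^ 2
      ≤ (‖∑ m ∈ Finset.range M, (inner ℂ (z m) (φ m) : ℂ)‖ + ‖(inner ℂ (S z) (S φ) : ℂ)‖) ^ 2 := by
        rw [hsplit]; gcongr; exact norm_add_le _ _
    _ ≤ 2 * (‖∑ m ∈ Finset.range M, (inner ℂ (z m) (φ m) : ℂ)‖ ^ 2
          + ‖(inner ℂ (S z) (S φ) : ℂ)‖ ^ 2) := add_sq_le
    _ ≤ _ := by linarith

/-- Infinite entropy production when the mean photon number is infinite: the many lost photons
come from components with a large photon number, on which the no-loss part is small. -/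
theorem hasRightDeriv_entropy_top_of_not_summable (hψ : Orthonormal ℂ ψ) (hp : ∀ i, 0 < p i)
    (hsum : ∑ i, p i = 1) {j₀ : Fin d}
    (hj₀ : ¬ Summable fun m : ℕ => (m : ℝ) * ‖ψ j₀ m‖ ^ 2) :
    HasRightDeriv (fun t : ℝ => (entropy (attenuator (Real.exp (-t))
      (∑ i, (p i : ℂ) • InnerProductSpace.rankOne ℂ (ψ i) (ψ i))) : EReal)) ⊤ 0 := by
  have hp' : ∀ i, 0 ≤ p i := fun i => (hp i).le
  set V := Submodule.span ℂ (Set.range ψ) with hV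
  have hfin : FiniteDimensional ℂ V := FiniteDimensional.span_of_finite ℂ (Set.finite_range ψ)
  obtain ⟨c, hc, hcV⟩ := exists_le_norm_kraus_zero V
  set w : ℕ → ℝ := fun m => ∑ i, ‖ψ i m‖ ^ 2 with hw
  have hws : Summable w := summable_sum fun i _ => summable_norm_sq (ψ i)
  have hd : (0 : ℝ) < d := by
    have : 0 < d := j₀.pos
    exact_mod_cast this
  -- beyond photon number `M` the weight of every unit vector of `B_0 V` is at most `1 / (8 d)`
  obtain ⟨M, hM⟩ := ((tendsto_sum_nat_add w).eventually_lt_const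
    (show 0 < c ^ 2 / (8 * d) by positivity)).exists
  set B : ℝ := ∑ m ∈ Finset.range M, 2 ^ (m + 1) with hB
  refine hasRightDeriv_entropy_top hψ hp hsum (c := 1 / 2) (c' := 1) (by norm_num) one_pos
    (eventually_mul_le_lossProb hp hj₀ 1) ?_
  filter_upwards [eventually_mul_le_lossProb hp hj₀ (8 * d * B),
    eventually_mem_Ioc (show (0 : ℝ) < 1 / 2 by norm_num)] with t hlin ⟨ht0, ht1⟩ φ hφ hmem
  have e0 := (Real.exp_pos (-t)).le
  have e1 := exp_neg_le_one ht0.le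
  have hδ0 : 0 ≤ lossProb p ψ (Real.exp (-t)) := lossProb_nonneg hp' _
  have htail : ∀ j, ∑' m, ‖φ j (m + M)‖ ^ 2 ≤ 1 / (8 * d) := fun j => by
    obtain ⟨v, hv, hDv⟩ := hmem j
    have hDv' : kraus (Real.exp (-t)) 0 v = φ j := hDv
    have hcv : c * ‖v‖ ≤ 1 := by
      have := hcV v hv t ht0.le (by linarith)
      rwa [hDv', hφ.1 j] at this
    obtain ⟨a, ha⟩ := (Submodule.mem_span_range_iff_exists_fun ℂ).1 hv
    have hpt : ∀ m, ‖φ j m‖ ^ 2 ≤ (1 / c ^ 2) * w m := fun m => by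
      have h1 : ‖φ j m‖ ^ 2 ≤ ‖v m‖ ^ 2 := by
        rw [← hDv', norm_kraus_apply_sq e0 e1]
        simp only [add_zero, Nat.choose_zero_right, Nat.cast_one, pow_zero, mul_one, one_mul]
        exact mul_le_of_le_one_left (by positivity) (pow_le_one₀ e0 e1)
      have h2 : ‖v m‖ ≤ ∑ i, ‖a i‖ * ‖ψ i m‖ := by
        rw [← ha, lp.coeFn_sum, Finset.sum_apply]
        refine (norm_sum_le _ _).trans (Finset.sum_le_sum fun i _ => ?_)
        rw [lp.coeFn_smul, Pi.smul_apply, norm_smul]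
      have h3 : ∑ i, ‖a i‖ ^ 2 ≤ 1 / c ^ 2 := by
        rw [← norm_sq_sum_smul hψ, ha, le_div_iff₀ (by positivity), ← mul_pow, mul_comm]
        exact pow_le_one₀ (by positivity) hcv
      calc ‖φ j m‖ ^ 2 ≤ (∑ i, ‖a i‖ * ‖ψ i m‖) ^ 2 := h1.trans (by gcongr)
        _ ≤ (∑ i, ‖a i‖ ^ 2) * ∑ i, ‖ψ i m‖ ^ 2 := Finset.sum_mul_sq_le_sq_mul_sq _ _ _
        _ ≤ _ := mul_le_mul_of_nonneg_right h3 (Finset.sum_nonneg fun _ _ => by positivity)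
    calc ∑' m, ‖φ j (m + M)‖ ^ 2 ≤ ∑' m, (1 / c ^ 2) * w (m + M) :=
          Summable.tsum_le_tsum (fun m => hpt (m + M))
            ((summable_nat_add_iff M).2 (summable_norm_sq (φ j)))
            (((summable_nat_add_iff M).2 hws).mul_left _)
      _ = (1 / c ^ 2) * ∑' m, w (m + M) := tsum_mul_left
      _ ≤ (1 / c ^ 2) * (c ^ 2 / (8 * d)) := by gcongr
      _ = 1 / (8 * d) := by field_simp
  have hz : ∀ j, (inner ℂ (φ j) (lossOp p ψ (Real.exp (-t)) 1 (φ j))).re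
      ≤ 2 * (B * t) + 2 * (1 / (8 * d)) * lossProb p ψ (Real.exp (-t)) := fun j => by
    have hs := summable_loss (ψ := ψ) hp' e0 e1 1
    have hfock : ∀ m, HasSum (fun s : ℕ × Fin d =>
        ‖outVec p ψ (Real.exp (-t)) (s.1 + 1, s.2) m‖ ^ 2)
        (inner ℂ (fock m) (lossOp p ψ (Real.exp (-t)) 1 (fock m))).re := fun m => by
      refine (hasSum_re_inner_gramOp_self hs (fock m)).congr_fun fun s => ?_
      rw [norm_inner_symm, inner_fock_left]
    have h1 := hasSum_le (fun s => norm_inner_sq_le_split (hφ.1 j) _ M)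
      (hasSum_re_inner_gramOp_self hs (φ j))
      (((hasSum_sum fun m (_ : m ∈ Finset.range M) => hfock m).mul_left 2).add
        ((hasSum_lossProb (ψ := ψ) hp' e0 e1).mul_left (2 * ∑' m, ‖φ j (m + M)‖ ^ 2)))
    refine h1.trans (add_le_add ?_ ?_)
    · refine mul_le_mul_of_nonneg_left ?_ zero_le_two
      rw [hB, Finset.sum_mul]
      exact Finset.sum_le_sum fun m _ => re_inner_fock_lossOp_le hp' hsum hψ ht0.le ht1 m
    · refine mul_le_mul_of_nonneg_right ?_ hδ0
      exact mul_le_mul_of_nonneg_left (htail j) zero_le_two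
  have hcaught : caughtProb p ψ (Real.exp (-t)) φ
      ≤ d * (2 * (B * t) + 2 * (1 / (8 * d)) * lossProb p ψ (Real.exp (-t))) := by
    have := Finset.sum_le_sum fun j (_ : j ∈ Finset.univ) => hz j
    rwa [Finset.sum_const, Finset.card_univ, Fintype.card_fin, nsmul_eq_mul] at this
  have h4 : d * (2 * (B * t) + 2 * (1 / (8 * d)) * lossProb p ψ (Real.exp (-t)))
      = (8 * d * B * t) / 4 + lossProb p ψ (Real.exp (-t)) / 4 := by
    field_simp
    ring
  linarith

/-- Vectors of finite mean photon number are in the domain of the ladder operator. -/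
theorem exists_isLowering {v : Mode} (h : Summable fun m : ℕ => (m : ℝ) * ‖v m‖ ^ 2) :
    ∃ χ : Mode, IsLowering v χ := by
  have hmem : Memℓp (fun m : ℕ => ((√((m + 1 : ℕ) : ℝ) : ℝ) : ℂ) * v (m + 1)) 2 := by
    refine memℓp_gen ?_
    have h1 : Summable fun m : ℕ => ‖((√((m + 1 : ℕ) : ℝ) : ℝ) : ℂ) * v (m + 1)‖ ^ 2 := by
      refine ((summable_nat_add_iff 1).2 h).congr fun m => ?_
      rw [norm_mul, mul_pow, Complex.norm_real, Real.norm_eq_abs, sq_abs,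
        Real.sq_sqrt (by positivity)]
    simpa using h1
  exact ⟨⟨_, hmem⟩, fun _ => rfl⟩

end infinite

/-- Unless the support is invariant under the ladder operator, the entropy production is
infinite. -/
theorem hasRightDeriv_entropy_top_of_not_isInvariant {d : ℕ} {p : Fin d → ℝ} {ψ : Fin d → Mode}
    (hψ : Orthonormal ℂ ψ) (hp : ∀ i, 0 < p i) (hsum : ∑ i, p i = 1)
    (hinv : ¬ ∃ A, IsInvariant ψ A) :
    HasRightDeriv (fun t : ℝ => (entropy (attenuator (Real.exp (-t))
      (∑ i, (p i : ℂ) • InnerProductSpace.rankOne ℂ (ψ i) (ψ i))) : EReal)) ⊤ 0 := by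
  by_cases hs : ∀ j, Summable fun m : ℕ => (m : ℝ) * ‖ψ j m‖ ^ 2
  · choose χ hχ using fun j => exists_isLowering (hs j)
    by_cases hmem : ∀ j, χ j ∈ Submodule.span ℂ (Set.range ψ)
    · refine absurd ?_ hinv
      choose a ha using fun j => (Submodule.mem_span_range_iff_exists_fun ℂ).1 (hmem j)
      exact ⟨fun i j => a j i, fun j => (ha j).symm ▸ hχ j⟩
    · push Not at hmem
      obtain ⟨j₀, hj₀⟩ := hmem
      exact hasRightDeriv_entropy_top_of_notMem hψ hp hsum hχ hj₀
  · push Not at hs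
    obtain ⟨j₀, hj₀⟩ := hs
    exact hasRightDeriv_entropy_top_of_not_summable hψ hp hsum hj₀

end QuantumAttenuator

end

theorem mainTheorem4 (ρ : QuantumAttenuator.Mode →L[ℂ] QuantumAttenuator.Mode)
    (hρ : QuantumAttenuator.IsState ρ) (hfin : QuantumAttenuator.HasFiniteSupport ρ) :
    QuantumAttenuator.entropy ρ ≠ ⊤ ∧
    ∃ D : EReal,
      QuantumAttenuator.HasRightDeriv
        (fun t : ℝ =>
          (QuantumAttenuator.entropy (QuantumAttenuator.attenuator (Real.exp (-t)) ρ) : EReal))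
        D 0 ∧
      ((QuantumAttenuator.f (QuantumAttenuator.entropy ρ).toReal : ℝ) : EReal) ≤ D := by
  obtain ⟨d, p, ψ, hψ, hp, hanti, hsum, rfl⟩ :=
    QuantumAttenuator.exists_spectral_decomposition hρ hfin
  have hS := QuantumAttenuator.entropy_of_spectral_decomposition hp hsum hψ
  refine ⟨hS ▸ ENNReal.ofReal_ne_top, ?_⟩
  by_cases hinv : ∃ A, QuantumAttenuator.IsInvariant ψ A
  · obtain ⟨A, hA⟩ := hinv
    refine ⟨_, QuantumAttenuator.hasRightDeriv_entropy_of_isInvariant hψ hp hsum hA, ?_⟩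
    rw [hS, ENNReal.toReal_ofReal (QuantumAttenuator.negMulLog_eigenvalue_nonneg hp hsum)]
    exact EReal.coe_le_coe_iff.2 (QuantumAttenuator.f_le_derivative hψ hp hanti hsum hA)
  · exact ⟨⊤, QuantumAttenuator.hasRightDeriv_entropy_top_of_not_isInvariant hψ hp hsum hinv,
      le_top⟩
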